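/- Let $K$ be a field of characteristic zero (for instance $K=\mathbb R$), let $P$ be a Noetherian commutative unital Poisson $K$-algebra, and let $J\subset P$ be a coisotropic ideal, i.e. an ideal with $\{J,J\}\subset J$. Let $\mathcal M=\bigoplus_{n\ge 1}\mathcal M^{-n}$ be a negatively graded $K$-vector space with finite-dimensional homogeneous components, and let $\mathcal M^*$ be its component-wise dual, with $(\mathcal M^{-n})^*$ in degree $n$. Let $\mathrm{Sym}(\mathcal M\oplus\mathcal M^*)$ be the free graded commutative algebra, with the Poisson bracket given by the graded biderivation with $\{x,\alpha\}=\alpha(x)$, $\{\alpha,x\}=-(-1)^{\deg\alpha\deg x}\alpha(x)$ and $\{x,y\}=\{\alpha,\beta\}=0$ for homogeneous $x,y\in\mathcal M$, $\alpha,\beta\in\mathcal M^*$. Let $X_0=P\otimes\mathrm{Sym}(\mathcal M\oplus\mathcal M^*)$ be the tensor product of the two Poisson algebras ($P$ in degree $0$). Let $\mathcal F^pX_0$ be the ideal generated by the homogeneous elements of degree at least $p$, let $I_0=\mathcal F^1X_0$, and let $I_0^{(k)}$ be its $k$-th power. Let $X=\bigoplus_n X^n$ with $X^n=\varprojlim_p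 X_0^n/(\mathcal F^pX_0\cap X_0^n)$, with the inverse limit topology (of discrete spaces) on each $X^n$ and the continuous extension of the bracket. Let $I\subset X$ and $I^{(k)}\subset X$ be the homogeneous ideals whose degree-$n$ components consist of the elements $(x_p+\mathcal F^pX_0\cap X_0^n)_p$ with representatives $x_p\in I_0\cap X_0^n$, respectively $x_p\in I_0^{(k)}\cap X_0^n$. For $R\in X^1$ the derivation $d_R=\{R,-\}$ preserves $I$ and so induces a map on $X/I$. Let $R\in X^1$ be such that $(X,R)$ is a BFV model for $(P,J)$: $\{R,R\}=0$, $H^j(X/I,d_R)=0$ for $j\neq 0$, and $H^0(X/I,d_R)=P/J$ via the canonical map $P\to X^0/I^0$. Let $R'\in X^1$ satisfy $\{R',R'\}=0$, and suppose that $d_R$ and $d_{R'}$ induce the same map on $X/I$. Then there is an element $\gamma\in X^0\cap I^{(2)}$ such that for every $n$ and every $x\in X^n$ the series $\exp(\mathrm{ad}_\gamma)x=\sum_{j\ge0}\frac1{j!}\,\mathrm{ad}_\gamma^j\,x$, where $\mathrm{ad}_\gamma=\{\gamma,-\}$, converges in $X^n$, and such that the resulting gauge equivalence $g=\exp\mathrm{ad}_\gamma$,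 which is linear on each $X^n$, satisfies $R'=gR$. -/

import Mathlib

open scoped TensorProduct

noncomputable section

namespace BFV

universe u v w

/-- A Poisson bracket on a unital commutative `K`-algebra `P`. -/
structure PoissonStructure (K : Type u) (P : Type v) [Field K] [CommRing P] [Algebra K P] where
  bracket : P →ₗ[K] P →ₗ[K] P
  bracket_self : ∀ a, bracket a a = 0
  jacobi : ∀ a b c,
    bracket a (bracket b c) + bracket b (bracket c a) + bracket c (bracket a b) = 0
  leibniz : ∀ a b c, bracket a (b * c) = bracket a b * c + b * bracket a c

/-- An ideal `J` is coisotropic if `{J, J} ⊆ J`. -/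
def IsCoisotropic {K : Type u} {P : Type v} [Field K] [CommRing P] [Algebra K P]
    (π : PoissonStructure K P) (J : Ideal P) : Prop :=
  ∀ a ∈ J, ∀ b ∈ J, π.bracket a b ∈ J

/-- The sign `(-1)^n` as an element of `K`. -/
def sgn (K : Type u) [Field K] (n : ℤ) : K := ((n.negOnePow : ℤ) : K)

section sgn
variable (K : Type u) [Field K]

lemma sgn_add (m n : ℤ) : sgn K (m + n) = sgn K m * sgn K n := by
  simp [sgn, Int.negOnePow_add]

lemma sgn_mul_self (n : ℤ) : sgn K n * sgn K n = 1 := by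
  rw [← sgn_add, sgn, Int.negOnePow_even _ ⟨n, rfl⟩]; simp

lemma sgn_neg (n : ℤ) : sgn K (-n) = sgn K n := by simp [sgn, Int.negOnePow_neg]

lemma sgn_zero : sgn K 0 = 1 := by simp [sgn]

end sgn

section Algebra

variable (K : Type u) [Field K] (M : ℕ+ → Type w) [∀ n, AddCommGroup (M n)] [∀ n, Module K (M n)]

/-- The homogeneous elements of `M ⊕ M*`, where the component `M n` of the negatively graded
vector space `M` sits in degree `-n` and its dual `(M n)*` in degree `n`. -/
inductive Gen : Type (max u w)
  | low (n : ℕ+) (x : M n) : Gen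
  | high (n : ℕ+) (α : Module.Dual K (M n)) : Gen

variable {K M}

/-- The degree of a homogeneous element of `M ⊕ M*`. -/
def Gen.deg : Gen K M → ℤ
  | .low n _ => -(n : ℤ)
  | .high n _ => (n : ℤ)

/-- The bracket of two homogeneous elements of `M ⊕ M*`:
`{x, α} = α(x)`, `{α, x} = -(-1)^{deg α deg x} α(x)`, `{x, y} = 0`, `{α, β} = 0`. -/
def pairing : Gen K M → Gen K M → K
  | .low m x, .high n α => if h : m = n then α (h ▸ x) else 0
  | .high n α, .low m x => if h : m = n then -sgn K ((n : ℤ) * -(m : ℤ)) * α (h ▸ x) else 0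
  | .low _ _, .low _ _ => 0
  | .high _ _, .high _ _ => 0

variable (K M)

/-- The relations of the free graded commutative algebra on `M ⊕ M*`: the generators depend
linearly on the elements of each homogeneous component, and commute up to the Koszul sign. -/
inductive SymRel : FreeAlgebra K (Gen K M) → FreeAlgebra K (Gen K M) → Prop
  | low_add (n : ℕ+) (x y : M n) :
      SymRel (FreeAlgebra.ι K (.low n (x + y)))
        (FreeAlgebra.ι K (.low n x) + FreeAlgebra.ι K (.low n y))
  | low_smul (n : ℕ+) (c : K) (x : M n) :
      SymRel (FreeAlgebra.ι K (.low n (c • x))) (c • FreeAlgebra.ι K (.low n x))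
  | high_add (n : ℕ+) (α β : Module.Dual K (M n)) :
      SymRel (FreeAlgebra.ι K (.high n (α + β)))
        (FreeAlgebra.ι K (.high n α) + FreeAlgebra.ι K (.high n β))
  | high_smul (n : ℕ+) (c : K) (α : Module.Dual K (M n)) :
      SymRel (FreeAlgebra.ι K (.high n (c • α))) (c • FreeAlgebra.ι K (.high n α))
  | comm (g h : Gen K M) :
      SymRel (FreeAlgebra.ι K g * FreeAlgebra.ι K h)
        (sgn K (g.deg * h.deg) • (FreeAlgebra.ι K h * FreeAlgebra.ι K g))

/-- The graded symmetric algebra `Sym(M ⊕ M*)`. -/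
def Sym : Type (max u w) := RingQuot (SymRel K M)

instance : Ring (Sym K M) := inferInstanceAs (Ring (RingQuot (SymRel K M)))

instance : Algebra K (Sym K M) := inferInstanceAs (Algebra K (RingQuot (SymRel K M)))

/-- The quotient map from the free algebra. -/
def symMk : FreeAlgebra K (Gen K M) →ₐ[K] Sym K M := RingQuot.mkAlgHom K (SymRel K M)

variable {K M} in
lemma symMk_rel {a b : FreeAlgebra K (Gen K M)} (h : SymRel K M a b) : symMk K M a = symMk K M b :=
  RingQuot.mkAlgHom_rel K h

variable {K M}

/-- The inclusion of the homogeneous elements of `M ⊕ M*` into `Sym(M ⊕ M*)`. -/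
def gen (g : Gen K M) : Sym K M := symMk K M (FreeAlgebra.ι K g)

lemma gen_low_add (n : ℕ+) (x y : M n) :
    gen (K := K) (.low n (x + y)) = gen (.low n x) + gen (.low n y) := by
  simpa [gen] using symMk_rel (SymRel.low_add (K := K) n x y)

lemma gen_low_smul (n : ℕ+) (c : K) (x : M n) :
    gen (K := K) (.low n (c • x)) = c • gen (.low n x) := by
  simpa [gen] using symMk_rel (SymRel.low_smul (K := K) n c x)

lemma gen_high_add (n : ℕ+) (α β : Module.Dual K (M n)) :
    gen (.high n (α + β)) = gen (.high n α) + gen (.high n β) := by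
  simpa [gen] using symMk_rel (SymRel.high_add (K := K) n α β)

lemma gen_high_smul (n : ℕ+) (c : K) (α : Module.Dual K (M n)) :
    gen (.high n (c • α)) = c • gen (.high n α) := by
  simpa [gen] using symMk_rel (SymRel.high_smul (K := K) n c α)

lemma gen_comm (g h : Gen K M) :
    gen g * gen h = sgn K (g.deg * h.deg) • (gen h * gen g) := by
  simpa [gen] using symMk_rel (SymRel.comm g h)

/-- The universal property of `Sym(M ⊕ M*)`. -/
def symLift {B : Type*} [Ring B] [Algebra K B] (f : Gen K M → B)
    (low_add : ∀ n x y, f (.low n (x + y)) = f (.low n x) + f (.low n y))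
    (low_smul : ∀ n (c : K) x, f (.low n (c • x)) = c • f (.low n x))
    (high_add : ∀ n α β, f (.high n (α + β)) = f (.high n α) + f (.high n β))
    (high_smul : ∀ n (c : K) α, f (.high n (c • α)) = c • f (.high n α))
    (comm : ∀ g h, f g * f h = sgn K (g.deg * h.deg) • (f h * f g)) : Sym K M →ₐ[K] B :=
  RingQuot.liftAlgHom K ⟨FreeAlgebra.lift K f, by
    intro a b hab
    cases hab with
    | low_add n x y => simp [low_add]
    | low_smul n c x => simp [low_smul]
    | high_add n α β => simp [high_add]
    | high_smul n c α => simp [high_smul]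
    | comm g h => simp [comm g h]⟩

lemma symLift_gen {B : Type*} [Ring B] [Algebra K B] (f : Gen K M → B) (h₁ h₂ h₃ h₄ h₅)
    (g : Gen K M) : symLift f h₁ h₂ h₃ h₄ h₅ (gen g) = f g := by
  exact (RingQuot.liftAlgHom_mkAlgHom_apply K _ _ _).trans (by simp)

/-- `Sym(M ⊕ M*)` is spanned by the products of generators. -/
lemma sym_induction {p : Sym K M → Prop} (add : ∀ x y, p x → p y → p (x + y))
    (smul : ∀ (c : K) x, p x → p (c • x)) (one : p 1) (mul : ∀ g x, p x → p (gen g * x))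
    (x : Sym K M) : p x := by
  have key : ∀ a : FreeAlgebra K (Gen K M), ∀ y : Sym K M, p y →
      p (symMk K M a * y) := by
    intro a
    induction a using FreeAlgebra.induction with
    | grade0 r => intro y hy; simpa [Algebra.algebraMap_eq_smul_one] using smul r y hy
    | grade1 g => intro y hy; exact mul g y hy
    | mul a b ha hb => intro y hy; rw [map_mul, mul_assoc]; exact ha _ (hb _ hy)
    | add a b ha hb => intro y hy; rw [map_add, add_mul]; exact add _ _ (ha _ hy) (hb _ hy)
  obtain ⟨a, rfl⟩ : ∃ a, symMk K M a = x := RingQuot.mkAlgHom_surjective K (SymRel K M) x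
  simpa using key a 1 one

lemma pairing_eq_zero (g h : Gen K M) (hgh : g.deg + h.deg ≠ 0) : pairing g h = 0 := by
  cases g <;> cases h <;> simp only [pairing, Gen.deg] at *
  all_goals
    rw [dif_neg]
    rintro rfl
    omega

lemma pairing_low_add_right (g : Gen K M) (n : ℕ+) (x y : M n) :
    pairing g (.low n (x + y)) = pairing g (.low n x) + pairing g (.low n y) := by
  cases g with
  | low m z => simp [pairing]
  | high m α =>
    simp only [pairing]
    split_ifs with h
    · subst h; simp; ring
    · simp

lemma pairing_low_smul_right (g : Gen K M) (n : ℕ+) (c : K) (x : M n) :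
    pairing g (.low n (c • x)) = c * pairing g (.low n x) := by
  cases g with
  | low m z => simp [pairing]
  | high m α =>
    simp only [pairing]
    split_ifs with h
    · subst h; simp; ring
    · simp

lemma pairing_high_add_right (g : Gen K M) (n : ℕ+) (α β : Module.Dual K (M n)) :
    pairing g (.high n (α + β)) = pairing g (.high n α) + pairing g (.high n β) := by
  cases g with
  | high m z => simp [pairing]
  | low m x =>
    simp only [pairing]
    split_ifs with h
    · simp
    · simp

lemma pairing_high_smul_right (g : Gen K M) (n : ℕ+) (c : K) (α : Module.Dual K (M n)) :
    pairing g (.high n (c • α)) = c * pairing g (.high n α) := by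
  cases g with
  | high m z => simp [pairing]
  | low m x =>
    simp only [pairing]
    split_ifs with h
    · simp
    · simp

lemma pairing_low_add_left (g : Gen K M) (n : ℕ+) (x y : M n) :
    pairing (.low n (x + y)) g = pairing (.low n x) g + pairing (.low n y) g := by
  cases g with
  | low m z => simp [pairing]
  | high m α =>
    simp only [pairing]
    split_ifs with h
    · subst h; simp
    · simp

lemma pairing_low_smul_left (g : Gen K M) (n : ℕ+) (c : K) (x : M n) :
    pairing (.low n (c • x)) g = c * pairing (.low n x) g := by
  cases g with
  | low m z => simp [pairing]
  | high m α =>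
    simp only [pairing]
    split_ifs with h
    · subst h; simp
    · simp

lemma pairing_high_add_left (g : Gen K M) (n : ℕ+) (α β : Module.Dual K (M n)) :
    pairing (.high n (α + β)) g = pairing (.high n α) g + pairing (.high n β) g := by
  cases g with
  | high m z => simp [pairing]
  | low m x =>
    simp only [pairing]
    split_ifs with h
    · simp; ring
    · simp

lemma pairing_high_smul_left (g : Gen K M) (n : ℕ+) (c : K) (α : Module.Dual K (M n)) :
    pairing (.high n (c • α)) g = c * pairing (.high n α) g := by
  cases g with
  | high m z => simp [pairing]
  | low m x =>
    simp only [pairing]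
    split_ifs with h
    · simp; ring
    · simp

/-- The endomorphism `(u, v) ↦ (h u, {g, h} u + (-1)^{deg g deg h} h v)`, used to build the graded
derivation `{g, -}`. -/
def derAux (g h : Gen K M) : Module.End K (Sym K M × Sym K M) :=
  LinearMap.prod (LinearMap.mulLeft K (gen h) ∘ₗ LinearMap.fst K _ _)
    (pairing g h • LinearMap.fst K _ _ +
      sgn K (g.deg * h.deg) • (LinearMap.mulLeft K (gen h) ∘ₗ LinearMap.snd K _ _))

lemma derAux_apply (g h : Gen K M) (z : Sym K M × Sym K M) :
    derAux g h z = (gen h * z.1, pairing g h • z.1 + sgn K (g.deg * h.deg) • (gen h * z.2)) := rfl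

lemma derAux_comm (g h k : Gen K M) :
    derAux g h * derAux g k = sgn K (h.deg * k.deg) • (derAux g k * derAux g h) := by
  refine LinearMap.ext fun z => ?_
  have e1 : ∀ h k : Gen K M, pairing g h * sgn K (h.deg * k.deg) * sgn K (g.deg * k.deg)
      = pairing g h := by
    intro h k
    by_cases hg : g.deg + h.deg = 0
    · rw [mul_assoc, show g.deg = - h.deg by omega, neg_mul, sgn_neg, sgn_mul_self, mul_one]
    · simp [pairing_eq_zero g h hg]
  have e2 := e1 h k
  have e3 := e1 k h
  rw [mul_comm k.deg h.deg] at e3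
  have e4 : gen h * (gen k * z.2) = sgn K (h.deg * k.deg) • (gen k * (gen h * z.2)) := by
    rw [← mul_assoc, gen_comm, smul_mul_assoc, mul_assoc]
  refine Prod.ext ?_ ?_
  · simp only [Module.End.mul_apply, LinearMap.smul_apply, derAux_apply, Prod.smul_mk]
    rw [← mul_assoc, gen_comm, smul_mul_assoc, mul_assoc]
  · simp only [Module.End.mul_apply, LinearMap.smul_apply, derAux_apply, Prod.smul_mk,
      mul_add, mul_smul_comm, smul_add, smul_smul, e4]
    rw [← e2, ← e3]
    have s1 := sgn_mul_self K (h.deg * k.deg)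
    have s2 := sgn_mul_self K (g.deg * h.deg)
    have s3 := sgn_mul_self K (g.deg * k.deg)
    match_scalars <;> simp only [mul_one] <;> grind

/-- The algebra map `x ↦ ((u, v) ↦ (x u, {g, x} u ± x v))`. -/
def derHom (g : Gen K M) : Sym K M →ₐ[K] Module.End K (Sym K M × Sym K M) :=
  symLift (derAux g)
    (by
      intro n x y; refine LinearMap.ext fun z => Prod.ext ?_ ?_
      · simp [derAux_apply, gen_low_add, add_mul]
      · simp [derAux_apply, gen_low_add, add_mul, pairing_low_add_right, Gen.deg, add_smul]; abel)
    (by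
      intro n c x; refine LinearMap.ext fun z => Prod.ext ?_ ?_
      · simp [derAux_apply, gen_low_smul]
      · simp [derAux_apply, gen_low_smul, pairing_low_smul_right, Gen.deg, mul_smul,
          smul_comm c])
    (by
      intro n x y; refine LinearMap.ext fun z => Prod.ext ?_ ?_
      · simp [derAux_apply, gen_high_add, add_mul]
      · simp [derAux_apply, gen_high_add, add_mul, pairing_high_add_right, Gen.deg, add_smul]; abel)
    (by
      intro n c x; refine LinearMap.ext fun z => Prod.ext ?_ ?_
      · simp [derAux_apply, gen_high_smul]
      · simp [derAux_apply, gen_high_smul, pairing_high_smul_right, Gen.deg, mul_smul,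
          smul_comm c])
    (derAux_comm g)

/-- The operator `{g, -}` on `Sym(M ⊕ M*)`: the graded derivation of degree `deg g` with
prescribed values on the generators (see `der_one`, `der_gen_mul`). -/
def der (g : Gen K M) : Module.End K (Sym K M) :=
  LinearMap.snd K _ _ ∘ₗ LinearMap.applyₗ ((1 : Sym K M), (0 : Sym K M)) ∘ₗ (derHom g).toLinearMap

lemma derHom_fst (g : Gen K M) (x : Sym K M) (z : Sym K M × Sym K M) :
    (derHom g x z).1 = x * z.1 := by
  induction x using sym_induction generalizing z with
  | add x y hx hy => simp [hx, hy, add_mul]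
  | smul c x hx => simp [hx]
  | one => simp
  | mul h x hx =>
    rw [map_mul, Module.End.mul_apply, derHom, symLift_gen, derAux_apply]
    simp only [← derHom.eq_1, hx, mul_assoc]

lemma der_one (g : Gen K M) : der g 1 = 0 := by simp [der]

lemma der_gen_mul (g h : Gen K M) (x : Sym K M) :
    der g (gen h * x) = pairing g h • x + sgn K (g.deg * h.deg) • (gen h * der g x) := by
  have h1 : derHom g (gen h) = derAux g h := by rw [derHom, symLift_gen]
  simp [der, h1, derAux_apply, derHom_fst]

lemma der_low_add (n : ℕ+) (x y : M n) :
    der (K := K) (.low n (x + y)) = der (.low n x) + der (.low n y) := by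
  refine LinearMap.ext fun s => ?_
  induction s using sym_induction with
  | add x y hx hy => rw [map_add, hx, hy, ← map_add]
  | smul c x hx => rw [map_smul, hx, ← map_smul]
  | one => simp [der_one]
  | mul h s hs =>
    rw [LinearMap.add_apply] at hs ⊢
    rw [der_gen_mul, der_gen_mul, der_gen_mul, hs, pairing_low_add_left]
    simp only [Gen.deg, mul_add, smul_add, add_smul]; abel

lemma der_low_smul (n : ℕ+) (c : K) (x : M n) :
    der (K := K) (.low n (c • x)) = c • der (.low n x) := by
  refine LinearMap.ext fun s => ?_
  induction s using sym_induction with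
  | add x y hx hy => rw [map_add, hx, hy, ← map_add]
  | smul c x hx => rw [map_smul, hx, ← map_smul]
  | one => simp [der_one]
  | mul h s hs =>
    rw [LinearMap.smul_apply] at hs ⊢
    rw [der_gen_mul, der_gen_mul, hs, pairing_low_smul_left]
    simp only [Gen.deg, mul_smul_comm, smul_add, mul_smul, smul_comm c]

lemma der_high_add (n : ℕ+) (x y : Module.Dual K (M n)) :
    der (.high n (x + y)) = der (.high n x) + der (.high n y) := by
  refine LinearMap.ext fun s => ?_
  induction s using sym_induction with
  | add x y hx hy => rw [map_add, hx, hy, ← map_add]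
  | smul c x hx => rw [map_smul, hx, ← map_smul]
  | one => simp [der_one]
  | mul h s hs =>
    rw [LinearMap.add_apply] at hs ⊢
    rw [der_gen_mul, der_gen_mul, der_gen_mul, hs, pairing_high_add_left]
    simp only [Gen.deg, mul_add, smul_add, add_smul]; abel

lemma der_high_smul (n : ℕ+) (c : K) (x : Module.Dual K (M n)) :
    der (.high n (c • x)) = c • der (.high n x) := by
  refine LinearMap.ext fun s => ?_
  induction s using sym_induction with
  | add x y hx hy => rw [map_add, hx, hy, ← map_add]
  | smul c x hx => rw [map_smul, hx, ← map_smul]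
  | one => simp [der_one]
  | mul h s hs =>
    rw [LinearMap.smul_apply] at hs ⊢
    rw [der_gen_mul, der_gen_mul, hs, pairing_high_smul_left]
    simp only [Gen.deg, mul_smul_comm, smul_add, mul_smul, smul_comm c]

/-- The algebra automorphism of `Sym(M ⊕ M*)` acting by `(-1)^{k n}` in degree `n`. -/
def twist (k : ℤ) : Sym K M →ₐ[K] Sym K M :=
  symLift (fun h => sgn K (k * h.deg) • gen h)
    (by intro n x y; simp [gen_low_add, Gen.deg])
    (by intro n c x; simp [gen_low_smul, Gen.deg, smul_comm c])
    (by intro n x y; simp [gen_high_add, Gen.deg])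
    (by intro n c x; simp [gen_high_smul, Gen.deg, smul_comm c])
    (by
      intro g h
      rw [smul_mul_smul_comm, smul_mul_smul_comm, gen_comm g h, smul_smul, smul_smul]
      congr 1; ring)

lemma twist_gen (k : ℤ) (h : Gen K M) : twist k (gen h) = sgn K (k * h.deg) • gen h := by
  exact symLift_gen _ _ _ _ _ _ _

/-- The endomorphism `(u, F) ↦ (g u, g F + (-1)^{deg g deg u} u {g, -})`. -/
def adAux (g : Gen K M) : Module.End K (Sym K M × Module.End K (Sym K M)) :=
  LinearMap.prod (LinearMap.mulLeft K (gen g) ∘ₗ LinearMap.fst K _ _)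
    (LinearMap.mulLeft K (LinearMap.mulLeft K (gen g)) ∘ₗ LinearMap.snd K _ _ +
      LinearMap.mulRight K (der g) ∘ₗ LinearMap.mul K (Sym K M) ∘ₗ (twist g.deg).toLinearMap ∘ₗ
        LinearMap.fst K _ _)

lemma adAux_apply (g : Gen K M) (z : Sym K M × Module.End K (Sym K M)) :
    adAux g z = (gen g * z.1,
      LinearMap.mulLeft K (gen g) * z.2 + LinearMap.mulLeft K (twist g.deg z.1) * der g) := rfl

/-- The algebra map `x ↦ ((u, F) ↦ (x u, x F ± u {x, -}))`. -/
def adHom : Sym K M →ₐ[K] Module.End K (Sym K M × Module.End K (Sym K M)) :=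
  symLift (adAux (K := K) (M := M))
    (by
      intro n x y
      refine LinearMap.ext fun z => Prod.ext ?_ (LinearMap.ext fun s => ?_)
      · simp [adAux_apply, gen_low_add, add_mul]
      · simp [adAux_apply, gen_low_add, add_mul, der_low_add, Gen.deg, mul_add]; abel)
    (by
      intro n c x
      refine LinearMap.ext fun z => Prod.ext ?_ (LinearMap.ext fun s => ?_)
      · simp [adAux_apply, gen_low_smul]
      · simp [adAux_apply, gen_low_smul, der_low_smul, Gen.deg])
    (by
      intro n x y
      refine LinearMap.ext fun z => Prod.ext ?_ (LinearMap.ext fun s => ?_)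
      · simp [adAux_apply, gen_high_add, add_mul]
      · simp [adAux_apply, gen_high_add, add_mul, der_high_add, Gen.deg, mul_add]; abel)
    (by
      intro n c x
      refine LinearMap.ext fun z => Prod.ext ?_ (LinearMap.ext fun s => ?_)
      · simp [adAux_apply, gen_high_smul]
      · simp [adAux_apply, gen_high_smul, der_high_smul, Gen.deg])
    (by
      intro g h
      have hc : ∀ t : Sym K M, gen g * (gen h * t) = sgn K (g.deg * h.deg) • (gen h * (gen g * t)) := by
        intro t; rw [← mul_assoc, gen_comm, smul_mul_assoc, mul_assoc]
      refine LinearMap.ext fun z => Prod.ext ?_ (LinearMap.ext fun s => ?_)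
      · simp [adAux_apply, hc]
      · simp only [Module.End.mul_apply, adAux_apply, LinearMap.add_apply, map_mul, twist_gen,
          LinearMap.mulLeft_apply, LinearMap.smul_apply, Prod.smul_snd, smul_mul_assoc, mul_assoc,
          mul_add, hc, smul_add, smul_smul]
        rw [mul_comm h.deg g.deg, sgn_mul_self, one_smul]; abel)

/-- The Poisson bracket on `Sym(M ⊕ M*)`: the graded biderivation extending `pairing`
(see `symBracket_one`, `symBracket_gen_mul`). -/
def symBracket : Sym K M →ₗ[K] Sym K M →ₗ[K] Sym K M :=
  LinearMap.snd K _ _ ∘ₗ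
    LinearMap.applyₗ ((1 : Sym K M), (0 : Module.End K (Sym K M))) ∘ₗ
      (adHom (K := K) (M := M)).toLinearMap

lemma adHom_fst (x : Sym K M) (z : Sym K M × Module.End K (Sym K M)) :
    (adHom x z).1 = x * z.1 := by
  induction x using sym_induction generalizing z with
  | add x y hx hy => simp [hx, hy, add_mul]
  | smul c x hx => simp [hx]
  | one => simp
  | mul h x hx =>
    rw [map_mul, Module.End.mul_apply, adHom, symLift_gen, adAux_apply]
    simp only [← adHom.eq_1, hx, mul_assoc]

lemma symBracket_one (y : Sym K M) : symBracket 1 y = 0 := by simp [symBracket]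

lemma symBracket_gen_mul (g : Gen K M) (x y : Sym K M) :
    symBracket (gen g * x) y = gen g * symBracket x y + twist g.deg x * der g y := by
  have h1 : adHom (gen g) = adAux g := by rw [adHom, symLift_gen]
  simp [symBracket, h1, adAux_apply, adHom_fst]

/-- The product in `Sym(M ⊕ M*)` of a list of homogeneous elements of `M ⊕ M*`. -/
def gprod (l : List (Gen K M)) : Sym K M := (l.map gen).prod

/-- The degree of a product of homogeneous elements. -/
def ldeg (l : List (Gen K M)) : ℤ := (l.map Gen.deg).sum

lemma gprod_nil : gprod ([] : List (Gen K M)) = 1 := by simp [gprod]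
lemma gprod_cons (g : Gen K M) (l) : gprod (g :: l) = gen g * gprod l := by simp [gprod]
lemma gprod_append (l k : List (Gen K M)) : gprod (l ++ k) = gprod l * gprod k := by simp [gprod]
lemma ldeg_nil : ldeg ([] : List (Gen K M)) = 0 := by simp [ldeg]
lemma ldeg_cons (g : Gen K M) (l) : ldeg (g :: l) = g.deg + ldeg l := by simp [ldeg]
lemma ldeg_append (l k : List (Gen K M)) : ldeg (l ++ k) = ldeg l + ldeg k := by simp [ldeg]

lemma gen_gprod_comm (g : Gen K M) (k : List (Gen K M)) :
    gen g * gprod k = sgn K (g.deg * ldeg k) • (gprod k * gen g) := by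
  induction k with
  | nil => simp [gprod_nil, ldeg_nil, sgn_zero]
  | cons h k ih =>
    rw [gprod_cons, ← mul_assoc, gen_comm, smul_mul_assoc, mul_assoc, ih, mul_smul_comm, smul_smul,
      ldeg_cons, mul_add, sgn_add, mul_assoc]

lemma gprod_comm (l k : List (Gen K M)) :
    gprod l * gprod k = sgn K (ldeg l * ldeg k) • (gprod k * gprod l) := by
  induction l with
  | nil => simp [gprod_nil, ldeg_nil, sgn_zero]
  | cons g l ih =>
    rw [gprod_cons, mul_assoc, ih, mul_smul_comm, ← mul_assoc, gen_gprod_comm, smul_mul_assoc,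
      smul_smul, ldeg_cons, add_mul, sgn_add, mul_assoc, mul_comm (sgn K (g.deg * ldeg k))]

lemma twist_gprod (n : ℤ) (l : List (Gen K M)) :
    twist n (gprod l) = sgn K (n * ldeg l) • gprod l := by
  induction l with
  | nil => simp [gprod_nil, ldeg_nil, sgn_zero]
  | cons g l ih =>
    rw [gprod_cons, map_mul, ih, twist_gen, smul_mul_smul_comm, ldeg_cons, mul_add, sgn_add]

lemma der_gprod_mul (g : Gen K M) (l : List (Gen K M)) (y : Sym K M) :
    der g (gprod l * y) =
      der g (gprod l) * y + sgn K (g.deg * ldeg l) • (gprod l * der g y) := by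
  induction l with
  | nil => simp [gprod_nil, ldeg_nil, sgn_zero, der_one]
  | cons h l ih =>
    rw [gprod_cons, mul_assoc, der_gen_mul, der_gen_mul, ih, ldeg_cons, mul_add g.deg, sgn_add]
    simp only [mul_add, add_mul, smul_add, smul_mul_assoc, mul_smul_comm, mul_assoc, smul_smul,
      add_assoc]

lemma symBracket_cons (g : Gen K M) (l : List (Gen K M)) (y : Sym K M) :
    symBracket (gprod (g :: l)) y = gen g * symBracket (gprod l) y +
      sgn K (g.deg * ldeg l) • (gprod l * der g y) := by
  rw [gprod_cons, symBracket_gen_mul, twist_gprod, smul_mul_assoc]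

lemma symBracket_leibniz_left (l k : List (Gen K M)) (y : Sym K M) :
    symBracket (gprod l * gprod k) y = gprod l * symBracket (gprod k) y +
      sgn K (ldeg l * ldeg k) • (gprod k * symBracket (gprod l) y) := by
  induction l with
  | nil => simp [gprod_nil, symBracket_one]
  | cons g l ih =>
    have h1 : ∀ t, gen g * (gprod k * t) = sgn K (g.deg * ldeg k) • (gprod k * (gen g * t)) := by
      intro t; rw [← mul_assoc, gen_gprod_comm, smul_mul_assoc, mul_assoc]
    have h2 : ∀ t, gprod l * (gprod k * t) = sgn K (ldeg l * ldeg k) • (gprod k * (gprod l * t)) := by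
      intro t; rw [← mul_assoc, gprod_comm, smul_mul_assoc, mul_assoc]
    have h3 := symBracket_cons g (l ++ k) y
    rw [gprod_cons, gprod_append, ← mul_assoc] at h3
    rw [symBracket_cons, gprod_cons, h3, ih, ldeg_append, ldeg_cons]
    simp only [mul_add, add_mul, sgn_add, smul_add, mul_smul_comm, h1, mul_assoc, h2, smul_smul]
    rw [add_assoc]
    congr 3 <;> ring

lemma symBracket_leibniz_right (l k : List (Gen K M)) (y : Sym K M) :
    symBracket (gprod l) (gprod k * y) = symBracket (gprod l) (gprod k) * y +
      sgn K (ldeg l * ldeg k) • (gprod k * symBracket (gprod l) y) := by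
  induction l with
  | nil => simp [gprod_nil, symBracket_one]
  | cons g l ih =>
    have h1 : ∀ t, gen g * (gprod k * t) = sgn K (g.deg * ldeg k) • (gprod k * (gen g * t)) := by
      intro t; rw [← mul_assoc, gen_gprod_comm, smul_mul_assoc, mul_assoc]
    have h2 : ∀ t, gprod l * (gprod k * t) = sgn K (ldeg l * ldeg k) • (gprod k * (gprod l * t)) := by
      intro t; rw [← mul_assoc, gprod_comm, smul_mul_assoc, mul_assoc]
    simp only [symBracket_cons, ih, der_gprod_mul, ldeg_cons, mul_add, add_mul, sgn_add, smul_add,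
      mul_smul_comm, smul_mul_assoc, h1, h2, mul_assoc, smul_smul]
    match_scalars <;> ring

/-- The homogeneous component of degree `n` of `Sym(M ⊕ M*)`. -/
def symDeg (n : ℤ) : Submodule K (Sym K M) :=
  Submodule.span K {x | ∃ l : List (Gen K M), ldeg l = n ∧ x = gprod l}

lemma gprod_mem_symDeg (l : List (Gen K M)) : gprod l ∈ symDeg (ldeg l) :=
  Submodule.subset_span ⟨l, rfl, rfl⟩

lemma mul_mem_symDeg {i j : ℤ} {x y : Sym K M} (hx : x ∈ symDeg i) (hy : y ∈ symDeg j) :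
    x * y ∈ symDeg (i + j) := by
  refine Submodule.span_induction₂ (p := fun x y _ _ => x * y ∈ symDeg (i + j)) ?_ ?_ ?_ ?_ ?_ ?_ ?_
    hx hy
  · rintro _ _ ⟨l, rfl, rfl⟩ ⟨k, rfl, rfl⟩
    rw [← gprod_append, ← ldeg_append]; exact gprod_mem_symDeg _
  · intro y _; simp
  · intro y _; simp
  · intro x y z _ _ _ hx hy; rw [add_mul]; exact add_mem hx hy
  · intro x y z _ _ _ hx hy; rw [mul_add]; exact add_mem hx hy
  · intro c x y _ _ h; rw [smul_mul_assoc]; exact Submodule.smul_mem _ _ h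
  · intro c x y _ _ h; rw [mul_smul_comm]; exact Submodule.smul_mem _ _ h

lemma gen_mem_symDeg (g : Gen K M) : gen g ∈ symDeg g.deg := by
  simpa [gprod, ldeg] using gprod_mem_symDeg [g]

lemma der_mem (g : Gen K M) (l : List (Gen K M)) : der g (gprod l) ∈ symDeg (g.deg + ldeg l) := by
  induction l with
  | nil => simp [gprod_nil, der_one]
  | cons h l ih =>
    rw [gprod_cons, der_gen_mul]
    refine add_mem ?_ (Submodule.smul_mem _ _ ?_)
    · by_cases hgh : g.deg + h.deg = 0
      · rw [ldeg_cons, ← add_assoc, hgh, zero_add]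
        exact Submodule.smul_mem _ _ (gprod_mem_symDeg l)
      · rw [pairing_eq_zero g h hgh, zero_smul]; exact zero_mem _
    · have := mul_mem_symDeg (gen_mem_symDeg h) ih
      rwa [ldeg_cons, add_left_comm]

lemma symBracket_mem (l k : List (Gen K M)) :
    symBracket (gprod l) (gprod k) ∈ symDeg (ldeg l + ldeg k) := by
  induction l with
  | nil => simp [gprod_nil, symBracket_one]
  | cons g l ih =>
    rw [symBracket_cons]
    refine add_mem ?_ (Submodule.smul_mem _ _ ?_)
    · have := mul_mem_symDeg (gen_mem_symDeg g) ih
      rwa [ldeg_cons, add_assoc]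
    · have := mul_mem_symDeg (gprod_mem_symDeg l) (der_mem g k)
      rwa [ldeg_cons, add_assoc, add_left_comm]

lemma span_gprod : Submodule.span K (Set.range (gprod (K := K) (M := M))) = ⊤ := by
  refine eq_top_iff.2 fun x _ => ?_
  induction x using sym_induction with
  | add x y hx hy => exact add_mem (hx trivial) (hy trivial)
  | smul c x hx => exact Submodule.smul_mem _ _ (hx trivial)
  | one => exact Submodule.subset_span ⟨[], gprod_nil⟩
  | mul g x hx =>
    refine Submodule.span_induction (p := fun x _ => gen g * x ∈ Submodule.span K (Set.range gprod))
      ?_ ?_ ?_ ?_ (hx trivial)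
    · rintro _ ⟨l, rfl⟩
      exact Submodule.subset_span ⟨g :: l, gprod_cons g l⟩
    · simp
    · intro x y _ _ hx hy; rw [mul_add]; exact add_mem hx hy
    · intro c x _ hx; rw [mul_smul_comm]; exact Submodule.smul_mem _ _ hx

end Algebra

section Uncompleted

variable (K : Type u) [Field K] (P : Type v) [CommRing P] [Algebra K P]
  (M : ℕ+ → Type w) [∀ n, AddCommGroup (M n)] [∀ n, Module K (M n)]

/-- The algebra `X₀ = P ⊗ Sym(M ⊕ M*)`. -/
abbrev X0 : Type (max u v w) := P ⊗[K] Sym K M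

variable {K P M}

/-- The element `a ⊗ g₁ ⋯ gᵣ` of `X₀`, for `a ∈ P` and homogeneous `gᵢ ∈ M ⊕ M*`. -/
def mono (a : P) (l : List (Gen K M)) : X0 K P M := a ⊗ₜ gprod l

variable (K P M)

/-- The homogeneous component `X₀ⁿ` of `X₀`, where `P` sits in degree `0`. -/
def X0deg (n : ℤ) : Submodule K (X0 K P M) :=
  Submodule.span K {x | ∃ (a : P) (l : List (Gen K M)), ldeg l = n ∧ x = mono a l}

/-- `F^p X₀`, the ideal generated by the homogeneous elements of degree at least `p`. Since `X₀` is
graded commutative and the generators are homogeneous, this left ideal is two-sided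
(see `FX0_mul_right`). -/
def FX0 (p : ℕ) : Ideal (X0 K P M) :=
  Ideal.span {x | ∃ n : ℤ, (p : ℤ) ≤ n ∧ x ∈ X0deg K P M n}

variable {K P M}

/-- The bracket on `X₀`, the tensor product of the Poisson brackets of `P` and `Sym(M ⊕ M*)`:
`{a ⊗ s, b ⊗ t} = {a, b} ⊗ s t + a b ⊗ {s, t}`. -/
def bracket0 (π : PoissonStructure K P) : X0 K P M →ₗ[K] X0 K P M →ₗ[K] X0 K P M :=
  TensorProduct.map₂ π.bracket (LinearMap.mul K (Sym K M)) +
    TensorProduct.map₂ (LinearMap.mul K P) symBracket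

lemma mono_mem (a : P) (l : List (Gen K M)) : mono a l ∈ X0deg K P M (ldeg l) :=
  Submodule.subset_span ⟨a, l, rfl, rfl⟩

lemma tmul_mem {n : ℤ} (a : P) {s : Sym K M} (hs : s ∈ symDeg n) :
    a ⊗ₜ[K] s ∈ X0deg K P M n := by
  refine Submodule.span_induction (p := fun s _ => a ⊗ₜ[K] s ∈ X0deg K P M n) ?_ ?_ ?_ ?_ hs
  · rintro _ ⟨l, rfl, rfl⟩; exact mono_mem a l
  · simp
  · intro x y _ _ hx hy; rw [TensorProduct.tmul_add]; exact add_mem hx hy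
  · intro c x _ hx; rw [TensorProduct.tmul_smul]; exact Submodule.smul_mem _ _ hx

lemma mono_mul (a b : P) (l k : List (Gen K M)) : mono a l * mono b k = mono (a * b) (l ++ k) := by
  simp [mono, gprod_append]

lemma mono_comm (a b : P) (l k : List (Gen K M)) :
    mono a l * mono b k = sgn K (ldeg l * ldeg k) • (mono b k * mono a l) := by
  simp only [mono, Algebra.TensorProduct.tmul_mul_tmul]
  rw [gprod_comm, TensorProduct.tmul_smul, mul_comm a b]

/-- `X₀` is spanned by the elements `mono a l`. -/
lemma X0_induction {p : X0 K P M → Prop} (zero : p 0) (add : ∀ x y, p x → p y → p (x + y))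
    (mem : ∀ a l, p (mono a l)) (x : X0 K P M) : p x := by
  induction x using TensorProduct.induction_on with
  | zero => exact zero
  | add x y hx hy => exact add x y hx hy
  | tmul a s =>
    have hs : s ∈ Submodule.span K (Set.range (gprod (K := K) (M := M))) := by
      rw [span_gprod]; trivial
    have : ∀ a : P, p (a ⊗ₜ s) := by
      refine Submodule.span_induction (p := fun s _ => ∀ a : P, p (a ⊗ₜ s)) ?_ ?_ ?_ ?_ hs
      · rintro _ ⟨l, rfl⟩ a; exact mem a l
      · intro a; simpa using zero
      · intro x y _ _ hx hy a; rw [TensorProduct.tmul_add]; exact add _ _ (hx a) (hy a)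
      · intro c x _ hx a; rw [← TensorProduct.smul_tmul]; exact hx _
    exact this a

variable (π : PoissonStructure K P)

lemma bracket_right_leibniz (a b c : P) :
    π.bracket (a * b) c = a * π.bracket b c + b * π.bracket a c := by
  have skew : ∀ x y, π.bracket x y = - π.bracket y x := by
    intro x y
    have h := π.bracket_self (x + y)
    simp only [map_add, LinearMap.add_apply, π.bracket_self] at h
    linear_combination h
  rw [skew, π.leibniz, skew b, skew a]; ring

lemma bracket0_tmul (a b : P) (s t : Sym K M) :
    bracket0 π (a ⊗ₜ s) (b ⊗ₜ t) = π.bracket a b ⊗ₜ (s * t) + (a * b) ⊗ₜ symBracket s t := by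
  simp [bracket0]

lemma bracket0_leibniz_left (a b : P) (l k : List (Gen K M)) (z : X0 K P M) :
    bracket0 π (mono a l * mono b k) z = mono a l * bracket0 π (mono b k) z +
      sgn K (ldeg l * ldeg k) • (mono b k * bracket0 π (mono a l) z) := by
  induction z using TensorProduct.induction_on with
  | zero => simp
  | add x y hx hy => simp only [map_add, mul_add, smul_add, hx, hy]; abel
  | tmul c t =>
    have h2 : gprod l * (gprod k * t) = sgn K (ldeg l * ldeg k) • (gprod k * (gprod l * t)) := by
      rw [← mul_assoc, gprod_comm, smul_mul_assoc, mul_assoc]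
    simp only [mono, Algebra.TensorProduct.tmul_mul_tmul, bracket0_tmul, mul_add,
      symBracket_leibniz_left, bracket_right_leibniz, TensorProduct.add_tmul,
      TensorProduct.tmul_add, TensorProduct.tmul_smul, smul_add, mul_assoc, h2]
    rw [mul_left_comm b a c]
    abel

lemma bracket0_leibniz_right (a b : P) (l k : List (Gen K M)) (z : X0 K P M) :
    bracket0 π (mono a l) (mono b k * z) = bracket0 π (mono a l) (mono b k) * z +
      sgn K (ldeg l * ldeg k) • (mono b k * bracket0 π (mono a l) z) := by
  induction z using TensorProduct.induction_on with
  | zero => simp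
  | add x y hx hy => simp only [map_add, mul_add, smul_add, hx, hy]; abel
  | tmul c t =>
    have h2 : gprod l * (gprod k * t) = sgn K (ldeg l * ldeg k) • (gprod k * (gprod l * t)) := by
      rw [← mul_assoc, gprod_comm, smul_mul_assoc, mul_assoc]
    simp only [mono, Algebra.TensorProduct.tmul_mul_tmul, bracket0_tmul, mul_add, add_mul,
      symBracket_leibniz_right, π.leibniz, TensorProduct.add_tmul,
      TensorProduct.tmul_add, TensorProduct.tmul_smul, smul_add, mul_assoc, h2]
    rw [mul_left_comm b a c]
    abel

lemma bracket0_mem {i j : ℤ} {x y : X0 K P M} (hx : x ∈ X0deg K P M i) (hy : y ∈ X0deg K P M j) :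
    bracket0 π x y ∈ X0deg K P M (i + j) := by
  refine Submodule.span_induction₂ (p := fun x y _ _ => bracket0 π x y ∈ X0deg K P M (i + j))
    ?_ ?_ ?_ ?_ ?_ ?_ ?_ hx hy
  · rintro _ _ ⟨a, l, rfl, rfl⟩ ⟨b, k, rfl, rfl⟩
    rw [mono, mono, bracket0_tmul]
    exact add_mem (tmul_mem _ (mul_mem_symDeg (gprod_mem_symDeg l) (gprod_mem_symDeg k)))
      (tmul_mem _ (symBracket_mem l k))
  · intro y _; simp
  · intro y _; simp
  · intro x y z _ _ _ hx hy; rw [map_add, LinearMap.add_apply]; exact add_mem hx hy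
  · intro x y z _ _ _ hx hy; rw [map_add]; exact add_mem hx hy
  · intro c x y _ _ h; rw [map_smul, LinearMap.smul_apply]; exact Submodule.smul_mem _ _ h
  · intro c x y _ _ h; rw [map_smul]; exact Submodule.smul_mem _ _ h

lemma mem_FX0_of_mem {p : ℕ} {n : ℤ} (h : (p : ℤ) ≤ n) {x : X0 K P M} (hx : x ∈ X0deg K P M n) :
    x ∈ FX0 K P M p :=
  Ideal.subset_span ⟨n, h, hx⟩

lemma FX0_antitone {p q : ℕ} (h : p ≤ q) : FX0 K P M q ≤ FX0 K P M p :=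
  Ideal.span_mono fun _ ⟨n, hn, hx⟩ => ⟨n, by omega, hx⟩

/-- `F^p X₀` is additively generated by the products `x y` with `deg y ≥ p`. -/
lemma FX0_induction {p : ℕ} {C : X0 K P M → Prop} (zero : C 0)
    (add : ∀ x y, C x → C y → C (x + y))
    (mem : ∀ a l b k, (p : ℤ) ≤ ldeg k → C (mono a l * mono b k))
    {x : X0 K P M} (hx : x ∈ FX0 K P M p) : C x := by
  have key : ∀ r : X0 K P M, C (r * x) := by
    refine Submodule.span_induction (p := fun x _ => ∀ r : X0 K P M, C (r * x)) ?_ ?_ ?_ ?_ hx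
    · rintro x ⟨n, hn, hx⟩
      refine Submodule.span_induction (p := fun x _ => ∀ r : X0 K P M, C (r * x)) ?_ ?_ ?_ ?_ hx
      · rintro _ ⟨b, k, rfl, rfl⟩ r
        refine X0_induction (p := fun r => C (r * mono b k)) ?_ ?_ ?_ r
        · simpa using zero
        · intro x y hx hy; rw [add_mul]; exact add _ _ hx hy
        · intro a l; exact mem a l b k hn
      · intro r; simpa using zero
      · intro x y _ _ hx hy r; rw [mul_add]; exact add _ _ (hx r) (hy r)
      · intro c x _ hx r; rw [mul_smul_comm, ← smul_mul_assoc]; exact hx _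
    · intro r; simpa using zero
    · intro x y _ _ hx hy r; rw [mul_add]; exact add _ _ (hx r) (hy r)
    · intro c x _ hx r; rw [smul_eq_mul, ← mul_assoc]; exact hx _
  simpa using key 1

lemma FX0_smul {p : ℕ} (c : K) {x : X0 K P M} (hx : x ∈ FX0 K P M p) : c • x ∈ FX0 K P M p :=
  Submodule.smul_of_tower_mem _ c hx

lemma FX0_mul_right {p : ℕ} {x : X0 K P M} (hx : x ∈ FX0 K P M p) (y : X0 K P M) :
    x * y ∈ FX0 K P M p := by
  refine FX0_induction (C := fun x => x * y ∈ FX0 K P M p) ?_ ?_ ?_ hx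
  · simp
  · intro x y hx hy; rw [add_mul]; exact add_mem hx hy
  · intro a l b k hk
    refine X0_induction (p := fun y => mono a l * mono b k * y ∈ FX0 K P M p) ?_ ?_ ?_ y
    · simp
    · intro x y hx hy; rw [mul_add]; exact add_mem hx hy
    · intro c m
      rw [mul_assoc, mono_comm b c]
      exact Ideal.mul_mem_left _ _ (FX0_smul _ (Ideal.mul_mem_left _ _
        (mem_FX0_of_mem hk (mono_mem b k))))

/-- `{F^p X₀, X₀ʲ} ⊆ F^q X₀` for `q ≤ p` and `q ≤ p + j`. -/
lemma bracket0_FX0_left {p q : ℕ} {j : ℤ} (hpq : q ≤ p) (hj : (q : ℤ) ≤ p + j) {x z : X0 K P M}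
    (hx : x ∈ FX0 K P M p) (hz : z ∈ X0deg K P M j) : bracket0 π x z ∈ FX0 K P M q := by
  refine FX0_induction (C := fun x => bracket0 π x z ∈ FX0 K P M q) ?_ ?_ ?_ hx
  · simp
  · intro x y hx hy; rw [map_add, LinearMap.add_apply]; exact add_mem hx hy
  · intro a l b k hk
    rw [bracket0_leibniz_left]
    refine add_mem (Ideal.mul_mem_left _ _ ?_) (FX0_smul _ (FX0_mul_right ?_ _))
    · exact mem_FX0_of_mem (by omega) (bracket0_mem π (mono_mem b k) hz)
    · exact mem_FX0_of_mem (by omega) (mono_mem b k)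

/-- `{X₀ⁱ, F^p X₀} ⊆ F^q X₀` for `q ≤ p` and `q ≤ p + i`. -/
lemma bracket0_FX0_right {p q : ℕ} {i : ℤ} (hpq : q ≤ p) (hi : (q : ℤ) ≤ p + i) {x z : X0 K P M}
    (hx : x ∈ FX0 K P M p) (hz : z ∈ X0deg K P M i) : bracket0 π z x ∈ FX0 K P M q := by
  refine FX0_induction (C := fun x => bracket0 π z x ∈ FX0 K P M q) ?_ ?_ ?_ hx
  · simp
  · intro x y hx hy; rw [map_add]; exact add_mem hx hy
  · intro a l b k hk
    refine Submodule.span_induction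
      (p := fun z _ => bracket0 π z (mono a l * mono b k) ∈ FX0 K P M q) ?_ ?_ ?_ ?_ hz
    · rintro _ ⟨c, m, rfl, rfl⟩
      rw [bracket0_leibniz_right]
      refine add_mem (Ideal.mul_mem_left _ _ ?_) (FX0_smul _ (Ideal.mul_mem_left _ _ ?_))
      · exact mem_FX0_of_mem (by omega) (mono_mem b k)
      · exact mem_FX0_of_mem (by omega) (bracket0_mem π (mono_mem c m) (mono_mem b k))
    · simp
    · intro x y _ _ hx hy; rw [map_add, LinearMap.add_apply]; exact add_mem hx hy
    · intro c x _ hx; rw [map_smul, LinearMap.smul_apply]; exact FX0_smul c hx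

end Uncompleted

section Completion

variable (K : Type u) [Field K] (P : Type v) [CommRing P] [Algebra K P]
  (M : ℕ+ → Type w) [∀ n, AddCommGroup (M n)] [∀ n, Module K (M n)]

variable {K P M} in
/-- `N ∩ X₀ⁿ` as a subspace of `X₀ⁿ`, for an ideal `N` of `X₀`. -/
def idealDeg (N : Ideal (X0 K P M)) (n : ℤ) : Submodule K (X0deg K P M n) :=
  (N.restrictScalars K).comap (X0deg K P M n).subtype

/-- `F^p X₀ⁿ = F^p X₀ ∩ X₀ⁿ`. -/
abbrev FX0deg (p : ℕ) (n : ℤ) : Submodule K (X0deg K P M n) := idealDeg (FX0 K P M p) n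

lemma FX0deg_antitone {p q : ℕ} (h : p ≤ q) (n : ℤ) : FX0deg K P M q n ≤ FX0deg K P M p n :=
  fun _ hx => FX0_antitone h hx

/-- The quotient `X₀ⁿ / F^p X₀ⁿ`. -/
def XQuot (p : ℕ) (n : ℤ) : Type (max u v w) := X0deg K P M n ⧸ FX0deg K P M p n

instance (p : ℕ) (n : ℤ) : AddCommGroup (XQuot K P M p n) :=
  inferInstanceAs (AddCommGroup (X0deg K P M n ⧸ FX0deg K P M p n))

instance (p : ℕ) (n : ℤ) : Module K (XQuot K P M p n) :=
  inferInstanceAs (Module K (X0deg K P M n ⧸ FX0deg K P M p n))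

/-- The projection `X₀ⁿ → X₀ⁿ / F^p X₀ⁿ`. -/
def toXQuot (p : ℕ) (n : ℤ) : X0deg K P M n →ₗ[K] XQuot K P M p n := (FX0deg K P M p n).mkQ

variable {K P M} in
lemma toXQuot_surjective (p : ℕ) (n : ℤ) : Function.Surjective (toXQuot K P M p n) :=
  Submodule.mkQ_surjective _

variable {K P M} in
lemma toXQuot_eq_zero {p : ℕ} {n : ℤ} {x : X0deg K P M n} :
    toXQuot K P M p n x = 0 ↔ (x : X0 K P M) ∈ FX0 K P M p :=
  Submodule.Quotient.mk_eq_zero _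

variable {K P M} in
/-- The universal property of `X₀ⁿ / F^p X₀ⁿ`. -/
def xquotLift {p : ℕ} {n : ℤ} {B : Type*} [AddCommGroup B] [Module K B]
    (f : X0deg K P M n →ₗ[K] B) (hf : ∀ x : X0deg K P M n, (x : X0 K P M) ∈ FX0 K P M p → f x = 0) :
    XQuot K P M p n →ₗ[K] B :=
  Submodule.liftQ (FX0deg K P M p n) f hf

variable {K P M} in
lemma xquotLift_toXQuot {p : ℕ} {n : ℤ} {B : Type*} [AddCommGroup B] [Module K B]
    (f : X0deg K P M n →ₗ[K] B) (hf) (x : X0deg K P M n) :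
    xquotLift (p := p) f hf (toXQuot K P M p n x) = f x := rfl

/-- The projection `X₀ⁿ / F^q X₀ⁿ → X₀ⁿ / F^p X₀ⁿ` for `p ≤ q`. -/
def transition {p q : ℕ} (h : p ≤ q) (n : ℤ) : XQuot K P M q n →ₗ[K] XQuot K P M p n :=
  Submodule.factor (FX0deg_antitone K P M h n)

variable {K P M} in
lemma transition_toXQuot {p q : ℕ} (h : p ≤ q) (n : ℤ) (x : X0deg K P M n) :
    transition K P M h n (toXQuot K P M q n x) = toXQuot K P M p n x := rfl

/-- The homogeneous component `Xⁿ`, the inverse limit over `p` of `X₀ⁿ / F^p X₀ⁿ`. -/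
def X (n : ℤ) : Submodule K (∀ p : ℕ, XQuot K P M p n) where
  carrier := {x | ∀ (p q : ℕ) (h : p ≤ q), transition K P M h n (x q) = x p}
  zero_mem' := by intro p q h; simp
  add_mem' := by intro x y hx hy p q h; simp [hx p q h, hy p q h]
  smul_mem' := by intro c x hx p q h; simp [hx p q h]

variable {K P M}

/-- For an ideal `N` of `X₀`, the subspace of `Xⁿ` of the elements `(x_p + F^p X₀ⁿ)_p` with
representatives `x_p ∈ N ∩ X₀ⁿ`, that is, the inverse limit of
`(N ∩ X₀ⁿ) / (N ∩ F^p X₀ⁿ)`. -/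
def completedIdeal (N : Ideal (X0 K P M)) (n : ℤ) : Submodule K (X K P M n) where
  carrier := {x | ∀ p : ℕ, x.1 p ∈ (idealDeg N n).map (toXQuot K P M p n)}
  zero_mem' := by intro p; exact zero_mem _
  add_mem' := by intro x y hx hy p; exact add_mem (hx p) (hy p)
  smul_mem' := by intro c x hx p; exact Submodule.smul_mem _ _ (hx p)

variable (K P M)

/-- The degree `n` component of `I = F^1 X`. -/
def I (n : ℤ) : Submodule K (X K P M n) := completedIdeal (FX0 K P M 1) n

/-- The degree `n` component of `I^{(k)}`, the completion of the `k`-fold product of the ideal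
`I₀ = F^1 X₀`. -/
def IPow (k : ℕ) (n : ℤ) : Submodule K (X K P M n) := completedIdeal (FX0 K P M 1 ^ k) n

variable {K P M}

/-- The map `X₀ⁿ → Xⁿ`. -/
def toX (n : ℤ) : X0deg K P M n →ₗ[K] X K P M n :=
  LinearMap.codRestrict _ (LinearMap.pi fun p => toXQuot K P M p n) fun _ _ _ _ => rfl

/-- Convergence of a sequence in `Xⁿ`, for the topology of the inverse limit of the discrete
spaces `X₀ⁿ / F^p X₀ⁿ`. -/
def ConvergesTo {n : ℤ} (u : ℕ → X K P M n) (x : X K P M n) : Prop :=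
  ∀ p : ℕ, ∃ N : ℕ, ∀ m ≥ N, (u m).1 p = x.1 p

variable (π : PoissonStructure K P)

/-- The bracket `X₀ⁱ × X₀ʲ → X₀ᵏ`, `k = i + j`. -/
def bracket0Deg (i j k : ℤ) (h : i + j = k) :
    X0deg K P M i →ₗ[K] X0deg K P M j →ₗ[K] X0deg K P M k :=
  LinearMap.mk₂ K (fun x y => ⟨bracket0 π x.1 y.1, h ▸ bracket0_mem π x.2 y.2⟩)
    (by intro x y z; ext; simp) (by intro c x y; ext; simp)
    (by intro x y z; ext; simp) (by intro c x y; ext; simp)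

/-- The map `X₀ⁱ / F^s X₀ⁱ × X₀ʲ / F^s X₀ʲ → X₀ᵏ / F^p X₀ᵏ` induced by the bracket, for
`s ≥ p + max (|i|, |j|)`. -/
def bracketQuot (i j k : ℤ) (h : i + j = k) (p s : ℕ) (hs : p + max i.natAbs j.natAbs ≤ s) :
    XQuot K P M s i →ₗ[K] XQuot K P M s j →ₗ[K] XQuot K P M p k :=
  xquotLift (xquotLift ((bracket0Deg π i j k h).compr₂ (toXQuot K P M p k)).flip (by
      intro y hy
      refine LinearMap.ext fun x => ?_
      exact toXQuot_eq_zero.2 (bracket0_FX0_right π (by omega) (by omega) hy x.2))).flip (by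
    intro x hx
    refine LinearMap.ext fun y => ?_
    obtain ⟨y, rfl⟩ := toXQuot_surjective s j y
    exact toXQuot_eq_zero.2 (bracket0_FX0_left π (by omega) (by omega) hx y.2))

lemma bracketQuot_mk (i j k : ℤ) (h : i + j = k) (p s : ℕ) (hs) (x : X0deg K P M i)
    (y : X0deg K P M j) :
    bracketQuot π i j k h p s hs (toXQuot K P M s i x) (toXQuot K P M s j y) =
      toXQuot K P M p k (bracket0Deg π i j k h x y) := rfl

/-- The bracket `Xⁱ × Xʲ → Xᵏ`, `k = i + j`: the `p`-th component of `{x, y}` is represented by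
`{x_s, y_s}` with `s = p + max (|i|, |j|)`. -/
def bracket (i j k : ℤ) (h : i + j = k) : X K P M i →ₗ[K] X K P M j →ₗ[K] X K P M k :=
  LinearMap.mk₂ K
    (fun x y => ⟨fun p => bracketQuot π i j k h p (p + max i.natAbs j.natAbs) le_rfl
        (x.1 (p + max i.natAbs j.natAbs)) (y.1 (p + max i.natAbs j.natAbs)), by
      intro p q hpq
      have hs : p + max i.natAbs j.natAbs ≤ q + max i.natAbs j.natAbs := by omega
      obtain ⟨a, ha⟩ := toXQuot_surjective _ _ (x.1 (q + max i.natAbs j.natAbs))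
      obtain ⟨b, hb⟩ := toXQuot_surjective _ _ (y.1 (q + max i.natAbs j.natAbs))
      have hx := x.2 _ _ hs
      have hy := y.2 _ _ hs
      rw [← ha, transition_toXQuot] at hx
      rw [← hb, transition_toXQuot] at hy
      beta_reduce
      rw [← ha, ← hb, ← hx, ← hy, bracketQuot_mk, bracketQuot_mk, transition_toXQuot]⟩)
    (by intro x y z; ext p; simp) (by intro c x y; ext p; simp)
    (by intro x y z; ext p; simp) (by intro c x y; ext p; simp)

/-- The derivation `d_R = {R, -}` of degree one. -/
def dR (R : X K P M 1) (i j : ℤ) (h : 1 + i = j) : X K P M i →ₗ[K] X K P M j :=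
  bracket π 1 i j h R

lemma dR_I (R : X K P M 1) (i j : ℤ) (h : 1 + i = j) :
    I K P M i ≤ (I K P M j).comap (dR π R i j h) := by
  intro x hx p
  obtain ⟨y, hy, hyx⟩ := hx (p + max (1 : ℤ).natAbs i.natAbs)
  obtain ⟨r, hr⟩ := toXQuot_surjective _ _ (R.1 (p + max (1 : ℤ).natAbs i.natAbs))
  refine ⟨bracket0Deg π 1 i j h r y, ?_, ?_⟩
  · exact bracket0_FX0_right π (p := 1) (by omega) (by omega) hy r.2
  · change _ = bracketQuot π 1 i j h p _ le_rfl (R.1 _) (x.1 _)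
    rw [← hyx, ← hr]
    rfl

/-- The map on `X / I` induced by `d_R`. -/
def dRQuot (R : X K P M 1) (i j : ℤ) (h : 1 + i = j) :
    (X K P M i ⧸ I K P M i) →ₗ[K] (X K P M j ⧸ I K P M j) :=
  Submodule.mapQ _ _ (dR π R i j h) (dR_I π R i j h)

/-- The classical master equation `{R, R} = 0`. -/
def MasterEquation (R : X K P M 1) : Prop := bracket π 1 1 2 (by norm_num) R R = 0

/-- The class of `a ⊗ 1` in `(X / I)⁰`, for `a ∈ P`. -/
def unitClass (a : P) : X K P M 0 ⧸ I K P M 0 :=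
  (I K P M 0).mkQ (toX 0 ⟨mono a [], mono_mem a []⟩)

/-- `(X, R)` is a BFV model for `P` and `J`: `R` solves the classical master equation,
`H^j(X / I, d_R) = 0` for `j ≠ 0`, and `H^0(X / I, d_R) = P / J`, that is, the map from `P` to
`H^0(X / I, d_R)` is well defined and surjective, with kernel `J`. -/
structure IsBFVModel (J : Ideal P) (R : X K P M 1) : Prop where
  master : MasterEquation π R
  acyclic : ∀ (i j k : ℤ) (hij : 1 + i = j) (hjk : 1 + j = k), j ≠ 0 →
    ∀ x, dRQuot π R j k hjk x = 0 → ∃ y, dRQuot π R i j hij y = x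
  unit_cocycle : ∀ a : P, dRQuot π R 0 1 (by norm_num) (unitClass a) = 0
  unit_surjective : ∀ x, dRQuot π R 0 1 (by norm_num) x = 0 →
    ∃ (a : P) (y : _), x = unitClass a + dRQuot π R (-1) 0 (by norm_num) y
  unit_kernel : ∀ a : P,
    (∃ y, dRQuot π R (-1) 0 (by norm_num) y = unitClass a) ↔ a ∈ J

/-- `R` and `R'` induce the same map on `X / I`. -/
def SameInducedDifferential (R R' : X K P M 1) : Prop :=
  ∀ (i j : ℤ) (h : 1 + i = j), dRQuot π R i j h = dRQuot π R' i j h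

/-- `ad_γ = {γ, -}` on `Xⁿ`, for `γ` of degree zero. -/
def ad (γ : X K P M 0) (n : ℤ) : Module.End K (X K P M n) := bracket π 0 n n (zero_add n) γ

/-- `g = exp ad_γ`: for all `x`, `g x` is the sum of the convergent series
`∑ j, (1 / j!) ad_γ^j x`. -/
def IsExpAd (γ : X K P M 0) (g : ∀ n : ℤ, X K P M n →ₗ[K] X K P M n) : Prop :=
  ∀ (n : ℤ) (x : X K P M n),
    ConvergesTo (fun N => ∑ j ∈ Finset.range N, ((j.factorial : K)⁻¹) • (ad π γ n ^ j) x) (g n x)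

end Completion

end BFV

end

/-!
The idea is obstruction theory for the classical master equation, with respect to the *weight*: a
product of generators has weight equal to the number of its factors from `M*` plus the total degree
of these factors. Write `S = R' - R`.

* As `{S, -}` vanishes on `X / I`, the element `S` lies in `I^{(2)}` (`mem_of_bracket_mem_I`): the
  terms of `S` with exactly one factor from `M*` are recovered by an Euler formula from the brackets
  of `S` with bases of the `M n` (`proj_eq_euler`).
* On the part of `X₀ = (P ⊗ Sym M) ⊗ Sym M*` of a fixed weight, the leading part of `{R, -}` is
  `δ ⊗ 1`, where `δ` is the differential of `X / I = P ⊗ Sym M` (`proj_bracket0_eq_lowMap`). An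
  element of `I^{(2)}` of degree one has coefficients in the negative degrees of `P ⊗ Sym M`, where
  `δ` is exact by assumption. A contracting homotopy of `δ` thus yields primitives, modulo higher
  weight, of the cocycles in `I^{(2)}` of degree one (`IsBFVModel.exists_primitive`).
* For `γ ∈ I^{(2)}` of degree zero, `ad_γ` raises the weight, so that `exp ad_γ` converges. By the
  graded Jacobi identity (`bracket0_jacobi`) it preserves the master equation
  (`MasterEquation.of_expPart`). If `exp(ad_γ) R` and `R'` agree up to weight `w`, the part of weight
  `w` of their difference is a cocycle by the two master equations, hence a boundary `{R, η}`; replacing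
  `γ` by `γ - η` makes them agree up to weight `w + 1` (`IsBFVModel.exists_correction`). No
  Baker-Campbell-Hausdorff formula is needed, as only the effect of `η` modulo higher weight matters
  (`expPart_add_sub_mem_fil`). The corrections converge to the required `γ` (`exists_limit`).

Computations in the completion are made with representatives in `X₀`. Since `X₀` has a multigrading,
by the degrees of the factors from `M` and from `M*` and the number of the latter, there are
projections `proj T` onto multihomogeneous subspaces `Sp K P M T`, and each element of `Xⁿ` has a
canonical representative modulo `F^p`, namely `tr n p x`.
-/

noncomputable section

namespace BFV

universe u v w

/-! ### Graded skew symmetry and the graded Jacobi identity on `X₀` -/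

section Poisson

variable {K : Type u} [Field K] {P : Type v} [CommRing P] [Algebra K P]
  {M : ℕ+ → Type w} [∀ n, AddCommGroup (M n)] [∀ n, Module K (M n)]

/-- Bilinear identities between homogeneous elements of `X₀` may be checked on the `mono a l`. -/
lemma X0deg_induction₂ {i j : ℤ} {C : X0 K P M → X0 K P M → Prop}
    (mono : ∀ a l b k, ldeg l = i → ldeg k = j → C (mono a l) (mono b k))
    (zero_left : ∀ y, C 0 y) (zero_right : ∀ x, C x 0)
    (add_left : ∀ x y z, C x z → C y z → C (x + y) z)
    (add_right : ∀ x y z, C x y → C x z → C x (y + z))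
    (smul_left : ∀ (c : K) x y, C x y → C (c • x) y)
    (smul_right : ∀ (c : K) x y, C x y → C x (c • y))
    {x y : X0 K P M} (hx : x ∈ X0deg K P M i) (hy : y ∈ X0deg K P M j) : C x y := by
  refine Submodule.span_induction₂ (p := fun x y _ _ => C x y) ?_ ?_ ?_ ?_ ?_ ?_ ?_ hx hy
  · rintro _ _ ⟨a, l, hl, rfl⟩ ⟨b, k, hk, rfl⟩; exact mono a l b k hl hk
  · intro y _; exact zero_left y
  · intro x _; exact zero_right x
  · intro x y z _ _ _ h1 h2; exact add_left x y z h1 h2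
  · intro x y z _ _ _ h1 h2; exact add_right x y z h1 h2
  · intro c x y _ _ h; exact smul_left c x y h
  · intro c x y _ _ h; exact smul_right c x y h

lemma X0_mul_comm {i j : ℤ} {x y : X0 K P M} (hx : x ∈ X0deg K P M i)
    (hy : y ∈ X0deg K P M j) : x * y = sgn K (i * j) • (y * x) := by
  refine X0deg_induction₂ (C := fun x y => x * y = sgn K (i * j) • (y * x))
    ?_ ?_ ?_ ?_ ?_ ?_ ?_ hx hy
  · rintro a l b k rfl rfl; exact mono_comm a b l k
  · intro y; simp
  · intro y; simp
  · intro x y z hx hy; rw [add_mul, hx, hy, mul_add, smul_add]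
  · intro x y z hx hy; rw [mul_add, hx, hy, add_mul, smul_add]
  · intro c x y h; rw [smul_mul_assoc, h, mul_smul_comm, smul_comm]
  · intro c x y h; rw [mul_smul_comm, h, smul_mul_assoc, smul_comm]

variable (π : PoissonStructure K P)

lemma bracket0_mul_right {i j : ℤ} {x y : X0 K P M} (hx : x ∈ X0deg K P M i)
    (hy : y ∈ X0deg K P M j) (z : X0 K P M) :
    bracket0 π x (y * z) = bracket0 π x y * z + sgn K (i * j) • (y * bracket0 π x z) := by
  refine X0deg_induction₂ (C := fun x y => bracket0 π x (y * z) =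
      bracket0 π x y * z + sgn K (i * j) • (y * bracket0 π x z))
    ?_ ?_ ?_ ?_ ?_ ?_ ?_ hx hy
  · rintro a l b k rfl rfl; exact bracket0_leibniz_right π a b l k z
  · intro y; simp
  · intro y; simp
  · intro x y z hx hy
    simp only [map_add, LinearMap.add_apply, hx, hy, add_mul, mul_add, smul_add]; abel
  · intro x y z hx hy
    simp only [map_add, hx, hy, add_mul, smul_add]; abel
  · intro c x y h
    simp only [map_smul, LinearMap.smul_apply, h, smul_mul_assoc, mul_smul_comm, smul_add,
      smul_comm c]
  · intro c x y h
    simp only [map_smul, h, smul_mul_assoc, smul_add, smul_comm c]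

lemma bracket0_mul_left {i j : ℤ} {x y : X0 K P M} (hx : x ∈ X0deg K P M i)
    (hy : y ∈ X0deg K P M j) (z : X0 K P M) :
    bracket0 π (x * y) z = x * bracket0 π y z + sgn K (i * j) • (y * bracket0 π x z) := by
  refine X0deg_induction₂ (C := fun x y => bracket0 π (x * y) z =
      x * bracket0 π y z + sgn K (i * j) • (y * bracket0 π x z))
    ?_ ?_ ?_ ?_ ?_ ?_ ?_ hx hy
  · rintro a l b k rfl rfl; exact bracket0_leibniz_left π a b l k z
  · intro y; simp
  · intro y; simp
  · intro x y z hx hy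
    simp only [add_mul, map_add, LinearMap.add_apply, hx, hy, mul_add, smul_add]; abel
  · intro x y z hx hy
    simp only [mul_add, map_add, LinearMap.add_apply, hx, hy, add_mul, smul_add]; abel
  · intro c x y h
    simp only [map_smul, LinearMap.smul_apply, h, smul_mul_assoc, mul_smul_comm, smul_add,
      smul_comm c]
  · intro c x y h
    simp only [map_smul, LinearMap.smul_apply, h, smul_mul_assoc, mul_smul_comm, smul_add,
      smul_comm c]

/-! ### The values on generators -/

lemma bracket_one_right (a : P) : π.bracket a 1 = 0 := by
  have h := π.leibniz a 1 1
  rw [one_mul, mul_one, one_mul] at h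
  exact left_eq_add.1 h

lemma bracket_skew (a b : P) : π.bracket a b = -π.bracket b a := by
  have h := π.bracket_self (a + b)
  simp only [map_add, LinearMap.add_apply, π.bracket_self] at h
  linear_combination h

lemma bracket_one_left (a : P) : π.bracket 1 a = 0 := by
  rw [bracket_skew, bracket_one_right, neg_zero]

lemma symBracket_one_right (l : List (Gen K M)) : symBracket (gprod l) 1 = 0 := by
  have h := symBracket_leibniz_right l [] (1 : Sym K M)
  simp only [gprod_nil, ldeg_nil, mul_zero, sgn_zero, one_smul, mul_one, one_mul] at h
  exact left_eq_add.1 h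

lemma bracket0_coeff_coeff (a b : P) :
    bracket0 π (mono a []) (mono b ([] : List (Gen K M))) = mono (π.bracket a b) [] := by
  simp [mono, bracket0_tmul, gprod_nil, symBracket_one]

lemma bracket0_coeff_gen (a : P) (g : Gen K M) :
    bracket0 π (mono a []) (mono 1 [g]) = 0 := by
  simp [mono, bracket0_tmul, gprod_nil, symBracket_one, bracket_one_right]

lemma bracket0_gen_coeff (a : P) (g : Gen K M) :
    bracket0 π (mono 1 [g]) (mono a []) = 0 := by
  simp only [mono, bracket0_tmul, bracket_one_left, TensorProduct.zero_tmul, zero_add]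
  rw [gprod_nil, symBracket_one_right, TensorProduct.tmul_zero]

lemma bracket0_gen_gen (g h : Gen K M) :
    bracket0 π (mono 1 [g]) (mono 1 [h]) = pairing g h • mono (1 : P) [] := by
  have h1 : symBracket (gprod [g]) (gprod [h]) = pairing g h • (1 : Sym K M) := by
    rw [symBracket_cons, gprod_nil, symBracket_one, mul_zero, zero_add, ldeg_nil, mul_zero,
      sgn_zero, one_smul, one_mul, gprod_cons, gprod_nil, der_gen_mul, der_one]
    simp
  simp only [mono, bracket0_tmul, bracket_one_left, TensorProduct.zero_tmul, zero_add, h1, mul_one,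
    gprod_nil, TensorProduct.tmul_smul]

lemma bracket0_one_right (x : X0 K P M) : bracket0 π x (mono 1 []) = 0 := by
  induction x using X0_induction with
  | zero => simp
  | add x y hx hy => simp [hx, hy]
  | mem a l =>
    simp only [mono, bracket0_tmul, bracket_one_right, TensorProduct.zero_tmul, zero_add]
    rw [gprod_nil, symBracket_one_right, TensorProduct.tmul_zero]

lemma mono_zero_left (l : List (Gen K M)) : mono (0 : P) l = 0 := by simp [mono]

lemma pairing_skew (g h : Gen K M) :
    pairing g h = -(sgn K (g.deg * h.deg) * pairing h g) := by
  cases g with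
  | low m x =>
    cases h with
    | low n y => simp [pairing]
    | high n β =>
      by_cases hmn : m = n
      · subst hmn
        have := sgn_mul_self K ((m : ℤ) * -(m : ℤ))
        simp only [pairing, Gen.deg, dite_true, mul_comm (-(m : ℤ)) (m : ℤ)]
        linear_combination (-β x) * this
      · simp [pairing, hmn]
  | high m α =>
    cases h with
    | high n y => simp [pairing]
    | low n x =>
      by_cases hmn : n = m
      · subst hmn
        simp [pairing, Gen.deg]
      · simp [pairing, hmn]

/-! ### Skew symmetry -/

lemma mono_gen_mul (a : P) (g : Gen K M) (l : List (Gen K M)) :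
    mono a (g :: l) = mono 1 [g] * mono a l := by
  rw [mono_mul]; simp

/-- A property of the elements `mono a l` that holds for elements of `P` and for generators and is
inherited by products holds for all of them. -/
lemma mono_induction {C : X0 K P M → ℤ → Prop} (coeff : ∀ a : P, C (mono a []) 0)
    (gen : ∀ g : Gen K M, C (mono 1 [g]) g.deg)
    (mul : ∀ (x y : X0 K P M) (i j : ℤ), x ∈ X0deg K P M i → y ∈ X0deg K P M j →
      C x i → C y j → C (x * y) (i + j)) (a : P) (l : List (Gen K M)) :
    C (mono a l) (ldeg l) := by
  induction l with
  | nil => simpa [ldeg_nil] using coeff a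
  | cons g l ih =>
    rw [mono_gen_mul, ldeg_cons]
    refine mul _ _ _ _ ?_ (mono_mem a l) (gen g) ih
    simpa [ldeg] using mono_mem (1 : P) [g]

lemma gen_mem_X0deg (g : Gen K M) : mono (1 : P) [g] ∈ X0deg K P M g.deg := by
  simpa [ldeg] using mono_mem (1 : P) [g]

lemma coeff_mem_X0deg (a : P) : mono a ([] : List (Gen K M)) ∈ X0deg K P M 0 := by
  simpa [ldeg] using mono_mem a ([] : List (Gen K M))

/-- Graded skew symmetry of the pair `x`, `y` of degrees `i`, `j`. -/
def SkewAt (x : X0 K P M) (i : ℤ) (y : X0 K P M) (j : ℤ) : Prop :=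
  bracket0 π x y = -(sgn K (i * j) • bracket0 π y x)

variable {π} in
lemma SkewAt.symm {x y : X0 K P M} {i j : ℤ} (h : SkewAt π x i y j) : SkewAt π y j x i := by
  unfold SkewAt at *
  rw [h, smul_neg, smul_smul, mul_comm j i, sgn_mul_self, one_smul, neg_neg]

variable {π} in
lemma SkewAt.mul {x y z : X0 K P M} {i j k : ℤ} (hx : x ∈ X0deg K P M i)
    (hy : y ∈ X0deg K P M j) (hz : z ∈ X0deg K P M k)
    (h1 : SkewAt π x i z k) (h2 : SkewAt π y j z k) : SkewAt π (x * y) (i + j) z k := by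
  unfold SkewAt at *
  have e1 := X0_mul_comm (bracket0_mem π hz hx) hy
  rw [bracket0_mul_left π hx hy, bracket0_mul_right π hz hx, h1, h2, e1]
  simp only [add_mul, sgn_add, mul_comm k i, smul_add, smul_smul, mul_neg, mul_smul_comm, smul_neg,
    neg_add, mul_comm k j]
  have s2 := sgn_mul_self K (i * k)
  have s3 := sgn_mul_self K (j * k)
  match_scalars <;> grind

lemma bracket0_skew {i j : ℤ} {x y : X0 K P M} (hx : x ∈ X0deg K P M i)
    (hy : y ∈ X0deg K P M j) :
    bracket0 π x y = -(sgn K (i * j) • bracket0 π y x) := by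
  have c1 : ∀ (a b : P), SkewAt π (mono a []) 0 (mono b ([] : List (Gen K M))) 0 := by
    intro a b
    rw [SkewAt, bracket0_coeff_coeff, bracket0_coeff_coeff, bracket_skew]
    simp [sgn_zero, mono, TensorProduct.neg_tmul]
  have c2 : ∀ (a : P) (h : Gen K M), SkewAt π (mono a []) 0 (mono 1 [h]) h.deg := by
    intro a h
    rw [SkewAt, bracket0_coeff_gen, bracket0_gen_coeff]; simp
  have c3 : ∀ (g h : Gen K M), SkewAt π (mono 1 [g]) g.deg (mono 1 [h]) h.deg := by
    intro g h
    rw [SkewAt, bracket0_gen_gen, bracket0_gen_gen, pairing_skew]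
    simp [smul_smul]
  have d1 : ∀ (a : P) (b : P) (k : List (Gen K M)),
      SkewAt π (mono b k) (ldeg k) (mono a []) 0 := fun a =>
    mono_induction (C := fun y j => SkewAt π y j (mono a []) 0) (fun b => c1 b a)
      (fun g => (c2 a g).symm) fun x y i j hx hy h1 h2 => h1.mul hx hy (coeff_mem_X0deg a) h2
  have d2 : ∀ (g : Gen K M) (b : P) (k : List (Gen K M)),
      SkewAt π (mono b k) (ldeg k) (mono 1 [g]) g.deg := fun g =>
    mono_induction (C := fun y j => SkewAt π y j (mono 1 [g]) g.deg) (fun b => c2 b g)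
      (fun h => c3 h g) fun x y i j hx hy h1 h2 => h1.mul hx hy (gen_mem_X0deg g) h2
  have d3 : ∀ (b : P) (k : List (Gen K M)) (a : P) (l : List (Gen K M)),
      SkewAt π (mono a l) (ldeg l) (mono b k) (ldeg k) := fun b k =>
    mono_induction (C := fun y j => SkewAt π y j (mono b k) (ldeg k)) (fun a => (d1 a b k).symm)
      (fun g => (d2 g b k).symm) fun x y i j hx hy h1 h2 => h1.mul hx hy (mono_mem b k) h2
  refine X0deg_induction₂ (C := fun x y => bracket0 π x y = -(sgn K (i * j) • bracket0 π y x))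
    ?_ ?_ ?_ ?_ ?_ ?_ ?_ hx hy
  · rintro a l b k rfl rfl; exact d3 b k a l
  · intro y; simp
  · intro y; simp
  · intro x y z hx hy; simp only [map_add, LinearMap.add_apply, hx, hy, smul_add, neg_add]
  · intro x y z hx hy; simp only [map_add, LinearMap.add_apply, hx, hy, smul_add, neg_add]
  · intro c x y h; simp only [map_smul, LinearMap.smul_apply, h, smul_neg, smul_comm c]
  · intro c x y h; simp only [map_smul, LinearMap.smul_apply, h, smul_neg, smul_comm c]

/-! ### The Jacobi identity -/

/-- The graded Jacobi identity for the elements `x`, `y`, `z`, where `x` and `y` have degrees `i`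
and `j`, in the form of a Leibniz rule for `{x, -}`. -/
def JacobiAt (x : X0 K P M) (i : ℤ) (y : X0 K P M) (j : ℤ) (z : X0 K P M) : Prop :=
  bracket0 π x (bracket0 π y z) =
    bracket0 π (bracket0 π x y) z + sgn K (i * j) • bracket0 π y (bracket0 π x z)

variable {π} in
/-- The defect in the Jacobi identity is a graded derivation in the last argument. -/
lemma JacobiAt.mul {x y z t : X0 K P M} {i j k : ℤ} (hx : x ∈ X0deg K P M i)
    (hy : y ∈ X0deg K P M j) (hz : z ∈ X0deg K P M k)
    (h1 : JacobiAt π x i y j z) (h2 : JacobiAt π x i y j t) : JacobiAt π x i y j (z * t) := by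
  unfold JacobiAt at *
  have e1 := bracket0_mul_right π hy hz t
  have e2 := bracket0_mul_right π hx hz t
  have e3 := bracket0_mul_right π (bracket0_mem π hx hy) hz t
  have e4 := bracket0_mul_right π hx (bracket0_mem π hy hz) t
  have e5 := bracket0_mul_right π hy (bracket0_mem π hx hz) t
  have e6 := bracket0_mul_right π hx hz (bracket0 π y t)
  have e7 := bracket0_mul_right π hy hz (bracket0 π x t)
  rw [e1, e2, e3]
  simp only [map_add, map_smul, e4, e5, e6, e7, h1, h2, add_mul, mul_add, smul_add, sgn_add,
    smul_smul, mul_smul_comm, smul_mul_assoc, mul_comm j i]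
  have s2 := sgn_mul_self K (i * j)
  match_scalars <;> grind

variable {π} in
lemma JacobiAt.rotate {x y z : X0 K P M} {i j k : ℤ} (hx : x ∈ X0deg K P M i)
    (hy : y ∈ X0deg K P M j) (hz : z ∈ X0deg K P M k) (h : JacobiAt π x i y j z) :
    JacobiAt π z k x i y := by
  unfold JacobiAt at *
  rw [bracket0_skew π hz (bracket0_mem π hx hy), bracket0_skew π hz hx, bracket0_skew π hz hy]
  simp only [map_neg, map_smul, LinearMap.neg_apply, LinearMap.smul_apply]
  rw [bracket0_skew π (bracket0_mem π hx hz) hy, h]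
  simp only [add_mul, sgn_add, smul_add, smul_neg, neg_neg, smul_smul, mul_comm k, neg_add]
  have s2 := sgn_mul_self K (i * j)
  have s3 := sgn_mul_self K (i * k)
  have s4 := sgn_mul_self K (j * k)
  match_scalars <;> grind

lemma bracket0_jacobi {i j : ℤ} {x y : X0 K P M} (hx : x ∈ X0deg K P M i)
    (hy : y ∈ X0deg K P M j) (z : X0 K P M) :
    bracket0 π x (bracket0 π y z) =
      bracket0 π (bracket0 π x y) z + sgn K (i * j) • bracket0 π y (bracket0 π x z) := by
  -- It suffices to treat three elements satisfying `G`, elements of `P` and generators: the defect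
  -- is a derivation in the last argument, and rotating the arguments moves each to that place.
  let G : X0 K P M → ℤ → Prop := fun x i =>
    (∃ a : P, x = mono a [] ∧ i = 0) ∨ ∃ g : Gen K M, x = mono 1 [g] ∧ i = g.deg
  have hG : ∀ x i, G x i → x ∈ X0deg K P M i := by
    rintro x i (⟨a, rfl, rfl⟩ | ⟨g, rfl, rfl⟩)
    · exact coeff_mem_X0deg a
    · exact gen_mem_X0deg g
  have extend : ∀ (x y : X0 K P M) (i j : ℤ), x ∈ X0deg K P M i → y ∈ X0deg K P M j →
      (∀ z k, G z k → JacobiAt π x i y j z) → ∀ a l, JacobiAt π x i y j (mono a l) := by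
    intro x y i j hx hy h a l
    exact mono_induction (C := fun z k => JacobiAt π x i y j z)
      (fun a => h _ _ (Or.inl ⟨a, rfl, rfl⟩))
      (fun g => h _ _ (Or.inr ⟨g, rfl, rfl⟩)) (fun z t k m hz ht h1 h2 => h1.mul hx hy hz h2) a l
  have g0 : ∀ x y z i j k, G x i → G y j → G z k → JacobiAt π x i y j z := by
    rintro _ _ _ _ _ _ (⟨a, rfl, rfl⟩ | ⟨g, rfl, rfl⟩) (⟨b, rfl, rfl⟩ | ⟨h, rfl, rfl⟩)
      (⟨c, rfl, rfl⟩ | ⟨k, rfl, rfl⟩)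
    · have := π.jacobi a b c
      have e : π.bracket a (π.bracket b c) =
          π.bracket (π.bracket a b) c + π.bracket b (π.bracket a c) := by
        rw [bracket_skew π (π.bracket a b), bracket_skew π a c, map_neg]
        linear_combination this
      simp only [JacobiAt, bracket0_coeff_coeff, mul_zero, sgn_zero, one_smul, e]
      simp [mono, TensorProduct.add_tmul]
    all_goals simp [JacobiAt, bracket0_coeff_coeff, bracket0_coeff_gen, bracket0_gen_coeff,
      bracket0_gen_gen, bracket0_one_right, bracket_one_left, mono_zero_left]
  have g1 : ∀ x y i j, G x i → G y j → ∀ a l, JacobiAt π x i y j (mono a l) :=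
    fun x y i j h1 h2 => extend x y i j (hG x i h1) (hG y j h2) fun z k hz =>
      g0 _ _ _ _ _ _ h1 h2 hz
  have g2 : ∀ a l x i, G x i → ∀ b k, JacobiAt π (mono a l) (ldeg l) x i (mono b k) :=
    fun a l x i h1 => extend _ x _ i (mono_mem a l) (hG x i h1) fun z k hz =>
      (g1 x z i k h1 hz a l).rotate (hG x i h1) (hG z k hz) (mono_mem a l)
  have g3 : ∀ a l b k c m, JacobiAt π (mono a l) (ldeg l) (mono b k) (ldeg k) (mono c m) :=
    fun a l b k => extend _ _ _ _ (mono_mem a l) (mono_mem b k) fun z m hz =>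
      (g2 b k z m hz a l).rotate (mono_mem b k) (hG z m hz) (mono_mem a l)
  refine X0deg_induction₂ (C := fun x y => JacobiAt π x i y j z)
    ?_ ?_ ?_ ?_ ?_ ?_ ?_ hx hy
  · rintro a l b k rfl rfl
    induction z using X0_induction with
    | zero => simp [JacobiAt]
    | add x y hx hy => simp only [JacobiAt, map_add, smul_add] at *; rw [hx, hy]; abel
    | mem c m => exact g3 a l b k c m
  · intro y; simp [JacobiAt]
  · intro y; simp [JacobiAt]
  · intro x y z hx hy
    simp only [JacobiAt, map_add, LinearMap.add_apply, smul_add] at *; rw [hx, hy]; abel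
  · intro x y z hx hy
    simp only [JacobiAt, map_add, LinearMap.add_apply, smul_add] at *; rw [hx, hy]; abel
  · intro c x y h
    simp only [JacobiAt, map_smul, LinearMap.smul_apply] at *
    rw [h, smul_add, smul_comm c]
  · intro c x y h
    simp only [JacobiAt, map_smul, LinearMap.smul_apply] at *
    rw [h, smul_add, smul_comm c]

end Poisson

/-! ### The multigrading of `X₀` -/

section Multigrading

variable {K : Type u} [Field K] {P : Type v} [CommRing P] [Algebra K P]
  {M : ℕ+ → Type w} [∀ n, AddCommGroup (M n)] [∀ n, Module K (M n)]

/-- Minus the degree of an element of `M`, and `0` for elements of `M*`. -/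
def Gen.lo : Gen K M → ℕ
  | .low n _ => n
  | .high _ _ => 0

/-- The degree of an element of `M*`, and `0` for elements of `M`. -/
def Gen.hi : Gen K M → ℕ
  | .low _ _ => 0
  | .high n _ => n

/-- `1` for elements of `M*` and `0` for elements of `M`. -/
def Gen.ct : Gen K M → ℕ
  | .low _ _ => 0
  | .high _ _ => 1

/-- Minus the total degree of the factors from `M`. -/
def lo (l : List (Gen K M)) : ℕ := (l.map Gen.lo).sum

/-- The total degree of the factors from `M*`. -/
def hi (l : List (Gen K M)) : ℕ := (l.map Gen.hi).sum

/-- The number of factors from `M*`. -/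
def ct (l : List (Gen K M)) : ℕ := (l.map Gen.ct).sum

@[simp] lemma lo_nil : lo ([] : List (Gen K M)) = 0 := rfl
@[simp] lemma hi_nil : hi ([] : List (Gen K M)) = 0 := rfl
@[simp] lemma ct_nil : ct ([] : List (Gen K M)) = 0 := rfl
@[simp] lemma lo_cons (g : Gen K M) (l) : lo (g :: l) = g.lo + lo l := by simp [lo]
@[simp] lemma hi_cons (g : Gen K M) (l) : hi (g :: l) = g.hi + hi l := by simp [hi]
@[simp] lemma ct_cons (g : Gen K M) (l) : ct (g :: l) = g.ct + ct l := by simp [ct]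
@[simp] lemma lo_append (l k : List (Gen K M)) : lo (l ++ k) = lo l + lo k := by simp [lo]
@[simp] lemma hi_append (l k : List (Gen K M)) : hi (l ++ k) = hi l + hi k := by simp [hi]
@[simp] lemma ct_append (l k : List (Gen K M)) : ct (l ++ k) = ct l + ct k := by simp [ct]
@[simp] lemma Gen.lo_low (n : ℕ+) (x : M n) : (Gen.low n x : Gen K M).lo = n := rfl
@[simp] lemma Gen.hi_low (n : ℕ+) (x : M n) : (Gen.low n x : Gen K M).hi = 0 := rfl
@[simp] lemma Gen.ct_low (n : ℕ+) (x : M n) : (Gen.low n x : Gen K M).ct = 0 := rfl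
@[simp] lemma Gen.lo_high (n : ℕ+) (α : Module.Dual K (M n)) :
    (Gen.high n α : Gen K M).lo = 0 := rfl
@[simp] lemma Gen.hi_high (n : ℕ+) (α : Module.Dual K (M n)) :
    (Gen.high n α : Gen K M).hi = n := rfl
@[simp] lemma Gen.ct_high (n : ℕ+) (α : Module.Dual K (M n)) :
    (Gen.high n α : Gen K M).ct = 1 := rfl

lemma Gen.deg_eq (g : Gen K M) : g.deg = (g.hi : ℤ) - g.lo := by
  cases g <;> simp [Gen.deg]

lemma ldeg_eq (l : List (Gen K M)) : ldeg l = (hi l : ℤ) - lo l := by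
  induction l with
  | nil => simp [ldeg_nil]
  | cons g l ih => rw [ldeg_cons, ih, Gen.deg_eq, hi_cons, lo_cons]; push_cast; ring

lemma ct_le_hi (l : List (Gen K M)) : ct l ≤ hi l := by
  induction l with
  | nil => simp
  | cons g l ih =>
    have : g.ct ≤ g.hi := by
      cases g with
      | low n x => simp
      | high n α => have := n.pos; simp; omega
    simp; omega

lemma hi_eq_zero_of_ct (l : List (Gen K M)) : ct l = 0 → hi l = 0 := by
  induction l with
  | nil => simp
  | cons g l ih => cases g <;> simp_all

/-- Every product of generators is, up to a scalar, a product of elements of `M` followed by a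
product of elements of `M*`. -/
lemma exists_gprod_split (l : List (Gen K M)) : ∃ (c : K) (l₁ l₂ : List (Gen K M)),
    ct l₁ = 0 ∧ lo l₂ = 0 ∧ lo l₁ = lo l ∧ hi l₂ = hi l ∧ ct l₂ = ct l ∧
      gprod l = c • (gprod l₁ * gprod l₂) := by
  induction l with
  | nil => exact ⟨1, [], [], by simp [gprod_nil]⟩
  | cons g l ih =>
    obtain ⟨c, l₁, l₂, h1, h2, h3, h4, h5, h6⟩ := ih
    cases g with
    | low n x =>
      exact ⟨c, .low n x :: l₁, l₂, by simp [h1], h2, by simp [h3], by simp [h4], by simp [h5],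
        by rw [gprod_cons, h6, gprod_cons, mul_smul_comm, mul_assoc]⟩
    | high n α =>
      refine ⟨c * sgn K ((Gen.high n α : Gen K M).deg * ldeg l₁), l₁, .high n α :: l₂, h1,
        by simp [h2], by simp [h3], by simp [h4], by simp [h5], ?_⟩
      rw [gprod_cons, h6, gprod_cons, mul_smul_comm, ← mul_assoc, gen_gprod_comm, smul_mul_assoc,
        mul_assoc, smul_smul]

/-! ### Multihomogeneous subspaces and projections -/

/-- The span of the products of generators whose `lo`, `hi` and `ct` satisfy `T`. -/
def symSp (K : Type u) [Field K] (M : ℕ+ → Type w) [∀ n, AddCommGroup (M n)]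
    [∀ n, Module K (M n)] (T : ℕ → ℕ → ℕ → Prop) : Submodule K (Sym K M) :=
  Submodule.span K {x | ∃ l : List (Gen K M), T (lo l) (hi l) (ct l) ∧ x = gprod l}

variable (K P M) in
/-- The span of the elements `mono a l` such that `lo l`, `hi l` and `ct l` satisfy `T`. -/
def Sp (T : ℕ → ℕ → ℕ → Prop) : Submodule K (X0 K P M) :=
  Submodule.span K {x | ∃ (a : P) (l : List (Gen K M)), T (lo l) (hi l) (ct l) ∧ x = mono a l}

lemma gprod_mem_symSp {T : ℕ → ℕ → ℕ → Prop} {l : List (Gen K M)} (h : T (lo l) (hi l) (ct l)) :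
    gprod l ∈ symSp K M T :=
  Submodule.subset_span ⟨l, h, rfl⟩

lemma mono_mem_Sp {T : ℕ → ℕ → ℕ → Prop} (a : P) {l : List (Gen K M)}
    (h : T (lo l) (hi l) (ct l)) : mono a l ∈ Sp K P M T :=
  Submodule.subset_span ⟨a, l, h, rfl⟩

lemma tmul_mem_Sp {T : ℕ → ℕ → ℕ → Prop} (a : P) {s : Sym K M} (hs : s ∈ symSp K M T) :
    a ⊗ₜ[K] s ∈ Sp K P M T := by
  refine Submodule.span_induction (p := fun s _ => a ⊗ₜ[K] s ∈ Sp K P M T) ?_ ?_ ?_ ?_ hs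
  · rintro _ ⟨l, hl, rfl⟩; exact mono_mem_Sp a hl
  · simp
  · intro x y _ _ hx hy; rw [TensorProduct.tmul_add]; exact add_mem hx hy
  · intro c x _ hx; rw [TensorProduct.tmul_smul]; exact Submodule.smul_mem _ _ hx

lemma Sp_le {T : ℕ → ℕ → ℕ → Prop} {N : Submodule K (X0 K P M)}
    (h : ∀ (a : P) (l : List (Gen K M)), T (lo l) (hi l) (ct l) → mono a l ∈ N) :
    Sp K P M T ≤ N :=
  Submodule.span_le.2 fun _ ⟨a, l, hl, hx⟩ => hx ▸ h a l hl

/-- Besides `S`, the inclusion of multidegrees may use the constraints `c ≤ h` and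
`c = 0 → h = 0`, which hold for all products of generators. -/
lemma Sp_mono {S T : ℕ → ℕ → ℕ → Prop}
    (h : ∀ l h c, c ≤ h → (c = 0 → h = 0) → S l h c → T l h c) : Sp K P M S ≤ Sp K P M T :=
  Sp_le fun a l hl => mono_mem_Sp a (h _ _ _ (ct_le_hi l) (hi_eq_zero_of_ct l) hl)

lemma mem_Sp_true (x : X0 K P M) : x ∈ Sp K P M fun _ _ _ => True := by
  induction x using X0_induction with
  | zero => exact zero_mem _
  | add x y hx hy => exact add_mem hx hy
  | mem a l => exact mono_mem_Sp a trivial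

/-- The coaction `Sym(M ⊕ M*) → Sym(M ⊕ M*)[ℕ³]` that records the multidegree. -/
def symGrade : Sym K M →ₐ[K] AddMonoidAlgebra (Sym K M) (ℕ × ℕ × ℕ) :=
  symLift (fun g => AddMonoidAlgebra.single (g.lo, g.hi, g.ct) (gen g))
    (by intro n x y; rw [gen_low_add, AddMonoidAlgebra.single_add]; rfl)
    (by intro n c x; rw [gen_low_smul, AddMonoidAlgebra.smul_single]; rfl)
    (by intro n x y; rw [gen_high_add, AddMonoidAlgebra.single_add]; rfl)
    (by intro n c x; rw [gen_high_smul, AddMonoidAlgebra.smul_single]; rfl)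
    (by
      intro g h
      rw [AddMonoidAlgebra.single_mul_single, AddMonoidAlgebra.single_mul_single,
        AddMonoidAlgebra.smul_single, gen_comm g h, add_comm])

lemma symGrade_gprod (l : List (Gen K M)) :
    symGrade (gprod l) = AddMonoidAlgebra.single (lo l, hi l, ct l) (gprod l) := by
  induction l with
  | nil => rw [gprod_nil, map_one]; rfl
  | cons g l ih =>
    rw [gprod_cons, map_mul, ih, symGrade, symLift_gen, AddMonoidAlgebra.single_mul_single]
    simp

open Classical in
/-- The projection of `Sym(M ⊕ M*)` onto `symSp K M T` along the other multidegrees. -/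
def symProj (T : ℕ → ℕ → ℕ → Prop) : Module.End K (Sym K M) :=
  (Finsupp.lsum K fun w : ℕ × ℕ × ℕ => if T w.1 w.2.1 w.2.2 then LinearMap.id else 0) ∘ₗ
    (AddMonoidAlgebra.coeffLinearEquiv K).toLinearMap ∘ₗ
      (symGrade (K := K) (M := M)).toLinearMap

open Classical in
lemma symProj_gprod (T : ℕ → ℕ → ℕ → Prop) (l : List (Gen K M)) :
    symProj T (gprod l) = if T (lo l) (hi l) (ct l) then gprod l else 0 := by
  simp only [symProj, LinearMap.comp_apply, AlgHom.toLinearMap_apply, symGrade_gprod]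
  change (Finsupp.lsum K _) (Finsupp.single _ _) = _
  rw [Finsupp.lsum_single]
  split_ifs <;> rfl

/-- The projection of `X₀` onto `Sp K P M T` along the other multidegrees. -/
def proj (T : ℕ → ℕ → ℕ → Prop) : Module.End K (X0 K P M) := (symProj T).lTensor P

open Classical in
lemma proj_mono (T : ℕ → ℕ → ℕ → Prop) (a : P) (l : List (Gen K M)) :
    proj T (mono a l) = if T (lo l) (hi l) (ct l) then mono a l else 0 := by
  rw [proj, mono, LinearMap.lTensor_tmul, symProj_gprod]
  split_ifs <;> simp

lemma proj_mono_of {T : ℕ → ℕ → ℕ → Prop} (a : P) {l : List (Gen K M)}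
    (h : T (lo l) (hi l) (ct l)) : proj T (mono a l) = mono a l := by
  rw [proj_mono, if_pos h]

lemma proj_mono_of_not {T : ℕ → ℕ → ℕ → Prop} (a : P) {l : List (Gen K M)}
    (h : ¬ T (lo l) (hi l) (ct l)) : proj T (mono a l) = 0 := by
  rw [proj_mono, if_neg h]

lemma Sp_induction {T : ℕ → ℕ → ℕ → Prop} {C : X0 K P M → Prop} (zero : C 0)
    (add : ∀ x y, C x → C y → C (x + y)) (smul : ∀ (c : K) x, C x → C (c • x))
    (mem : ∀ a l, T (lo l) (hi l) (ct l) → C (mono a l))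
    {x : X0 K P M} (hx : x ∈ Sp K P M T) : C x := by
  refine Submodule.span_induction (p := fun x _ => C x) ?_ zero (fun x y _ _ => add x y)
    (fun c x _ => smul c x) hx
  rintro _ ⟨a, l, hl, rfl⟩; exact mem a l hl

lemma proj_mem_inf {S T : ℕ → ℕ → ℕ → Prop} {x : X0 K P M} (hx : x ∈ Sp K P M S) :
    proj T x ∈ Sp K P M fun l h c => S l h c ∧ T l h c := by
  refine Sp_induction (C := fun x => proj T x ∈ Sp K P M fun l h c => S l h c ∧ T l h c)
    ?_ ?_ ?_ ?_ hx
  · simp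
  · intro x y hx hy; rw [map_add]; exact add_mem hx hy
  · intro c x hx; rw [map_smul]; exact Submodule.smul_mem _ _ hx
  · intro a l hl
    by_cases h : T (lo l) (hi l) (ct l)
    · rw [proj_mono_of a h]; exact mono_mem_Sp a ⟨hl, h⟩
    · rw [proj_mono_of_not a h]; exact zero_mem _

lemma proj_mem (T : ℕ → ℕ → ℕ → Prop) (x : X0 K P M) : proj T x ∈ Sp K P M T :=
  Sp_mono (by simp) (proj_mem_inf (T := T) (mem_Sp_true x))

lemma proj_mem_of_mem {S : ℕ → ℕ → ℕ → Prop} (T : ℕ → ℕ → ℕ → Prop) {x : X0 K P M}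
    (hx : x ∈ Sp K P M S) : proj T x ∈ Sp K P M S :=
  Sp_mono (by tauto) (proj_mem_inf (T := T) hx)

/-- On a multihomogeneous subspace, only the restriction of `T` to the multidegrees which occur
matters for `proj T`. -/
lemma proj_congr {S T U : ℕ → ℕ → ℕ → Prop}
    (h : ∀ l h c, c ≤ h → (c = 0 → h = 0) → S l h c → (T l h c ↔ U l h c)) {x : X0 K P M}
    (hx : x ∈ Sp K P M S) : proj T x = proj U x := by
  classical
  refine Sp_induction (C := fun x => proj T x = proj U x) ?_ ?_ ?_ ?_ hx
  · simp
  · intro x y hx hy; rw [map_add, hx, hy, map_add]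
  · intro c x hx; rw [map_smul, hx, map_smul]
  · intro a l hl
    simp only [proj_mono, h _ _ _ (ct_le_hi l) (hi_eq_zero_of_ct l) hl]

lemma proj_true (x : X0 K P M) : proj (fun _ _ _ => True) x = x := by
  induction x using X0_induction with
  | zero => simp
  | add x y hx hy => rw [map_add, hx, hy]
  | mem a l => rw [proj_mono_of a trivial]

lemma proj_false (x : X0 K P M) : proj (fun _ _ _ => False) x = 0 := by
  induction x using X0_induction with
  | zero => simp
  | add x y hx hy => rw [map_add, hx, hy, add_zero]
  | mem a l => rw [proj_mono_of_not a id]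

lemma proj_eq_self {S T : ℕ → ℕ → ℕ → Prop}
    (h : ∀ l h c, c ≤ h → (c = 0 → h = 0) → S l h c → T l h c) {x : X0 K P M}
    (hx : x ∈ Sp K P M S) : proj T x = x := by
  rw [proj_congr (U := fun _ _ _ => True)
    (fun l' h' c' h1 h2 h3 => by simp [h l' h' c' h1 h2 h3]) hx,
    proj_true]

lemma proj_eq_zero {S T : ℕ → ℕ → ℕ → Prop}
    (h : ∀ l h c, c ≤ h → (c = 0 → h = 0) → S l h c → ¬ T l h c) {x : X0 K P M}
    (hx : x ∈ Sp K P M S) : proj T x = 0 := by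
  rw [proj_congr (U := fun _ _ _ => False)
    (fun l' h' c' h1 h2 h3 => by simp [h l' h' c' h1 h2 h3]) hx,
    proj_false]

lemma proj_proj (S T : ℕ → ℕ → ℕ → Prop) (x : X0 K P M) :
    proj S (proj T x) = proj (fun l h c => S l h c ∧ T l h c) x := by
  classical
  induction x using X0_induction with
  | zero => simp
  | add x y hx hy => rw [map_add, map_add, hx, hy, map_add]
  | mem a l =>
    by_cases h : T (lo l) (hi l) (ct l)
    · simp [proj_mono, h]
    · simp [proj_mono, h]

lemma proj_add_proj_not (T : ℕ → ℕ → ℕ → Prop) (x : X0 K P M) :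
    proj T x + proj (fun l h c => ¬ T l h c) x = x := by
  classical
  induction x using X0_induction with
  | zero => simp
  | add x y hx hy => rw [map_add, map_add, add_add_add_comm, hx, hy]
  | mem a l => by_cases h : T (lo l) (hi l) (ct l) <;> simp [proj_mono, h]

lemma mem_Sp_of_proj_eq_zero {S T : ℕ → ℕ → ℕ → Prop} {x : X0 K P M} (hx : x ∈ Sp K P M S)
    (h : proj T x = 0) : x ∈ Sp K P M fun l h c => S l h c ∧ ¬ T l h c := by
  rw [← proj_add_proj_not T x, h, zero_add]
  exact proj_mem_inf hx

lemma mem_Sp_inf {S T : ℕ → ℕ → ℕ → Prop} {x : X0 K P M} (h1 : x ∈ Sp K P M S)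
    (h2 : x ∈ Sp K P M T) : x ∈ Sp K P M fun l h c => S l h c ∧ T l h c := by
  rw [← proj_eq_self (T := T) (fun _ _ _ _ _ => id) h2]
  exact proj_mem_inf h1

lemma X0deg_eq_Sp (n : ℤ) : X0deg K P M n = Sp K P M fun l h _ => (h : ℤ) - l = n := by
  refine le_antisymm (Submodule.span_le.2 ?_) (Sp_le ?_)
  · rintro _ ⟨a, l, rfl, rfl⟩; exact mono_mem_Sp a (ldeg_eq l).symm
  · intro a l hl; exact Submodule.subset_span ⟨a, l, by rw [ldeg_eq, hl], rfl⟩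

lemma mul_mem_Sp {S T U : ℕ → ℕ → ℕ → Prop} {x y : X0 K P M} (hx : x ∈ Sp K P M S)
    (hy : y ∈ Sp K P M T)
    (h : ∀ l h c l' h' c', S l h c → T l' h' c' → U (l + l') (h + h') (c + c')) :
    x * y ∈ Sp K P M U := by
  refine Submodule.span_induction₂ (p := fun x y _ _ => x * y ∈ Sp K P M U)
    ?_ ?_ ?_ ?_ ?_ ?_ ?_ hx hy
  · rintro _ _ ⟨a, l, hl, rfl⟩ ⟨b, k, hk, rfl⟩
    rw [mono_mul]
    exact mono_mem_Sp _ (by simpa using h _ _ _ _ _ _ hl hk)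
  · intro y _; simp
  · intro y _; simp
  · intro x y z _ _ _ hx hy; rw [add_mul]; exact add_mem hx hy
  · intro x y z _ _ _ hx hy; rw [mul_add]; exact add_mem hx hy
  · intro c x y _ _ h; rw [smul_mul_assoc]; exact Submodule.smul_mem _ _ h
  · intro c x y _ _ h; rw [mul_smul_comm]; exact Submodule.smul_mem _ _ h

lemma exists_mono_split (a : P) (l : List (Gen K M)) : ∃ (c : K) (l₁ l₂ : List (Gen K M)),
    ct l₁ = 0 ∧ lo l₂ = 0 ∧ lo l₁ = lo l ∧ hi l₂ = hi l ∧ ct l₂ = ct l ∧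
      mono a l = c • (mono a l₁ * mono 1 l₂) := by
  obtain ⟨c, l₁, l₂, h1, h2, h3, h4, h5, h6⟩ := exists_gprod_split l
  refine ⟨c, l₁, l₂, h1, h2, h3, h4, h5, ?_⟩
  rw [mono_mul, mul_one, mono, h6, TensorProduct.tmul_smul, mono, gprod_append]

/-- `F^p X₀` consists of the elements whose factors from `M*` have total degree at least `p`. -/
lemma mem_FX0_iff {p : ℕ} {x : X0 K P M} :
    x ∈ FX0 K P M p ↔ x ∈ Sp K P M fun _ h _ => p ≤ h := by
  constructor
  · refine FX0_induction (C := fun x => x ∈ Sp K P M fun _ h _ => p ≤ h) (zero_mem _)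
      (fun x y => add_mem) ?_
    intro a l b k hk
    rw [mono_mul]
    refine mono_mem_Sp _ ?_
    rw [ldeg_eq] at hk
    simp only [hi_append]; omega
  · intro hx
    refine Sp_le (N := (FX0 K P M p).restrictScalars K) ?_ hx
    intro a l hl
    obtain ⟨c, l₁, l₂, -, h2, -, h4, -, h6⟩ := exists_mono_split a l
    rw [h6]
    refine FX0_smul c (Ideal.mul_mem_left _ _ (mem_FX0_of_mem ?_ (mono_mem 1 l₂)))
    rw [ldeg_eq]; omega

/-- The square of `I₀` consists of the elements with at least two factors from `M*`. -/
lemma mem_FX0_sq_iff {x : X0 K P M} :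
    x ∈ FX0 K P M 1 ^ 2 ↔ x ∈ Sp K P M fun _ _ c => 2 ≤ c := by
  rw [Submodule.pow_succ, Submodule.pow_one]
  constructor
  · intro hx
    refine Submodule.mul_induction_on (C := fun x => x ∈ Sp K P M fun _ _ c => 2 ≤ c) hx ?_ ?_
    · intro y hy z hz
      have e : Sp K P M (fun _ h _ => 1 ≤ h) ≤ Sp K P M fun _ _ c => 1 ≤ c :=
        Sp_mono (by intros; omega)
      exact mul_mem_Sp (e (mem_FX0_iff.1 hy)) (e (mem_FX0_iff.1 hz)) (by intros; omega)
    · intro x y; exact add_mem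
  · intro hx
    refine Sp_le (N := (FX0 K P M 1 * FX0 K P M 1).restrictScalars K) ?_ hx
    intro a l hl
    induction l with
    | nil => simp at hl
    | cons g l ih =>
      rw [mono_gen_mul]
      cases g with
      | low n x => exact Ideal.mul_mem_left _ _ (ih (by simpa using hl))
      | high n α =>
        have := n.pos
        have := ct_le_hi l
        refine Ideal.mul_mem_mul (mem_FX0_iff.2 (mono_mem_Sp _ ?_))
          (mem_FX0_iff.2 (mono_mem_Sp _ ?_))
        · simp; omega
        · simp at hl; omega

/-! ### Multidegrees and the bracket -/

lemma gen_mul_mem_symSp {S T : ℕ → ℕ → ℕ → Prop} (g : Gen K M) {x : Sym K M}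
    (hx : x ∈ symSp K M S) (h : ∀ l h c, S l h c → T (g.lo + l) (g.hi + h) (g.ct + c)) :
    gen g * x ∈ symSp K M T := by
  refine Submodule.span_induction (p := fun x _ => gen g * x ∈ symSp K M T) ?_ ?_ ?_ ?_ hx
  · rintro _ ⟨l, hl, rfl⟩
    rw [← gprod_cons]
    exact gprod_mem_symSp (by simpa using h _ _ _ hl)
  · simp
  · intro x y _ _ hx hy; rw [mul_add]; exact add_mem hx hy
  · intro c x _ hx; rw [mul_smul_comm]; exact Submodule.smul_mem _ _ hx

lemma gprod_mul_mem_symSp {S T : ℕ → ℕ → ℕ → Prop} (k : List (Gen K M)) {x : Sym K M}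
    (hx : x ∈ symSp K M S) (h : ∀ l h c, S l h c → T (lo k + l) (hi k + h) (ct k + c)) :
    gprod k * x ∈ symSp K M T := by
  refine Submodule.span_induction (p := fun x _ => gprod k * x ∈ symSp K M T) ?_ ?_ ?_ ?_ hx
  · rintro _ ⟨l, hl, rfl⟩
    rw [← gprod_append]
    exact gprod_mem_symSp (by simpa using h _ _ _ hl)
  · simp
  · intro x y _ _ hx hy; rw [mul_add]; exact add_mem hx hy
  · intro c x _ hx; rw [mul_smul_comm]; exact Submodule.smul_mem _ _ hx

lemma symSp_mono {S T : ℕ → ℕ → ℕ → Prop} (h : ∀ l h c, S l h c → T l h c) :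
    symSp K M S ≤ symSp K M T :=
  Submodule.span_mono fun _ ⟨l, hl, hx⟩ => ⟨l, h _ _ _ hl, hx⟩

/-- `{g, -}` removes from a product a factor dual to `g`. -/
lemma der_mem_symSp (g : Gen K M) (k : List (Gen K M)) :
    der g (gprod k) ∈ symSp K M fun l h c =>
      l + g.hi = lo k ∧ h + g.lo = hi k ∧ c + 1 = ct k + g.ct := by
  induction k with
  | nil => rw [gprod_nil, der_one]; exact zero_mem _
  | cons e k ih =>
    rw [gprod_cons, der_gen_mul]
    refine add_mem ?_ (Submodule.smul_mem _ _ (gen_mul_mem_symSp e ih ?_))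
    · cases g with
      | low m x =>
        cases e with
        | low n y => simp [pairing]
        | high n β =>
          by_cases hmn : m = n
          · subst hmn
            exact Submodule.smul_mem _ _ (gprod_mem_symSp (by simp [add_comm]))
          · simp [pairing, hmn]
      | high m α =>
        cases e with
        | high n y => simp [pairing]
        | low n x =>
          by_cases hmn : n = m
          · subst hmn
            exact Submodule.smul_mem _ _ (gprod_mem_symSp (by simp [add_comm]))
          · simp [pairing, hmn]
    · simp only [lo_cons, hi_cons, ct_cons]; intros; omega

/-- The bracket of two products contracts a factor from `M` of one of them with a factor from `M*`
of the other one; `d` is the degree of the latter. -/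
lemma symBracket_mem_symSp (l k : List (Gen K M)) :
    symBracket (gprod l) (gprod k) ∈ symSp K M fun l' h' c' => ∃ d : ℕ, 1 ≤ d ∧
      l' + d = lo l + lo k ∧ h' + d = hi l + hi k ∧ c' + 1 = ct l + ct k ∧
      (d ≤ lo l ∧ d ≤ hi k ∧ 1 ≤ ct k ∨ d ≤ hi l ∧ 1 ≤ ct l ∧ d ≤ lo k) := by
  induction l with
  | nil => rw [gprod_nil, symBracket_one]; exact zero_mem _
  | cons g l ih =>
    rw [symBracket_cons]
    refine add_mem (gen_mul_mem_symSp g ih ?_)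
      (Submodule.smul_mem _ _ (gprod_mul_mem_symSp l (der_mem_symSp g k) ?_))
    · rintro l' h' c' ⟨d, hd⟩
      refine ⟨d, ?_⟩
      simp only [lo_cons, hi_cons, ct_cons]; omega
    · rintro l' h' c' ⟨h1, h2, h3⟩
      cases g with
      | low n x =>
        have := n.pos
        refine ⟨n, ?_⟩
        simp only [Gen.lo_low, Gen.hi_low, Gen.ct_low, lo_cons, hi_cons, ct_cons] at h1 h2 h3 ⊢
        omega
      | high n α =>
        have := n.pos
        refine ⟨n, ?_⟩
        simp only [Gen.lo_high, Gen.hi_high, Gen.ct_high, lo_cons, hi_cons, ct_cons] at h1 h2 h3 ⊢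
        omega

/-- The multidegrees of the terms of a bracket. In `h₀` both factors are multiplied after a bracket
in `P`; in `h₁` a factor from `M` of one of them is contracted with a factor from `M*` of degree `d`
of the other one. -/
lemma bracket0_mem_Sp (π : PoissonStructure K P) {S T U : ℕ → ℕ → ℕ → Prop} {x y : X0 K P M}
    (hx : x ∈ Sp K P M S) (hy : y ∈ Sp K P M T)
    (h₀ : ∀ l h c l' h' c', c ≤ h → (c = 0 → h = 0) → c' ≤ h' → (c' = 0 → h' = 0) →
      S l h c → T l' h' c' → U (l + l') (h + h') (c + c'))
    (h₁ : ∀ l h c l' h' c' l'' h'' c'' d, c ≤ h → (c = 0 → h = 0) → c' ≤ h' → (c' = 0 → h' = 0) →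
      S l h c → T l' h' c' → 1 ≤ d → l'' + d = l + l' → h'' + d = h + h' → c'' + 1 = c + c' →
      (d ≤ l ∧ d ≤ h' ∧ 1 ≤ c' ∨ d ≤ h ∧ 1 ≤ c ∧ d ≤ l') → U l'' h'' c'') :
    bracket0 π x y ∈ Sp K P M U := by
  refine Submodule.span_induction₂ (p := fun x y _ _ => bracket0 π x y ∈ Sp K P M U)
    ?_ ?_ ?_ ?_ ?_ ?_ ?_ hx hy
  · rintro _ _ ⟨a, l, hl, rfl⟩ ⟨b, k, hk, rfl⟩
    have f1 := ct_le_hi l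
    have f2 := hi_eq_zero_of_ct l
    have f3 := ct_le_hi k
    have f4 := hi_eq_zero_of_ct k
    rw [mono, mono, bracket0_tmul, ← gprod_append]
    refine add_mem (mono_mem_Sp _ ?_) (tmul_mem_Sp _ (symSp_mono ?_ (symBracket_mem_symSp l k)))
    · simpa using h₀ _ _ _ _ _ _ f1 f2 f3 f4 hl hk
    · rintro l' h' c' ⟨d, h1, h2, h3, h4, h5⟩
      exact h₁ _ _ _ _ _ _ _ _ _ _ f1 f2 f3 f4 hl hk h1 h2 h3 h4 h5
  · intro y _; simp
  · intro y _; simp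
  · intro x y z _ _ _ hx hy; rw [map_add, LinearMap.add_apply]; exact add_mem hx hy
  · intro x y z _ _ _ hx hy; rw [map_add]; exact add_mem hx hy
  · intro c x y _ _ h; rw [map_smul, LinearMap.smul_apply]; exact Submodule.smul_mem _ _ h
  · intro c x y _ _ h; rw [map_smul]; exact Submodule.smul_mem _ _ h

end Multigrading

/-! ### Elements of the completion and their representatives -/

section Representatives

variable {K : Type u} [Field K] {P : Type v} [CommRing P] [Algebra K P]
  {M : ℕ+ → Type w} [∀ n, AddCommGroup (M n)] [∀ n, Module K (M n)]

/-- The homogeneous element `u` of `X₀` represents `x ∈ Xⁿ` modulo `F^p`. -/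
def Rep {n : ℤ} (p : ℕ) (x : X K P M n) (u : X0 K P M) : Prop :=
  ∃ h : u ∈ X0deg K P M n, x.1 p = toXQuot K P M p n ⟨u, h⟩

variable {n : ℤ} {p : ℕ} {x y : X K P M n} {u v : X0 K P M}

lemma exists_rep (p : ℕ) (x : X K P M n) : ∃ u, Rep p x u := by
  obtain ⟨u, hu⟩ := toXQuot_surjective p n (x.1 p)
  exact ⟨u.1, u.2, hu.symm⟩

lemma Rep.mem_deg (h : Rep p x u) : u ∈ X0deg K P M n := h.1

lemma Rep.mono {q : ℕ} (h : Rep q x u) (hpq : p ≤ q) : Rep p x u := by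
  obtain ⟨h1, h2⟩ := h
  exact ⟨h1, by rw [← x.2 p q hpq, h2, transition_toXQuot]⟩

lemma Rep.add (hx : Rep p x u) (hy : Rep p y v) : Rep p (x + y) (u + v) := by
  obtain ⟨h1, h2⟩ := hx
  obtain ⟨h3, h4⟩ := hy
  exact ⟨add_mem h1 h3, by
    change x.1 p + y.1 p = _
    rw [h2, h4, ← map_add]; rfl⟩

lemma Rep.smul (c : K) (hx : Rep p x u) : Rep p (c • x) (c • u) := by
  obtain ⟨h1, h2⟩ := hx
  exact ⟨Submodule.smul_mem _ c h1, by
    change c • x.1 p = _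
    rw [h2, ← map_smul]; rfl⟩

lemma Rep.neg (hx : Rep p x u) : Rep p (-x) (-u) := by
  rw [← neg_one_smul K x, ← neg_one_smul K u]; exact hx.smul (-1)

lemma rep_toX (p : ℕ) (u : X0deg K P M n) : Rep p (toX n u) u.1 := ⟨u.2, rfl⟩

lemma Rep.congr (hx : Rep p x u) (hv : v ∈ X0deg K P M n) (h : u - v ∈ FX0 K P M p) :
    Rep p x v := by
  obtain ⟨h1, h2⟩ := hx
  refine ⟨hv, ?_⟩
  rw [h2, ← sub_eq_zero, ← map_sub, toXQuot_eq_zero]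
  exact h

lemma Rep.eq (hx : Rep p x u) (hy : Rep p y u) : x.1 p = y.1 p := hx.2.trans hy.2.symm

lemma X_ext (h : ∀ p, ∃ u, Rep p x u ∧ Rep p y u) : x = y := by
  refine Subtype.ext (funext fun p => ?_)
  obtain ⟨u, hx, hy⟩ := h p
  exact hx.eq hy

lemma Rep.bracket (π : PoissonStructure K P) {i j k : ℤ} (h : i + j = k) {s : ℕ} {x : X K P M i}
    {y : X K P M j} (hx : Rep s x u) (hy : Rep s y v) (hs : p + max i.natAbs j.natAbs ≤ s) :
    Rep p (bracket π i j k h x y) (bracket0 π u v) := by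
  obtain ⟨h1, h2⟩ := hx.mono hs
  obtain ⟨h3, h4⟩ := hy.mono hs
  refine ⟨h ▸ bracket0_mem π h1 h3, ?_⟩
  change bracketQuot π i j k h p _ le_rfl (x.1 _) (y.1 _) = _
  rw [h2, h4]; rfl

lemma proj_mem_X0deg (T : ℕ → ℕ → ℕ → Prop) (hu : u ∈ X0deg K P M n) :
    proj T u ∈ X0deg K P M n := by
  rw [X0deg_eq_Sp] at *
  exact proj_mem_of_mem T hu

lemma proj_lt_of_mem_FX0 (hu : u ∈ FX0 K P M p) : proj (fun _ h _ => h < p) u = 0 :=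
  proj_eq_zero (by intros; omega) (mem_FX0_iff.1 hu)

lemma sub_proj_lt_mem_FX0 (u : X0 K P M) : u - proj (fun _ h _ => h < p) u ∈ FX0 K P M p := by
  rw [mem_FX0_iff, sub_eq_iff_eq_add'.2 (proj_add_proj_not (fun _ h _ => h < p) u).symm]
  exact Sp_mono (by intros; omega) (proj_mem _ u)

/-- The canonical representative of `x ∈ Xⁿ` modulo `F^p`, the one whose factors from `M*` have
total degree less than `p`. -/
def tr (n : ℤ) (p : ℕ) : X K P M n →ₗ[K] X0 K P M :=
  xquotLift (p := p) (proj (fun _ h _ => h < p) ∘ₗ (X0deg K P M n).subtype)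
      (fun _ hx => proj_lt_of_mem_FX0 hx) ∘ₗ LinearMap.proj p ∘ₗ (X K P M n).subtype

lemma Rep.tr_eq (hx : Rep p x u) : tr n p x = proj (fun _ h _ => h < p) u := by
  obtain ⟨h1, h2⟩ := hx
  change xquotLift (p := p) (proj (fun _ h _ => h < p) ∘ₗ (X0deg K P M n).subtype)
    (fun _ hx => proj_lt_of_mem_FX0 hx) (x.1 p) = _
  rw [h2]; rfl

lemma rep_tr (p : ℕ) (x : X K P M n) : Rep p x (tr n p x) := by
  obtain ⟨u, hu⟩ := exists_rep p x
  rw [hu.tr_eq]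
  exact hu.congr (proj_mem_X0deg _ hu.mem_deg) (sub_proj_lt_mem_FX0 u)

lemma tr_mem_deg (p : ℕ) (x : X K P M n) : tr n p x ∈ X0deg K P M n := (rep_tr p x).mem_deg

lemma tr_mem_Sp (p : ℕ) (x : X K P M n) : tr n p x ∈ Sp K P M fun _ h _ => h < p := by
  obtain ⟨u, hu⟩ := exists_rep p x
  rw [hu.tr_eq]
  exact proj_mem _ u

lemma apply_eq_zero_of_tr (h : tr n p x = 0) : x.1 p = 0 := by
  have h1 := rep_tr p x
  rw [h] at h1
  exact h1.2.trans (map_zero _)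

/-! ### Multihomogeneous subspaces of the completion -/

variable (K P M) in
/-- The elements of `Xⁿ` all of whose terms have a multidegree satisfying `T`. -/
def Sub (T : ℕ → ℕ → ℕ → Prop) (n : ℤ) : Submodule K (X K P M n) :=
  ⨅ p, (Sp K P M T).comap (tr n p)

lemma mem_Sub {T : ℕ → ℕ → ℕ → Prop} : x ∈ Sub K P M T n ↔ ∀ p, tr n p x ∈ Sp K P M T := by
  simp [Sub]

lemma mem_Sub_of_rep {T : ℕ → ℕ → ℕ → Prop} (h : ∀ p, ∃ u ∈ Sp K P M T, Rep p x u) :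
    x ∈ Sub K P M T n := by
  refine mem_Sub.2 fun p => ?_
  obtain ⟨u, hu, hx⟩ := h p
  rw [hx.tr_eq]
  exact proj_mem_of_mem _ hu

lemma Sub_mono {S T : ℕ → ℕ → ℕ → Prop}
    (h : ∀ l h c : ℕ, c ≤ h → (c = 0 → h = 0) → (h : ℤ) - l = n → S l h c → T l h c) :
    Sub K P M S n ≤ Sub K P M T n := by
  intro x hx
  rw [mem_Sub] at *
  intro p
  have := mem_Sp_inf (hx p) (X0deg_eq_Sp (K := K) (P := P) (M := M) n ▸ tr_mem_deg p x)
  exact Sp_mono (fun l h' c h1 h2 h3 => h l h' c h1 h2 h3.2 h3.1) this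

lemma mem_Sub_true (x : X K P M n) : x ∈ Sub K P M (fun _ _ _ => True) n :=
  mem_Sub.2 fun _ => mem_Sp_true _

/-- The completion of a multihomogeneous ideal is a multihomogeneous subspace of `Xⁿ`. -/
lemma mem_completedIdeal_iff {N : Ideal (X0 K P M)} {T : ℕ → ℕ → ℕ → Prop}
    (hN : ∀ u, u ∈ N ↔ u ∈ Sp K P M T) : x ∈ completedIdeal N n ↔ x ∈ Sub K P M T n := by
  constructor
  · intro hx
    refine mem_Sub_of_rep fun p => ?_
    obtain ⟨u, hu, hux⟩ := hx p
    exact ⟨u.1, (hN _).1 hu, u.2, hux.symm⟩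
  · intro hx p
    obtain ⟨h1, h2⟩ := rep_tr p x
    exact ⟨⟨_, h1⟩, (hN _).2 (mem_Sub.1 hx p), h2.symm⟩

lemma mem_I_iff : x ∈ I K P M n ↔ x ∈ Sub K P M (fun _ h _ => 1 ≤ h) n :=
  mem_completedIdeal_iff fun _ => mem_FX0_iff

lemma mem_IPow_two_iff : x ∈ IPow K P M 2 n ↔ x ∈ Sub K P M (fun _ _ c => 2 ≤ c) n :=
  mem_completedIdeal_iff fun _ => mem_FX0_sq_iff

lemma proj_lt_tr {q : ℕ} (h : p ≤ q) (x : X K P M n) :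
    proj (fun _ h _ => h < p) (tr n q x) = tr n p x :=
  ((rep_tr q x).mono h).tr_eq.symm

/-- An element of `Xⁿ` lies in `Iⁿ` as soon as its component modulo `F^1` vanishes. -/
lemma mem_I_iff_tr : x ∈ I K P M n ↔ tr n 1 x = 0 := by
  rw [mem_I_iff, mem_Sub]
  constructor
  · intro h
    rw [← proj_eq_self (T := fun _ h _ => h < 1) (fun _ _ _ _ _ h => h) (tr_mem_Sp 1 x)]
    exact proj_eq_zero (by intros; omega) (h 1)
  · intro h p
    rcases Nat.eq_zero_or_pos p with rfl | hp
    · exact Sp_mono (by intros; omega) (tr_mem_Sp 0 x)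
    · rw [← proj_lt_tr hp] at h
      exact Sp_mono (by intros; omega) (mem_Sp_of_proj_eq_zero (mem_Sp_true _) h)

/-- The analogue of `bracket0_mem_Sp` for homogeneous elements of the completion. -/
lemma bracket_mem_Sub (π : PoissonStructure K P) {i j k : ℤ} (hk : i + j = k)
    {S T U : ℕ → ℕ → ℕ → Prop} {x : X K P M i} {y : X K P M j}
    (hx : x ∈ Sub K P M S i) (hy : y ∈ Sub K P M T j)
    (h₀ : ∀ l h c l' h' c' : ℕ, (h : ℤ) - l = i → (h' : ℤ) - l' = j →
      c ≤ h → (c = 0 → h = 0) → c' ≤ h' → (c' = 0 → h' = 0) →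
      S l h c → T l' h' c' → U (l + l') (h + h') (c + c'))
    (h₁ : ∀ l h c l' h' c' l'' h'' c'' d : ℕ, (h : ℤ) - l = i → (h' : ℤ) - l' = j →
      c ≤ h → (c = 0 → h = 0) → c' ≤ h' → (c' = 0 → h' = 0) →
      S l h c → T l' h' c' → 1 ≤ d → l'' + d = l + l' → h'' + d = h + h' → c'' + 1 = c + c' →
      (d ≤ l ∧ d ≤ h' ∧ 1 ≤ c' ∨ d ≤ h ∧ 1 ≤ c ∧ d ≤ l') → U l'' h'' c'') :
    bracket π i j k hk x y ∈ Sub K P M U k := by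
  refine mem_Sub_of_rep fun p => ⟨_, ?_, (rep_tr _ x).bracket π hk (rep_tr _ y) le_rfl⟩
  have e : ∀ {n : ℤ} {V : ℕ → ℕ → ℕ → Prop} {z : X K P M n} (q : ℕ), z ∈ Sub K P M V n →
      tr n q z ∈ Sp K P M fun l h c => V l h c ∧ (h : ℤ) - l = n := by
    intro n V z q hz
    exact mem_Sp_inf (mem_Sub.1 hz q) (X0deg_eq_Sp (K := K) (P := P) (M := M) n ▸ tr_mem_deg q z)
  refine bracket0_mem_Sp π (e _ hx) (e _ hy) ?_ ?_
  · intro l h c l' h' c' f1 f2 f3 f4 hS hT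
    exact h₀ _ _ _ _ _ _ hS.2 hT.2 f1 f2 f3 f4 hS.1 hT.1
  · intro l h c l' h' c' l'' h'' c'' d f1 f2 f3 f4 hS hT
    exact h₁ _ _ _ _ _ _ _ _ _ _ hS.2 hT.2 f1 f2 f3 f4 hS.1 hT.1

/-! ### The Poisson identities in the completion -/

variable (π : PoissonStructure K P)

lemma bracket_X_skew {i j k : ℤ} (h : i + j = k) (h' : j + i = k) (x : X K P M i) (y : X K P M j) :
    bracket π i j k h x y = -(sgn K (i * j) • bracket π j i k h' y x) := by
  refine X_ext fun p => ?_
  obtain ⟨u, hu⟩ := exists_rep (p + max i.natAbs j.natAbs) x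
  obtain ⟨v, hv⟩ := exists_rep (p + max i.natAbs j.natAbs) y
  refine ⟨_, hu.bracket π h hv le_rfl, ?_⟩
  rw [bracket0_skew π hu.mem_deg hv.mem_deg]
  exact ((hv.bracket π h' hu (by omega)).smul _).neg

/-- `ad_γ` is a derivation of the bracket. -/
lemma ad_bracket (γ : X K P M 0) (x y : X K P M 1) (h : (1 : ℤ) + 1 = 2) :
    ad π γ 2 (bracket π 1 1 2 h x y) =
      bracket π 1 1 2 h (ad π γ 1 x) y + bracket π 1 1 2 h x (ad π γ 1 y) := by
  refine X_ext fun p => ?_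
  obtain ⟨g, hg⟩ := exists_rep (p + 3) γ
  obtain ⟨u, hu⟩ := exists_rep (p + 3) x
  obtain ⟨v, hv⟩ := exists_rep (p + 3) y
  have e1 : (1 : ℤ).natAbs = 1 := rfl
  have e0 : (0 : ℤ).natAbs = 0 := rfl
  have e2 : (2 : ℤ).natAbs = 2 := rfl
  refine ⟨bracket0 π g (bracket0 π u v), ?_, ?_⟩
  · exact (hg.mono (by omega)).bracket (s := p + 2) π _ (hu.bracket π h hv (by omega)) (by omega)
  · rw [bracket0_jacobi π hg.mem_deg hu.mem_deg, zero_mul, sgn_zero, one_smul]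
    exact (((hg.bracket (p := p + 1) π (zero_add 1) hu (by omega)).bracket π h
      (hv.mono (by omega)) (by omega))).add ((hu.mono (by omega)).bracket π h
      (hg.bracket (p := p + 1) π (zero_add 1) hv (by omega)) (by omega))

/-! ### The weight filtration and limits -/

variable (K P M) in
/-- The elements of `Xⁿ` all of whose terms have weight at least `w`, where the weight of a product
is the number of factors from `M*` plus their total degree. -/
abbrev fil (w : ℕ) (n : ℤ) : Submodule K (X K P M n) := Sub K P M (fun _ h c => w ≤ h + c) n

lemma fil_antitone {w w' : ℕ} (h : w ≤ w') : fil K P M w' n ≤ fil K P M w n :=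
  Sub_mono (by intros; omega)

lemma apply_eq_zero_of_mem_fil {w : ℕ} (hx : x ∈ fil K P M w n) (h : 2 * p ≤ w) : x.1 p = 0 := by
  refine apply_eq_zero_of_tr ?_
  rw [← proj_eq_self (T := fun _ h _ => h < p) (fun _ _ _ _ _ h => h) (tr_mem_Sp p x)]
  exact proj_eq_zero (by intros; omega) (mem_Sub.1 hx p)

lemma eq_zero_of_mem_fil (hx : ∀ w, x ∈ fil K P M w n) : x = 0 :=
  Subtype.ext (funext fun p => apply_eq_zero_of_mem_fil (hx (2 * p)) le_rfl)

/-- Multihomogeneous subspaces are closed for the weight filtration. -/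
lemma mem_Sub_of_approx {T : ℕ → ℕ → ℕ → Prop}
    (h : ∀ N, ∃ y ∈ Sub K P M T n, x - y ∈ fil K P M N n) : x ∈ Sub K P M T n := by
  refine mem_Sub_of_rep fun p => ?_
  obtain ⟨y, hy, hxy⟩ := h (2 * p)
  have h1 : x.1 p = y.1 p := sub_eq_zero.1 (apply_eq_zero_of_mem_fil hxy le_rfl)
  obtain ⟨h2, h3⟩ := rep_tr p y
  exact ⟨_, mem_Sub.1 hy p, h2, h1.trans h3⟩

lemma sub_mem_fil_of_succ {u : ℕ → X K P M n} (hu : ∀ N, u (N + 1) - u N ∈ fil K P M N n)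
    {N m : ℕ} (h : N ≤ m) : u m - u N ∈ fil K P M N n := by
  induction m, h using Nat.le_induction with
  | base => simp
  | succ m hm ih =>
    have := add_mem (fil_antitone hm (hu m)) ih
    rwa [sub_add_sub_cancel] at this

/-- `Xⁿ` is complete for the weight filtration. -/
lemma exists_limit {Y : Type*} [AddCommGroup Y] [Module K Y] (E : ℕ → Y →ₗ[K] X K P M n)
    (hE : ∀ N y, E (N + 1) y - E N y ∈ fil K P M N n) :
    ∃ L : Y →ₗ[K] X K P M n, (∀ N y, L y - E N y ∈ fil K P M N n) ∧
      ∀ y, ConvergesTo (fun N => E N y) (L y) := by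
  have key : ∀ y p m, 2 * p ≤ m → (E m y).1 p = (E (2 * p) y).1 p := by
    intro y p m hm
    have h := apply_eq_zero_of_mem_fil (sub_mem_fil_of_succ (u := fun N => E N y)
      (fun N => hE N y) hm) le_rfl
    exact sub_eq_zero.1 h
  -- Elements of weight at least `2 p` vanish modulo `F^p`, so `E (2 p)` has the right component.
  let L : Y →ₗ[K] X K P M n := LinearMap.codRestrict _
    (LinearMap.pi fun p => LinearMap.proj p ∘ₗ (X K P M n).subtype ∘ₗ E (2 * p)) (by
      intro y p q hpq
      change transition K P M hpq n ((E (2 * q) y).1 q) = (E (2 * p) y).1 p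
      rw [(E (2 * q) y).2 p q hpq, key y p _ (by omega)])
  have hL : ∀ y p m, 2 * p ≤ m → (L y).1 p = (E m y).1 p := fun y p m hm => (key y p m hm).symm
  have htr : ∀ y p m, 2 * p ≤ m → Rep p (L y) (tr n p (E m y)) := by
    intro y p m hm
    obtain ⟨h1, h2⟩ := rep_tr p (E m y)
    exact ⟨h1, (hL y p m hm).trans h2⟩
  refine ⟨L, fun N y => ?_, fun y p => ⟨2 * p, fun m hm => (hL y p m hm).symm⟩⟩
  refine mem_Sub_of_rep fun p => ⟨tr n p (E (2 * p + N) y - E N y), ?_, ?_⟩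
  · exact mem_Sub.1 (sub_mem_fil_of_succ (u := fun N => E N y) (fun N => hE N y) (by omega)) p
  · rw [map_sub, sub_eq_add_neg, sub_eq_add_neg]
    exact (htr y p _ (by omega)).add (rep_tr p _).neg

end Representatives

/-! ### Separating the factors from `M` and from `M*` -/

section Splitting

variable {K : Type u} [Field K] {P : Type v} [CommRing P] [Algebra K P]
  {M : ℕ+ → Type w} [∀ n, AddCommGroup (M n)] [∀ n, Module K (M n)]

lemma twist_twist_comm (m n : ℤ) (s : Sym K M) : twist m (twist n s) = twist n (twist m s) := by
  induction s using sym_induction with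
  | add x y hx hy => simp only [map_add, hx, hy]
  | smul c x hx => simp only [map_smul, hx]
  | one => simp only [map_one]
  | mul g x hx =>
    simp only [map_mul, twist_gen, map_smul, hx, smul_mul_assoc]
    rw [smul_comm]

/-- The action of a generator on `Sym(M ⊕ M*) ⊗ Sym(M ⊕ M*)` in which the elements of `M` multiply
the first factor, and those of `M*` multiply the second one after passing the first one. -/
def splitAux : Gen K M → Module.End K (Sym K M ⊗[K] Sym K M)
  | .low n x => (LinearMap.mulLeft K (gen (.low n x))).rTensor _
  | .high n α =>
      TensorProduct.map (twist (n : ℤ)).toLinearMap (LinearMap.mulLeft K (gen (.high n α)))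

lemma splitAux_low (n : ℕ+) (x : M n) (s t : Sym K M) :
    splitAux (.low n x) (s ⊗ₜ t) = (gen (.low n x) * s) ⊗ₜ t := rfl

lemma splitAux_high (n : ℕ+) (α : Module.Dual K (M n)) (s t : Sym K M) :
    splitAux (.high n α) (s ⊗ₜ t) = twist (n : ℤ) s ⊗ₜ (gen (.high n α) * t) := rfl

lemma gen_mul_gen_mul (g h : Gen K M) (s : Sym K M) :
    gen g * (gen h * s) = sgn K (g.deg * h.deg) • (gen h * (gen g * s)) := by
  rw [← mul_assoc, gen_comm, smul_mul_assoc, mul_assoc]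

lemma splitAux_comm (g h : Gen K M) :
    splitAux g * splitAux h = sgn K (g.deg * h.deg) • (splitAux h * splitAux g) := by
  refine TensorProduct.ext' fun s t => ?_
  rw [LinearMap.smul_apply, Module.End.mul_apply, Module.End.mul_apply]
  cases g with
  | low m x =>
    cases h with
    | low n y => rw [splitAux_low, splitAux_low, splitAux_low, splitAux_low, gen_mul_gen_mul,
        TensorProduct.smul_tmul']
    | high n β =>
      rw [splitAux_high, splitAux_low, splitAux_low, splitAux_high, map_mul, twist_gen,
        smul_mul_assoc, ← TensorProduct.smul_tmul', smul_smul, mul_comm (n : ℤ), Gen.deg, Gen.deg,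
        sgn_mul_self, one_smul]
  | high m α =>
    cases h with
    | low n y =>
      rw [splitAux_high, splitAux_low, splitAux_low, splitAux_high, map_mul, twist_gen,
        smul_mul_assoc, ← TensorProduct.smul_tmul']
      rfl
    | high n β => rw [splitAux_high, splitAux_high, splitAux_high, splitAux_high, gen_mul_gen_mul,
        TensorProduct.tmul_smul, twist_twist_comm]

/-- The action of `Sym(M ⊕ M*)` given by `splitAux`. -/
def splitHom : Sym K M →ₐ[K] Module.End K (Sym K M ⊗[K] Sym K M) :=
  symLift splitAux
    (by
      intro n x y
      refine TensorProduct.ext' fun s t => ?_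
      simp [splitAux_low, gen_low_add, add_mul, TensorProduct.add_tmul])
    (by
      intro n c x
      refine TensorProduct.ext' fun s t => ?_
      simp [splitAux_low, gen_low_smul, TensorProduct.smul_tmul'])
    (by
      intro n x y
      refine TensorProduct.ext' fun s t => ?_
      simp [splitAux_high, gen_high_add, add_mul, TensorProduct.tmul_add])
    (by
      intro n c x
      refine TensorProduct.ext' fun s t => ?_
      simp [splitAux_high, gen_high_smul])
    splitAux_comm

lemma splitHom_low {l : List (Gen K M)} (hl : ct l = 0) (s t : Sym K M) :
    splitHom (gprod l) (s ⊗ₜ t) = (gprod l * s) ⊗ₜ t := by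
  induction l with
  | nil => simp [gprod_nil]
  | cons g l ih =>
    cases g with
    | low n x =>
      rw [gprod_cons, map_mul, Module.End.mul_apply, ih (by simpa using hl), splitHom, symLift_gen,
        splitAux_low, mul_assoc]
    | high n α => simp at hl

lemma splitHom_high {l : List (Gen K M)} (hl : lo l = 0) (t : Sym K M) :
    splitHom (gprod l) (1 ⊗ₜ t) = 1 ⊗ₜ (gprod l * t) := by
  induction l with
  | nil => simp [gprod_nil]
  | cons g l ih =>
    cases g with
    | low n x => simp at hl
    | high n α =>
      rw [gprod_cons, map_mul, Module.End.mul_apply, ih (by simpa using hl), splitHom, symLift_gen,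
        splitAux_high, mul_assoc, map_one]

/-- The linear isomorphism of `Sym(M ⊕ M*)` with the tensor product of its subalgebras generated by
`M` and `M*`, as a map into `Sym(M ⊕ M*) ⊗ Sym(M ⊕ M*)`. -/
def symSplit : Sym K M →ₗ[K] Sym K M ⊗[K] Sym K M :=
  LinearMap.applyₗ ((1 : Sym K M) ⊗ₜ[K] (1 : Sym K M)) ∘ₗ (splitHom (K := K) (M := M)).toLinearMap

lemma symSplit_gprod {l₁ l₂ : List (Gen K M)} (h₁ : ct l₁ = 0) (h₂ : lo l₂ = 0) :
    symSplit (gprod l₁ * gprod l₂) = gprod l₁ ⊗ₜ gprod l₂ := by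
  change splitHom (gprod l₁ * gprod l₂) (1 ⊗ₜ 1) = _
  rw [map_mul, Module.End.mul_apply, splitHom_high h₂, splitHom_low h₁, mul_one, mul_one]

/-- The operator `f ⊗ 1` on `X₀ = (P ⊗ Sym M) ⊗ Sym M*`. -/
def lowMap (f : Module.End K (X0 K P M)) : Module.End K (X0 K P M) :=
  TensorProduct.lift ((LinearMap.mul K (X0 K P M)).compl₂
      (Algebra.TensorProduct.includeRight : Sym K M →ₐ[K] X0 K P M).toLinearMap) ∘ₗ
    f.rTensor (Sym K M) ∘ₗ (TensorProduct.assoc K P (Sym K M) (Sym K M)).symm.toLinearMap ∘ₗ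
      symSplit.lTensor P

lemma lowMap_mono_mul (f : Module.End K (X0 K P M)) (a : P) {l k : List (Gen K M)} (hl : ct l = 0)
    (hk : lo k = 0) : lowMap f (mono a l * mono 1 k) = f (mono a l) * mono 1 k := by
  rw [mono_mul, mul_one, mono, gprod_append]
  simp only [lowMap, LinearMap.comp_apply, LinearMap.lTensor_tmul, symSplit_gprod hl hk,
    LinearEquiv.coe_coe, TensorProduct.assoc_symm_tmul, LinearMap.rTensor_tmul,
    TensorProduct.lift.tmul, LinearMap.compl₂_apply]
  rfl

lemma lowMap_mul_mono (f : Module.End K (X0 K P M)) {a : X0 K P M} {k : List (Gen K M)}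
    (ha : a ∈ Sp K P M fun _ _ c => c = 0) (hk : lo k = 0) :
    lowMap f (a * mono 1 k) = f a * mono 1 k := by
  refine Sp_induction (C := fun a => lowMap f (a * mono 1 k) = f a * mono 1 k) ?_ ?_ ?_ ?_ ha
  · simp
  · intro x y hx hy; rw [add_mul, map_add, hx, hy, map_add, add_mul]
  · intro c x hx; rw [smul_mul_assoc, map_smul, hx, map_smul, smul_mul_assoc]
  · intro a l hl; exact lowMap_mono_mul f a hl hk

end Splitting

/-! ### Exactness of the associated graded complex -/

section Homotopy

lemma exists_generalized_inverse {K V W : Type*} [Field K] [AddCommGroup V] [Module K V]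
    [AddCommGroup W] [Module K W] (f : V →ₗ[K] W) : ∃ σ : W →ₗ[K] V, ∀ v, f (σ (f v)) = f v := by
  obtain ⟨r, hr⟩ := f.rangeRestrict.exists_rightInverse_of_surjective f.range_rangeRestrict
  obtain ⟨σ, hσ⟩ := r.exists_extend
  refine ⟨σ, fun v => ?_⟩
  have h1 : σ (f v) = r (f.rangeRestrict v) := LinearMap.congr_fun hσ (f.rangeRestrict v)
  have h2 := congrArg Subtype.val (LinearMap.congr_fun hr (f.rangeRestrict v))
  rw [h1]; exact h2

/-- An exact sequence of vector spaces `V → U → E` has a contracting homotopy at `U`. -/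
lemma exists_homotopy_of_exact {K E : Type*} [Field K] [AddCommGroup E] [Module K E]
    (δ : Module.End K E) (V U : Submodule K E) (h : ∀ a ∈ U, δ a = 0 → ∃ b ∈ V, δ b = a) :
    ∃ σ τ : Module.End K E, ∀ a ∈ U, σ a ∈ V ∧ δ (σ a) + τ (δ a) = a := by
  obtain ⟨σ, hσ⟩ := exists_generalized_inverse (δ ∘ₗ V.subtype)
  obtain ⟨κ, hκ⟩ := exists_generalized_inverse (δ ∘ₗ U.subtype)
  let p : U →ₗ[K] E := U.subtype - δ ∘ₗ V.subtype ∘ₗ σ ∘ₗ U.subtype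
  have hp : ∀ u : U, δ u = 0 → p u = 0 := by
    intro u hu
    obtain ⟨b, hb, hbu⟩ := h u u.2 hu
    have := hσ ⟨b, hb⟩
    simp only [LinearMap.comp_apply, Submodule.subtype_apply, hbu] at this
    simp [p, this]
  refine ⟨V.subtype ∘ₗ σ, p ∘ₗ κ, fun a ha => ⟨(σ a).2, ?_⟩⟩
  have h1 := hp (⟨a, ha⟩ - κ (δ a)) (by
    have := hκ ⟨a, ha⟩
    simp only [LinearMap.comp_apply, Submodule.subtype_apply] at this
    simp [this])
  rw [map_sub, sub_eq_zero] at h1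
  simp only [LinearMap.comp_apply, ← h1]
  simp [p]

variable {K : Type u} [Field K] {P : Type v} [CommRing P] [Algebra K P]
  {M : ℕ+ → Type w} [∀ n, AddCommGroup (M n)] [∀ n, Module K (M n)]

/-- The homotopies in the finitely many degrees up to `N` combine to a single one. -/
lemma exists_homotopy (δ : Module.End K (X0 K P M)) (N : ℕ)
    (hδ : ∀ q, ∀ a ∈ Sp K P M (fun l _ c => c = 0 ∧ l = q),
      δ a ∈ Sp K P M fun l _ c => c = 0 ∧ l + 1 = q)
    (h : ∀ q, 1 ≤ q → q ≤ N → ∀ a ∈ Sp K P M (fun l _ c => c = 0 ∧ l = q), δ a = 0 →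
      ∃ b ∈ Sp K P M (fun l _ c => c = 0 ∧ l = q + 1), δ b = a) :
    ∃ σ τ : Module.End K (X0 K P M), ∀ q, 1 ≤ q → q ≤ N →
      ∀ a ∈ Sp K P M (fun l _ c => c = 0 ∧ l = q),
        σ a ∈ Sp K P M (fun l _ c => c = 0 ∧ l = q + 1) ∧ δ (σ a) + τ (δ a) = a := by
  have h' : ∀ q, ∃ σ τ : Module.End K (X0 K P M), 1 ≤ q → q ≤ N →
      ∀ a ∈ Sp K P M (fun l _ c => c = 0 ∧ l = q),
        σ a ∈ Sp K P M (fun l _ c => c = 0 ∧ l = q + 1) ∧ δ (σ a) + τ (δ a) = a := by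
    intro q
    by_cases hq : 1 ≤ q ∧ q ≤ N
    · obtain ⟨σ, τ, hστ⟩ := exists_homotopy_of_exact δ _ _ (h q hq.1 hq.2)
      exact ⟨σ, τ, fun _ _ => hστ⟩
    · exact ⟨0, 0, fun h1 h2 => absurd ⟨h1, h2⟩ hq⟩
  choose σ τ hστ using h'
  refine ⟨∑ q ∈ Finset.range (N + 1), σ q ∘ₗ proj (fun l _ c => c = 0 ∧ l = q),
    ∑ q ∈ Finset.range (N + 1), τ q ∘ₗ proj (fun l _ c => c = 0 ∧ l + 1 = q), ?_⟩
  intro q h1 h2 a ha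
  have e1 : (∑ q ∈ Finset.range (N + 1), σ q ∘ₗ proj (fun l _ c => c = 0 ∧ l = q)) a = σ q a := by
    rw [LinearMap.sum_apply, Finset.sum_eq_single q]
    · rw [LinearMap.comp_apply, proj_eq_self (by intros; omega) ha]
    · intro q' _ hq'
      rw [LinearMap.comp_apply, proj_eq_zero (by intros; omega) ha, map_zero]
    · intro hq; exact absurd (Finset.mem_range.2 (by omega)) hq
  have e2 : (∑ q ∈ Finset.range (N + 1), τ q ∘ₗ proj (fun l _ c => c = 0 ∧ l + 1 = q)) (δ a) =
      τ q (δ a) := by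
    rw [LinearMap.sum_apply, Finset.sum_eq_single q]
    · rw [LinearMap.comp_apply, proj_eq_self (by intros; omega) (hδ q a ha)]
    · intro q' _ hq'
      rw [LinearMap.comp_apply, proj_eq_zero (by intros; omega) (hδ q a ha), map_zero]
    · intro hq; exact absurd (Finset.mem_range.2 (by omega)) hq
  rw [e1, e2]
  exact hστ q h1 h2 a ha

variable (π : PoissonStructure K P)

/-- For `r` of degree one, the map induced by `{r, -}` on `X₀ / I₀`, in terms of representatives
without factors from `M*`. -/
def lowDiff (r : X0 K P M) : Module.End K (X0 K P M) :=
  proj (fun _ _ c => c = 0) ∘ₗ bracket0 π r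

lemma lowDiff_mem {r : X0 K P M} (hr : r ∈ X0deg K P M 1) {q : ℕ} {a : X0 K P M}
    (ha : a ∈ Sp K P M fun l _ c => c = 0 ∧ l = q) :
    lowDiff π r a ∈ Sp K P M fun l _ c => c = 0 ∧ l + 1 = q := by
  rw [X0deg_eq_Sp] at hr
  have := bracket0_mem_Sp (U := fun l h c => (h : ℤ) - l = 1 - q) π hr ha
    (by intros; omega) (by intros; omega)
  exact Sp_mono (by intros; omega) (proj_mem_inf this)

lemma bracket0_mem_weight {r : X0 K P M} (hr : r ∈ X0deg K P M 1) {w : ℕ} {x : X0 K P M}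
    (hx : x ∈ Sp K P M fun _ h c => w ≤ h + c) :
    bracket0 π r x ∈ Sp K P M fun _ h c => w ≤ h + c := by
  rw [X0deg_eq_Sp] at hr
  exact bracket0_mem_Sp π hr hx (by intros; omega) (by intros; omega)

/-- On `(P ⊗ Sym M) ⊗ Sym M*`, the part of `{r, -}` that preserves the weight is
`lowDiff π r ⊗ 1`. -/
lemma proj_bracket0_eq_lowMap {r : X0 K P M} (hr : r ∈ X0deg K P M 1) {w : ℕ} {x : X0 K P M}
    (hx : x ∈ Sp K P M fun _ h c => h + c = w) :
    proj (fun _ h c => h + c = w) (bracket0 π r x) = lowMap (lowDiff π r) x := by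
  refine Sp_induction (C := fun x => proj (fun _ h c => h + c = w) (bracket0 π r x) =
    lowMap (lowDiff π r) x) ?_ ?_ ?_ ?_ hx
  · simp
  · intro x y hx hy; rw [map_add, map_add, hx, hy, map_add]
  · intro c x hx; rw [map_smul, map_smul, hx, map_smul]
  · intro a l hl
    obtain ⟨c, l₁, l₂, h1, h2, h3, h4, h5, h6⟩ := exists_mono_split a l
    have hhi := hi_eq_zero_of_ct l₁ h1
    have hβ : mono (1 : P) l₂ ∈ Sp K P M fun l h c => l = 0 ∧ h + c = w :=
      mono_mem_Sp _ (by omega)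
    rw [h6, map_smul, map_smul, map_smul, lowMap_mono_mul _ a h1 h2,
      bracket0_mul_right π hr (mono_mem a l₁), map_add, map_smul]
    congr 1
    -- `{r, β}` has higher weight for a product `β` of elements of `M*`: a term of `r` with a factor
    -- of degree `-d` from `M` has total degree one, hence factors from `M*` of total degree at least
    -- `d + 1`, which outweigh the factor of degree `d` removed from `β`.
    have e1 : bracket0 π r (mono 1 l₂) ∈ Sp K P M fun _ h c => w + 1 ≤ h + c := by
      have hr' := hr
      rw [X0deg_eq_Sp] at hr'
      exact bracket0_mem_Sp π hr' hβ (by intros; omega) (by intros; omega)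
    have e2 : mono a l₁ * bracket0 π r (mono 1 l₂) ∈ Sp K P M fun _ h c => w + 1 ≤ h + c :=
      mul_mem_Sp (mem_Sp_true _) e1 (by intros; omega)
    rw [proj_eq_zero (by intros; omega) e2, smul_zero, add_zero]
    conv_lhs => rw [← proj_add_proj_not (fun _ _ c => c = 0) (bracket0 π r (mono a l₁))]
    rw [add_mul, map_add]
    have e3 : proj (fun _ _ c => c = 0) (bracket0 π r (mono a l₁)) * mono 1 l₂ ∈
        Sp K P M fun _ h c => h + c = w := by
      have : proj (fun _ _ c => c = 0) (bracket0 π r (mono a l₁)) ∈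
        Sp K P M fun _ h c => h + c = 0 := Sp_mono (by intros; omega) (proj_mem _ _)
      exact mul_mem_Sp this hβ (by intros; omega)
    have e4 : proj (fun _ _ c => ¬ c = 0) (bracket0 π r (mono a l₁)) * mono 1 l₂ ∈
        Sp K P M fun _ h c => w + 1 ≤ h + c :=
      mul_mem_Sp (proj_mem _ _) hβ (by intros; omega)
    rw [proj_eq_self (fun _ _ _ _ _ h => h) e3, proj_eq_zero (by intros; omega) e4, add_zero]
    rfl

/-- Exactness of the weight `w` part of the associated graded complex in degree one, for elements
with at least two factors from `M*`, under the assumption that the complex `P ⊗ Sym M` with the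
differential `lowDiff π r` is exact in negative degrees. -/
lemma exists_primitive_of_weight {r : X0 K P M} (hr : r ∈ X0deg K P M 1) {w : ℕ}
    (h : ∀ q, 1 ≤ q → q ≤ w → ∀ a ∈ Sp K P M (fun l _ c => c = 0 ∧ l = q), lowDiff π r a = 0 →
      ∃ b ∈ Sp K P M (fun l _ c => c = 0 ∧ l = q + 1), lowDiff π r b = a)
    {x : X0 K P M} (hx : x ∈ Sp K P M fun l h c => h + c = w ∧ h = l + 1 ∧ 2 ≤ c)
    (hrx : proj (fun _ h c => h + c = w) (bracket0 π r x) = 0) :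
    ∃ y ∈ Sp K P M (fun l h c => h + c = w ∧ h = l ∧ 2 ≤ c),
      proj (fun _ h c => h + c = w) (bracket0 π r y) = x := by
  obtain ⟨σ, τ, hστ⟩ := exists_homotopy (lowDiff π r) w (fun q a => lowDiff_mem π hr) h
  set δ := lowDiff π r with hδ
  have key : lowMap σ x ∈ Sp K P M (fun l h c => h + c = w ∧ h = l ∧ 2 ≤ c) ∧
      lowMap δ (lowMap σ x) + lowMap τ (lowMap δ x) = x := by
    refine Sp_induction (C := fun x => lowMap σ x ∈
      Sp K P M (fun l h c => h + c = w ∧ h = l ∧ 2 ≤ c) ∧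
      lowMap δ (lowMap σ x) + lowMap τ (lowMap δ x) = x) ?_ ?_ ?_ ?_ hx
    · simp
    · rintro x y ⟨hx1, hx2⟩ ⟨hy1, hy2⟩
      refine ⟨by rw [map_add]; exact add_mem hx1 hy1, ?_⟩
      simp only [map_add]
      rw [add_add_add_comm, hx2, hy2]
    · rintro c x ⟨hx1, hx2⟩
      refine ⟨by rw [map_smul]; exact Submodule.smul_mem _ _ hx1, ?_⟩
      simp only [map_smul]
      rw [← smul_add, hx2]
    · intro a l hl
      obtain ⟨c, l₁, l₂, h1, h2, h3, h4, h5, h6⟩ := exists_mono_split a l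
      have hc := ct_le_hi l
      have ha : mono a l₁ ∈ Sp K P M fun l _ c => c = 0 ∧ l = lo l₁ := mono_mem_Sp a ⟨h1, rfl⟩
      obtain ⟨g1, g2⟩ := hστ (lo l₁) (by omega) (by omega) _ ha
      have g3 := lowDiff_mem π hr ha
      have hβ : mono (1 : P) l₂ ∈ Sp K P M fun l h c => l = 0 ∧ h + c = w ∧ 2 ≤ c ∧ h = lo l₁ + 1 :=
        mono_mem_Sp _ (by omega)
      rw [h6]
      simp only [map_smul]
      rw [lowMap_mono_mul σ a h1 h2, lowMap_mono_mul δ a h1 h2,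
        lowMap_mul_mono δ (Sp_mono (by tauto) g1) h2, lowMap_mul_mono τ (Sp_mono (by tauto) g3) h2,
        ← smul_add, ← add_mul, g2]
      exact ⟨Submodule.smul_mem _ _ (mul_mem_Sp (Sp_mono
        (T := fun l h c => c = 0 ∧ h = 0 ∧ l = lo l₁ + 1) (by intros; omega) g1) hβ
          (by intros; omega)), rfl⟩
  rw [proj_bracket0_eq_lowMap π hr (Sp_mono (by tauto) hx)] at hrx
  refine ⟨_, key.1, ?_⟩
  rw [proj_bracket0_eq_lowMap π hr (Sp_mono (by tauto) key.1)]
  have := key.2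
  rwa [hrx, map_zero, add_zero] at this

end Homotopy

/-! ### Primitives modulo higher weight -/

section Primitive

variable {K : Type u} [Field K] {P : Type v} [CommRing P] [Algebra K P]
  {M : ℕ+ → Type w} [∀ n, AddCommGroup (M n)] [∀ n, Module K (M n)]
  (π : PoissonStructure K P)

lemma proj_ct_eq_proj_hi (u : X0 K P M) :
    proj (fun _ _ c => c = 0) u = proj (fun _ h _ => h < 1) u :=
  proj_congr (by intros; omega) (mem_Sp_true u)

lemma dRQuot_mkQ (R : X K P M 1) (i j : ℤ) (h : 1 + i = j) (x : X K P M i) :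
    dRQuot π R i j h ((I K P M i).mkQ x) = (I K P M j).mkQ (dR π R i j h x) := rfl

lemma tr_dR_toX (R : X K P M 1) {i j : ℤ} (h : 1 + i = j) {s : ℕ} (hs : 1 + max 1 i.natAbs ≤ s)
    (u : X0deg K P M i) : tr j 1 (dR π R i j h (toX i u)) = lowDiff π (tr 1 s R) u.1 := by
  have := (rep_tr s R).bracket π h (rep_toX s u) (p := 1) (by simpa using hs)
  rw [dR, this.tr_eq, ← proj_ct_eq_proj_hi]; rfl

/-- The acyclicity of `X / I` in negative degrees, in terms of representatives in `X₀`. -/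
lemma IsBFVModel.exists_low_primitive {J : Ideal P} {R : X K P M 1} (hR : IsBFVModel π J R)
    {s q : ℕ} (hq : 1 ≤ q) (hs : q + 2 ≤ s) {a : X0 K P M}
    (ha : a ∈ Sp K P M fun l _ c => c = 0 ∧ l = q) (hδ : lowDiff π (tr 1 s R) a = 0) :
    ∃ b ∈ Sp K P M (fun l _ c => c = 0 ∧ l = q + 1), lowDiff π (tr 1 s R) b = a := by
  have ha' : a ∈ X0deg K P M (-q) := by
    rw [X0deg_eq_Sp]; exact Sp_mono (by intros; omega) ha
  obtain ⟨y, hy⟩ := hR.acyclic (-(q : ℤ) - 1) (-q) (1 - q) (by ring) (by ring) (by omega)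
    ((I K P M _).mkQ (toX _ ⟨a, ha'⟩)) (by
      rw [dRQuot_mkQ, Submodule.mkQ_apply, Submodule.Quotient.mk_eq_zero, mem_I_iff_tr,
        tr_dR_toX (s := s) _ _ _ (by omega), hδ])
  obtain ⟨y, rfl⟩ := Submodule.mkQ_surjective _ y
  have hb : tr (-(q : ℤ) - 1) 1 y ∈ Sp K P M fun l _ c => c = 0 ∧ l = q + 1 := by
    have h1 := mem_Sp_inf (tr_mem_Sp 1 y)
      (X0deg_eq_Sp (K := K) (P := P) (M := M) (-(q : ℤ) - 1) ▸ tr_mem_deg 1 y)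
    exact Sp_mono (by intros; omega) h1
  refine ⟨_, hb, ?_⟩
  -- `y` may be replaced by its canonical representative, which has the same class modulo `I`.
  have h2 : (I K P M _).mkQ y = (I K P M _).mkQ (toX _ ⟨_, tr_mem_deg 1 y⟩) := by
    rw [← sub_eq_zero, ← map_sub, Submodule.mkQ_apply, Submodule.Quotient.mk_eq_zero, mem_I_iff_tr,
      map_sub, (rep_toX 1 ⟨_, tr_mem_deg 1 y⟩).tr_eq, proj_eq_self (fun _ _ _ _ _ h => h)
        (tr_mem_Sp 1 y), sub_self]
  rw [h2, dRQuot_mkQ, ← sub_eq_zero, ← map_sub, Submodule.mkQ_apply, Submodule.Quotient.mk_eq_zero,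
    mem_I_iff_tr, map_sub, tr_dR_toX (s := s) _ _ _ (by omega), (rep_toX 1 ⟨a, ha'⟩).tr_eq,
    proj_eq_self (by intros; omega) ha, sub_eq_zero] at hy
  exact hy

lemma proj_weight_lt {w p : ℕ} (h : w + 1 ≤ p) (u : X0 K P M) :
    proj (fun _ h c => h + c = w) (proj (fun _ h _ => h < p) u) =
      proj (fun _ h c => h + c = w) u := by
  rw [proj_proj]
  exact proj_congr (by intros; omega) (mem_Sp_true u)

lemma mem_fil_succ {n : ℤ} {w : ℕ} {x : X K P M n} (hx : x ∈ fil K P M w n)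
    (h : proj (fun _ h c => h + c = w) (tr n (w + 1) x) = 0) : x ∈ fil K P M (w + 1) n := by
  refine mem_Sub.2 fun p => ?_
  rw [← proj_lt_tr (le_max_left p (w + 1))]
  refine proj_mem_of_mem _ ?_
  rw [← proj_lt_tr (le_max_right p (w + 1)), proj_weight_lt le_rfl] at h
  exact Sp_mono (by intros; omega) (mem_Sp_of_proj_eq_zero (mem_Sub.1 hx _) h)

/-- If `S ∈ I^{(2)}` has degree one and weight at least `w`, and `{R, S}` has weight greater than
`w`, then `S` is the boundary of an element of `I^{(2)}`, modulo weight greater than `w`. -/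
lemma IsBFVModel.exists_primitive {J : Ideal P} {R : X K P M 1} (hR : IsBFVModel π J R) {w : ℕ}
    {S : X K P M 1} (hS₂ : S ∈ Sub K P M (fun _ _ c => 2 ≤ c) 1) (hS : S ∈ fil K P M w 1)
    (hRS : bracket π 1 1 2 (by norm_num) R S ∈ fil K P M (w + 1) 2) :
    ∃ η ∈ Sub K P M (fun _ _ c => 2 ≤ c) 0, η ∈ fil K P M w 0 ∧
      S - bracket π 1 0 1 (by norm_num) R η ∈ fil K P M (w + 1) 1 := by
  -- The part of weight `w` of all terms below only depends on `R` and `S` modulo `F^s`.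
  set s := w + 2 with hs
  set r := tr 1 s R with hr
  set x := proj (fun _ h c => h + c = w) (tr 1 s S) with hx
  have hx1 : x ∈ Sp K P M fun l h c => h + c = w ∧ h = l + 1 ∧ 2 ≤ c := by
    have h1 := mem_Sp_inf (mem_Sub.1 hS₂ s)
      (X0deg_eq_Sp (K := K) (P := P) (M := M) 1 ▸ tr_mem_deg s S)
    exact Sp_mono (by intros; omega) (proj_mem_inf h1)
  have hx2 : proj (fun _ h c => h + c = w) (bracket0 π r x) = 0 := by
    have h1 := ((rep_tr s R).bracket π (p := w + 1) (by norm_num : (1 : ℤ) + 1 = 2) (rep_tr s S)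
      (by simp; omega)).tr_eq
    have h2 := mem_Sub.1 hRS (w + 1)
    rw [h1] at h2
    have h3 : proj (fun _ h c => h + c = w) (bracket0 π r (tr 1 s S)) = 0 := by
      rw [← proj_weight_lt le_rfl]; exact proj_eq_zero (by intros; omega) h2
    rw [← proj_add_proj_not (fun _ h c => h + c = w) (tr 1 s S), map_add, map_add] at h3
    have h4 : proj (fun _ h c => ¬ h + c = w) (tr 1 s S) ∈ Sp K P M fun _ h c => w + 1 ≤ h + c :=
      Sp_mono (by intros; omega) (proj_mem_inf (mem_Sub.1 hS s))
    rwa [proj_eq_zero (by intros; omega) (bracket0_mem_weight π (tr_mem_deg s R) h4),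
      add_zero] at h3
  obtain ⟨y, hy, hyx⟩ := exists_primitive_of_weight π (tr_mem_deg s R)
    (fun q h1 h2 a => hR.exists_low_primitive π h1 (by omega)) hx1 hx2
  have hy0 : y ∈ X0deg K P M 0 := by
    rw [X0deg_eq_Sp]; exact Sp_mono (by intros; omega) hy
  have hη : ∀ {T : ℕ → ℕ → ℕ → Prop}, y ∈ Sp K P M T → toX 0 ⟨y, hy0⟩ ∈ Sub K P M T 0 :=
    fun hT => mem_Sub_of_rep fun p => ⟨y, hT, rep_toX p ⟨y, hy0⟩⟩
  have hη2 : toX 0 ⟨y, hy0⟩ ∈ fil K P M w 0 := hη (Sp_mono (by intros; omega) hy)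
  refine ⟨toX 0 ⟨y, hy0⟩, hη (Sp_mono (by tauto) hy), hη2, mem_fil_succ (sub_mem hS ?_) ?_⟩
  · exact bracket_mem_Sub π _ (mem_Sub_true R) hη2 (by intros; omega) (by intros; omega)
  · have h1 := ((rep_tr s R).bracket π (p := w + 1) (by norm_num : (1 : ℤ) + 0 = 1)
      (rep_toX s ⟨y, hy0⟩) (by simp; omega)).tr_eq
    rw [map_sub, map_sub, h1, proj_weight_lt le_rfl, hyx, ← proj_lt_tr (show w + 1 ≤ s by omega),
      proj_weight_lt le_rfl, sub_self]

end Primitive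

/-! ### Elements of degree one which act trivially on `X / I` -/

section Euler

variable {K : Type u} [Field K] {P : Type v} [CommRing P] [Algebra K P]
  {M : ℕ+ → Type w} [∀ n, AddCommGroup (M n)] [∀ n, Module K (M n)]
  (π : PoissonStructure K P)

lemma eq_zero_of_mem_Sp_false {T : ℕ → ℕ → ℕ → Prop} {x : X0 K P M} (hx : x ∈ Sp K P M T)
    (h : ∀ l h c, c ≤ h → (c = 0 → h = 0) → ¬ T l h c) : x = 0 := by
  rw [← proj_false x]
  exact (proj_eq_self (by intro l h' c h1 h2 h3; exact h l h' c h1 h2 h3) hx).symm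

lemma bracket0_mono_low (a : P) {l : List (Gen K M)} (hl : ct l = 0) (n : ℕ+) (x : M n) :
    bracket0 π (mono a l) (mono 1 [.low n x]) = 0 := by
  have h1 : symBracket (gprod l) (gprod [.low n x]) ∈ symSp K M fun _ _ _ => False := by
    refine symSp_mono ?_ (symBracket_mem_symSp l [.low n x])
    simp only [lo_cons, hi_cons, ct_cons, Gen.ct_low, ct_nil]
    intros; omega
  have h2 : symBracket (gprod l) (gprod [.low n x]) = 0 := by simpa [symSp] using h1
  rw [mono, mono, bracket0_tmul, bracket_one_right, h2]
  simp

/-- The inclusion of `(M n)*` into `Sym(M ⊕ M*)`. -/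
def genHigh (n : ℕ+) : Module.Dual K (M n) →ₗ[K] Sym K M where
  toFun α := gen (.high n α)
  map_add' := gen_high_add n
  map_smul' := gen_high_smul n

/-- The Euler formula: the terms of `u` with exactly one factor from `M*`, which has degree `n`, are
recovered from the brackets of `u` with a basis of `M n`. -/
lemma proj_eq_euler {n : ℕ+} {ι : Type*} [Fintype ι] (b : Module.Basis ι K (M n)) (u : X0 K P M) :
    proj (fun _ h c => c = 1 ∧ h = n) u = (-sgn K ((n : ℤ) * -(n : ℤ))) • ∑ i,
      proj (fun _ _ c => c = 0) (bracket0 π u (mono 1 [.low n (b i)])) *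
        mono 1 [.high n (b.coord i)] := by
  induction u using X0_induction with
  | zero => simp
  | add x y hx hy =>
    simp only [map_add, LinearMap.add_apply, add_mul, Finset.sum_add_distrib, smul_add, hx, hy]
  | mem a l =>
    obtain ⟨c, l₁, l₂, h1, h2, h3, h4, h5, h6⟩ := exists_mono_split a l
    rw [h6]
    simp only [map_smul, LinearMap.smul_apply, smul_mul_assoc, ← Finset.smul_sum]
    rw [smul_comm _ c]
    congr 1
    have hhi := hi_eq_zero_of_ct l₁ h1
    match l₂, h2 with
    | [], _ =>
      have : mono a l₁ * mono 1 [] = mono a l₁ := by rw [mono_mul]; simp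
      rw [this, proj_mono_of_not a (by omega)]
      simp [bracket0_mono_low π a h1]
    | .low m x :: k, h2 => simp at h2
    | [.high m α], _ =>
      have e : ∀ x : M n, bracket0 π (mono a l₁ * mono 1 [.high m α]) (mono 1 [.low n x]) =
          pairing (Gen.high m α) (.low n x) • mono a l₁ := by
        intro x
        rw [bracket0_leibniz_left, bracket0_mono_low π a h1, mul_zero, smul_zero, add_zero,
          bracket0_gen_gen, mul_smul_comm, mono_mul, mul_one, List.append_nil]
      simp only [e, map_smul, proj_mono_of (T := fun _ _ c => c = 0) a h1, smul_mul_assoc]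
      rw [mono_mul]
      by_cases hmn : n = m
      · subst hmn
        rw [proj_mono_of _ (by simp [hhi, h1])]
        have e2 : ∀ i, mono a l₁ * mono 1 [Gen.high n (b.coord i)] =
            a ⊗ₜ[K] (gprod l₁ * genHigh n (b.coord i)) := by
          intro i
          rw [mono_mul, mul_one, mono, gprod_append, gprod_cons, gprod_nil, mul_one]; rfl
        simp only [e2, pairing, dite_true, mul_smul, ← TensorProduct.tmul_smul, ← mul_smul_comm,
          ← map_smul, ← TensorProduct.tmul_sum, ← Finset.mul_sum, ← map_sum, ← Finset.smul_sum]
        rw [b.sum_dual_apply_smul_coord, smul_smul, neg_mul_neg, sgn_mul_self, one_smul, mul_one,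
          mono, gprod_append, gprod_cons, gprod_nil, mul_one]
        rfl
      · rw [proj_mono_of_not _ (by
          have : (m : ℕ) ≠ n := fun h => hmn (PNat.coe_injective h.symm)
          simp [this, hhi])]
        simp [pairing, hmn]
    | .high m α :: .low m' x :: k, h2 => simp at h2
    | .high m α :: .high m' β :: k, _ =>
      have hc : mono a l₁ * mono 1 (.high m α :: .high m' β :: k) ∈
          Sp K P M fun _ _ c => 2 ≤ c := by
        rw [mono_mul]; exact mono_mem_Sp _ (by simp; omega)
      rw [proj_eq_zero (by intros; omega) hc]
      have e : ∀ x : M n, proj (fun _ _ c => c = 0) (bracket0 π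
          (mono a l₁ * mono 1 (.high m α :: .high m' β :: k)) (mono 1 [.low n x])) = 0 := by
        intro x
        have hx : mono (1 : P) [(Gen.low n x : Gen K M)] ∈ Sp K P M fun _ _ c => c = 0 :=
          mono_mem_Sp _ (by simp)
        exact proj_eq_zero (S := fun _ _ c => 1 ≤ c) (by intros; omega)
          (bracket0_mem_Sp π hc hx (by intros; omega) (by intros; omega))
      simp [e]

/-- An element of `X₀` vanishes if its components for the degree in `M*` do. -/
lemma eq_zero_of_forall_proj_hi {p : ℕ} {u : X0 K P M} (hu : u ∈ Sp K P M fun _ h _ => h < p)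
    (h : ∀ m, proj (fun _ h _ => h = m) u = 0) : u = 0 := by
  induction p with
  | zero => exact eq_zero_of_mem_Sp_false hu (by intros; omega)
  | succ p ih => exact ih (Sp_mono (by intros; omega) (mem_Sp_of_proj_eq_zero hu (h p)))

lemma low_mem_X0deg (n : ℕ+) (x : M n) :
    mono (1 : P) [(Gen.low n x : Gen K M)] ∈ X0deg K P M (-(n : ℤ)) :=
  gen_mem_X0deg (Gen.low n x)

lemma proj_ct_bracket0_low {S : X K P M 1}
    (hS : ∀ (i j : ℤ) (h : 1 + i = j) (x : X K P M i), dR π S i j h x ∈ I K P M j)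
    {s : ℕ} {n : ℕ+} (hs : n + 1 ≤ s) (x : M n) :
    proj (fun _ _ c => c = 0) (bracket0 π (tr 1 s S) (mono 1 [.low n x])) = 0 := by
  have hj : 1 + -(n : ℤ) = 1 - n := by ring
  let u : X0deg K P M (-(n : ℤ)) := ⟨mono 1 [.low n x], low_mem_X0deg n x⟩
  have h1 := mem_I_iff_tr.1 (hS (-(n : ℤ)) (1 - n) hj (toX _ u))
  rwa [tr_dR_toX (s := s) π S hj (by have := n.pos; omega) u] at h1

/-- If `{S, -}` vanishes on `X / I` then `S` lies in `I^{(2)}`. -/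
lemma mem_of_bracket_mem_I [∀ n, FiniteDimensional K (M n)] {S : X K P M 1}
    (hS : ∀ (i j : ℤ) (h : 1 + i = j) (x : X K P M i), dR π S i j h x ∈ I K P M j) :
    S ∈ Sub K P M (fun _ _ c => 2 ≤ c) 1 := by
  have key : ∀ (n : ℕ+) (p : ℕ), proj (fun _ h c => c = 1 ∧ h = n) (tr 1 p S) = 0 := by
    intro n p
    -- `{S, x}` modulo `F^1`, for `x` of degree `-n`, requires `S` modulo `F^(n + 1)`.
    set s := p + n + 1 with hs
    have h1 : proj (fun _ h c => c = 1 ∧ h = n) (tr 1 s S) = 0 := by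
      rw [proj_eq_euler π (Module.finBasis K (M n))]
      refine (congrArg _ (Finset.sum_eq_zero fun i _ => ?_)).trans (smul_zero _)
      rw [proj_ct_bracket0_low π hS (by omega), zero_mul]
    rw [← proj_lt_tr (show p ≤ s by omega), proj_proj]
    have h3 := congrArg (proj fun _ h _ => h < p) h1
    rw [proj_proj, map_zero] at h3
    rw [← h3]
    exact proj_congr (by intros; tauto) (mem_Sp_true _)
  refine mem_Sub.2 fun p => ?_
  have h1 : tr 1 p S ∈ Sp K P M fun l h c => 1 ≤ c := by
    have := X0deg_eq_Sp (K := K) (P := P) (M := M) 1 ▸ tr_mem_deg p S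
    exact Sp_mono (by intros; omega) this
  have h2 : proj (fun _ _ c => c = 1) (tr 1 p S) = 0 := by
    refine eq_zero_of_forall_proj_hi (proj_mem_of_mem _ (tr_mem_Sp p S)) fun m => ?_
    rw [proj_proj]
    rcases Nat.eq_zero_or_pos m with rfl | hm
    · exact proj_eq_zero (by intros; omega) h1
    · rw [← key ⟨m, hm⟩ p]
      exact proj_congr (by intros; rw [and_comm]; rfl) (mem_Sp_true _)
  exact Sp_mono (by intros; omega) (mem_Sp_of_proj_eq_zero h1 h2)

end Euler

/-! ### Exponentials -/

/-- If `D` acts as a derivation for the bilinear map `B` and `B x x = 0`, then the homogeneous parts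
of `B (exp D x) (exp D x)` vanish. -/
lemma sum_antidiagonal_derivation_eq_zero {K V W : Type*} [Field K] [CharZero K] [AddCommGroup V]
    [Module K V] [AddCommGroup W] [Module K W] (B : V →ₗ[K] V →ₗ[K] W) (D : Module.End K V)
    (D' : Module.End K W) (hD : ∀ x y, D' (B x y) = B (D x) y + B x (D y)) {x : V}
    (hx : B x x = 0) (n : ℕ) :
    ∑ m ∈ Finset.HasAntidiagonal.antidiagonal n,
      (((m.1.factorial : K)⁻¹) * ((m.2.factorial : K)⁻¹)) • B ((D ^ m.1) x) ((D ^ m.2) x) = 0 := by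
  -- On `V ⊗ V` the operator `D ⊗ 1 + 1 ⊗ D` lifts `D'`, and its powers are given by the binomial
  -- theorem.
  set L := TensorProduct.lift B with hL
  set D₁ : Module.End K (V ⊗[K] V) := D.rTensor V with hD₁
  set D₂ : Module.End K (V ⊗[K] V) := D.lTensor V with hD₂
  have hc : Commute D₁ D₂ := by
    refine TensorProduct.ext' fun s t => ?_
    simp [hD₁, hD₂]
  have h1 : ∀ z, L ((D₁ + D₂) z) = D' (L z) := by
    intro z
    refine LinearMap.congr_fun (f := L ∘ₗ (D₁ + D₂)) (g := D' ∘ₗ L) ?_ z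
    refine TensorProduct.ext' fun s t => ?_
    simp [hL, hD₁, hD₂, hD]
  have h2 : ∀ n z, L (((D₁ + D₂) ^ n) z) = (D' ^ n) (L z) := by
    intro n
    induction n with
    | zero => simp
    | succ n ih =>
      intro z
      rw [pow_succ, Module.End.mul_apply, ih, h1, pow_succ, Module.End.mul_apply]
  have h3 : ∀ i j, (D₁ ^ i * D₂ ^ j) (x ⊗ₜ x) = (D ^ i) x ⊗ₜ (D ^ j) x := by
    intro i j
    rw [hD₁, hD₂, LinearMap.rTensor_pow, LinearMap.lTensor_pow, Module.End.mul_apply,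
      LinearMap.lTensor_tmul, LinearMap.rTensor_tmul]
  have h4 := h2 n (x ⊗ₜ x)
  rw [hc.add_pow', hL, TensorProduct.lift.tmul, hx, map_zero, LinearMap.sum_apply, map_sum] at h4
  have h5 : ∀ m ∈ Finset.HasAntidiagonal.antidiagonal n,
      (((m.1.factorial : K)⁻¹) * ((m.2.factorial : K)⁻¹)) •
      B ((D ^ m.1) x) ((D ^ m.2) x) = ((n.factorial : K)⁻¹) •
        (TensorProduct.lift B) ((n.choose m.1 • (D₁ ^ m.1 * D₂ ^ m.2)) (x ⊗ₜ x)) := by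
    intro m hm
    rw [Finset.HasAntidiagonal.mem_antidiagonal] at hm
    rw [LinearMap.smul_apply, h3, map_nsmul, TensorProduct.lift.tmul, ← Nat.cast_smul_eq_nsmul K,
      smul_smul]
    congr 1
    have e : (n.choose m.1 : K) * m.1.factorial * m.2.factorial = n.factorial := by
      rw [← hm, Nat.choose_symm_add]
      exact_mod_cast Nat.add_choose_mul_factorial_mul_factorial m.1 m.2
    have f1 : (m.1.factorial : K) ≠ 0 := by exact_mod_cast m.1.factorial_ne_zero
    have f2 : (m.2.factorial : K) ≠ 0 := by exact_mod_cast m.2.factorial_ne_zero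
    have f3 : (n.factorial : K) ≠ 0 := by exact_mod_cast n.factorial_ne_zero
    field_simp
    linear_combination -e
  rw [Finset.sum_congr rfl h5, ← Finset.smul_sum, h4, smul_zero]

section Exponential

variable {K : Type u} [Field K] {P : Type v} [CommRing P] [Algebra K P]
  {M : ℕ+ → Type w} [∀ n, AddCommGroup (M n)] [∀ n, Module K (M n)]
  (π : PoissonStructure K P)

/-! ### The bracket and the weight filtration -/

variable {π}

lemma ad_mem_fil {γ : X K P M 0} (hγ : γ ∈ Sub K P M (fun _ _ c => 2 ≤ c) 0) {n : ℤ} {w : ℕ}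
    {x : X K P M n} (hx : x ∈ fil K P M w n) : ad π γ n x ∈ fil K P M (w + 1) n :=
  bracket_mem_Sub π _ hγ hx (by intros; omega) (by intros; omega)

lemma ad_pow_mem_fil {γ : X K P M 0} (hγ : γ ∈ Sub K P M (fun _ _ c => 2 ≤ c) 0) {n : ℤ}
    (x : X K P M n) (j : ℕ) : (ad π γ n ^ j) x ∈ fil K P M j n := by
  induction j with
  | zero => exact Sub_mono (by intros; omega) (mem_Sub_true _)
  | succ j ih => rw [pow_succ', Module.End.mul_apply]; exact ad_mem_fil hγ ih

lemma ad_mem_sq {γ : X K P M 0} (hγ : γ ∈ Sub K P M (fun _ _ c => 2 ≤ c) 0) (x : X K P M 1) :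
    ad π γ 1 x ∈ Sub K P M (fun _ _ c => 2 ≤ c) 1 :=
  bracket_mem_Sub π _ hγ (mem_Sub_true x) (by intros; omega) (by intros; omega)

lemma bracket_mem_fil_succ {u : X K P M 1} (hu : u ∈ Sub K P M (fun _ _ c => 2 ≤ c) 1) {w : ℕ}
    {x : X K P M 1} (hx : x ∈ fil K P M w 1) (h : (1 : ℤ) + 1 = 2) :
    bracket π 1 1 2 h u x ∈ fil K P M (w + 1) 2 :=
  bracket_mem_Sub π _ hu hx (by intros; omega) (by intros; omega)

lemma bracket_mem_fil_left {w : ℕ} {x y : X K P M 1} (hx : x ∈ fil K P M w 1)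
    (h : (1 : ℤ) + 1 = 2) : bracket π 1 1 2 h x y ∈ fil K P M w 2 :=
  bracket_mem_Sub π _ hx (mem_Sub_true y) (by intros; omega) (by intros; omega)

lemma bracket_mem_fil_right {w : ℕ} {x y : X K P M 1} (hy : y ∈ fil K P M w 1)
    (h : (1 : ℤ) + 1 = 2) : bracket π 1 1 2 h x y ∈ fil K P M w 2 :=
  bracket_mem_Sub π _ (mem_Sub_true x) hy (by intros; omega) (by intros; omega)

lemma ad_mem_fil_of_mem_fil {w : ℕ} {η : X K P M 0} (hη : η ∈ fil K P M w 0) (x : X K P M 1) :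
    ad π η 1 x ∈ fil K P M w 1 :=
  bracket_mem_Sub π _ hη (mem_Sub_true x) (by intros; omega) (by intros; omega)

lemma ad_mem_fil_succ_of_mem_sq {w : ℕ} {η : X K P M 0} (hη : η ∈ fil K P M w 0) {u : X K P M 1}
    (hu : u ∈ Sub K P M (fun _ _ c => 2 ≤ c) 1) : ad π η 1 u ∈ fil K P M (w + 1) 1 :=
  bracket_mem_Sub π _ hη hu (by intros; omega) (by intros; omega)

/-! ### Partial sums of the exponential series -/

variable (π) in
/-- The `N`-th partial sum of the series `exp ad_γ`. -/
def expPart (γ : X K P M 0) (n : ℤ) (N : ℕ) : Module.End K (X K P M n) :=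
  ∑ j ∈ Finset.range N, ((j.factorial : K)⁻¹) • ad π γ n ^ j

lemma expPart_apply (γ : X K P M 0) (n : ℤ) (N : ℕ) (x : X K P M n) :
    expPart π γ n N x = ∑ j ∈ Finset.range N, ((j.factorial : K)⁻¹) • (ad π γ n ^ j) x := by
  simp [expPart, LinearMap.sum_apply]

lemma exists_isExpAd {γ : X K P M 0} (hγ : γ ∈ Sub K P M (fun _ _ c => 2 ≤ c) 0) :
    ∃ g : ∀ n : ℤ, X K P M n →ₗ[K] X K P M n, IsExpAd π γ g ∧
      ∀ n N x, g n x - expPart π γ n N x ∈ fil K P M N n := by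
  have h : ∀ n, ∃ L : X K P M n →ₗ[K] X K P M n,
      (∀ N y, L y - expPart π γ n N y ∈ fil K P M N n) ∧
        ∀ y, ConvergesTo (fun N => expPart π γ n N y) (L y) := by
    intro n
    refine exists_limit _ fun N y => ?_
    rw [expPart_apply, expPart_apply, Finset.sum_range_succ, add_sub_cancel_left]
    exact Submodule.smul_mem _ _ (ad_pow_mem_fil hγ y N)
  choose g hg1 hg2 using h
  refine ⟨g, fun n x => ?_, hg1⟩
  simpa only [expPart_apply] using hg2 n x

lemma expPart_sub_mem_sq {γ : X K P M 0} (hγ : γ ∈ Sub K P M (fun _ _ c => 2 ≤ c) 0)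
    (R : X K P M 1) (N : ℕ) : expPart π γ 1 (N + 1) R - R ∈ Sub K P M (fun _ _ c => 2 ≤ c) 1 := by
  rw [expPart_apply, Finset.sum_range_succ']
  simp only [Nat.factorial_zero, Nat.cast_one, inv_one, one_smul, pow_zero, Module.End.one_apply,
    add_sub_cancel_right]
  refine sum_mem fun j _ => Submodule.smul_mem _ _ ?_
  rw [pow_succ', Module.End.mul_apply]
  exact ad_mem_sq hγ _

/-- A change of `γ` in weight `w` changes `exp(ad_γ) R` by `{η, R}`, up to higher weight. -/
lemma expPart_add_sub_mem_fil {γ η : X K P M 0} (hγ : γ ∈ Sub K P M (fun _ _ c => 2 ≤ c) 0)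
    (hη : η ∈ Sub K P M (fun _ _ c => 2 ≤ c) 0) {w : ℕ} (hw : η ∈ fil K P M w 0) (R : X K P M 1)
    (N : ℕ) : expPart π (γ + η) 1 (N + 2) R - expPart π γ 1 (N + 2) R - ad π η 1 R ∈
      fil K P M (w + 1) 1 := by
  have had : ad π (γ + η) 1 = ad π γ 1 + ad π η 1 := by simp [ad]
  have hsucc : ∀ j, (ad π (γ + η) 1 ^ (j + 1)) R - (ad π γ 1 ^ (j + 1)) R =
      ad π (γ + η) 1 ((ad π (γ + η) 1 ^ j) R - (ad π γ 1 ^ j) R) +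
        ad π η 1 ((ad π γ 1 ^ j) R) := by
    intro j
    rw [pow_succ', pow_succ', Module.End.mul_apply, Module.End.mul_apply, map_sub]
    have e := LinearMap.congr_fun had ((ad π γ 1 ^ j) R)
    rw [LinearMap.add_apply] at e
    rw [e]; abel
  have hstep : ∀ j, (ad π (γ + η) 1 ^ (j + 1)) R - (ad π γ 1 ^ (j + 1)) R ∈ fil K P M w 1 →
      (ad π (γ + η) 1 ^ (j + 2)) R - (ad π γ 1 ^ (j + 2)) R ∈ fil K P M (w + 1) 1 := by
    intro j hj
    rw [hsucc (j + 1)]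
    refine add_mem (ad_mem_fil (add_mem hγ hη) hj) (ad_mem_fil_succ_of_mem_sq hw ?_)
    rw [pow_succ', Module.End.mul_apply]
    exact ad_mem_sq hγ _
  have hall : ∀ j, (ad π (γ + η) 1 ^ (j + 1)) R - (ad π γ 1 ^ (j + 1)) R ∈ fil K P M w 1 := by
    intro j
    induction j with
    | zero =>
      rw [hsucc 0, pow_zero, pow_zero, sub_self, map_zero, zero_add]
      exact ad_mem_fil_of_mem_fil hw _
    | succ j ih => exact fil_antitone (Nat.le_succ w) (hstep j ih)
  rw [expPart_apply, expPart_apply, ← Finset.sum_sub_distrib,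
    Finset.sum_congr rfl fun j _ => (smul_sub ((j.factorial : K)⁻¹) _ _).symm,
    Finset.sum_range_succ', Finset.sum_range_succ']
  have e : ((0 + 1).factorial : K)⁻¹ • ((ad π (γ + η) 1 ^ (0 + 1)) R - (ad π γ 1 ^ (0 + 1)) R) =
      ad π η 1 R := by
    rw [hsucc 0, pow_zero, pow_zero, sub_self, map_zero, zero_add, zero_add, Nat.factorial_one,
      Nat.cast_one, inv_one, one_smul, Module.End.one_apply]
  rw [e, pow_zero, pow_zero, sub_self, smul_zero, add_zero, add_sub_cancel_right]
  exact sum_mem fun j _ => Submodule.smul_mem _ _ (hstep j (hall j))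

/-- Gauge transformations preserve the classical master equation. -/
lemma MasterEquation.of_expPart [CharZero K] {γ : X K P M 0}
    (hγ : γ ∈ Sub K P M (fun _ _ c => 2 ≤ c) 0) {R R₁ : X K P M 1} (hR : MasterEquation π R)
    (hR₁ : ∀ N, R₁ - expPart π γ 1 N R ∈ fil K P M N 1) : MasterEquation π R₁ := by
  refine eq_zero_of_mem_fil fun N => ?_
  set B := bracket (M := M) π 1 1 2 (by norm_num) with hB
  set e := expPart π γ 1 (2 * N) R with he
  have hρ : R₁ - e ∈ fil K P M N 1 := fil_antitone (by omega) (hR₁ (2 * N))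
  have h1 : B R₁ R₁ = B (R₁ - e) R₁ + B e (R₁ - e) + B e e := by
    simp only [map_sub, LinearMap.sub_apply]; abel
  rw [h1]
  refine add_mem (add_mem (bracket_mem_fil_left hρ _) (bracket_mem_fil_right hρ _)) ?_
  have h2 : B e e = ∑ m ∈ Finset.range (2 * N) ×ˢ Finset.range (2 * N),
      (((m.1.factorial : K)⁻¹) * ((m.2.factorial : K)⁻¹)) •
        B ((ad π γ 1 ^ m.1) R) ((ad π γ 1 ^ m.2) R) := by
    rw [Finset.sum_product_right, he, expPart_apply, map_sum]
    refine Finset.sum_congr rfl fun j _ => ?_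
    rw [map_sum, LinearMap.sum_apply]
    refine Finset.sum_congr rfl fun i _ => ?_
    rw [map_smul, map_smul, LinearMap.smul_apply, smul_smul, mul_comm]
  -- The terms of total order less than `2 N` cancel, and the other ones have large weight.
  rw [h2, ← Finset.sum_filter_add_sum_filter_not _ fun m : ℕ × ℕ => m.1 + m.2 < 2 * N]
  refine add_mem ?_ (sum_mem fun m hm => Submodule.smul_mem _ _ ?_)
  · have h3 : ∀ m ∈ (Finset.range (2 * N) ×ˢ Finset.range (2 * N)).filter
        (fun m : ℕ × ℕ => m.1 + m.2 < 2 * N), m.1 + m.2 ∈ Finset.range (2 * N) := by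
      intro m hm
      exact Finset.mem_range.2 (Finset.mem_filter.1 hm).2
    rw [← Finset.sum_fiberwise_of_maps_to h3]
    refine sum_mem fun n hn => ?_
    have h4 : ((Finset.range (2 * N) ×ˢ Finset.range (2 * N)).filter
        (fun m : ℕ × ℕ => m.1 + m.2 < 2 * N)).filter (fun m => m.1 + m.2 = n) =
          Finset.HasAntidiagonal.antidiagonal n := by
      ext m
      simp only [Finset.mem_filter, Finset.mem_product, Finset.mem_range,
        Finset.HasAntidiagonal.mem_antidiagonal] at hn ⊢
      omega
    rw [h4, sum_antidiagonal_derivation_eq_zero B (ad π γ 1) (ad π γ 2)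
      (fun x y => ad_bracket π γ x y _) hR n]
    exact zero_mem _
  · have hm' := (Finset.mem_filter.1 hm).2
    rcases le_total m.1 m.2 with h | h
    · exact bracket_mem_fil_right (fil_antitone (by omega) (ad_pow_mem_fil hγ R m.2)) _
    · exact bracket_mem_fil_left (fil_antitone (by omega) (ad_pow_mem_fil hγ R m.1)) _

/-! ### The construction of the gauge equivalence -/

/-- One step of the construction: if `exp(ad_γ) R` and `R'` agree up to weight `w`, then `γ` can be
corrected in weight `w` so that they agree up to weight `w + 1`. The partial sums of the exponential
series with `w + 2` terms suffice here, as the remainder has higher weight; they have at least the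
two terms needed for a correction to take effect. -/
lemma IsBFVModel.exists_correction [CharZero K] {J : Ideal P} {R R' : X K P M 1}
    (hR : IsBFVModel π J R) (hR' : MasterEquation π R')
    (hRR' : R' - R ∈ Sub K P M (fun _ _ c => 2 ≤ c) 1) (w : ℕ) {γ : X K P M 0}
    (hγ : γ ∈ Sub K P M (fun _ _ c => 2 ≤ c) 0)
    (hw : R' - expPart π γ 1 (w + 2) R ∈ fil K P M w 1) :
    ∃ γ' ∈ Sub K P M (fun _ _ c => 2 ≤ c) 0, γ' - γ ∈ fil K P M w 0 ∧
      R' - expPart π γ' 1 (w + 3) R ∈ fil K P M (w + 1) 1 := by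
  obtain ⟨g, -, hg⟩ := exists_isExpAd (π := π) hγ
  set R₁ := g 1 R with hR₁
  have hmaster : MasterEquation π R₁ := hR.master.of_expPart hγ fun N => hg 1 N R
  have hR₁R : R₁ - R ∈ Sub K P M (fun _ _ c => 2 ≤ c) 1 :=
    mem_Sub_of_approx fun N => ⟨_, expPart_sub_mem_sq hγ R N, by
      rw [sub_sub_sub_cancel_right]; exact fil_antitone (Nat.le_succ N) (hg 1 (N + 1) R)⟩
  set S := R' - R₁ with hS
  have hS2 : S ∈ Sub K P M (fun _ _ c => 2 ≤ c) 1 := by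
    rw [hS, ← sub_sub_sub_cancel_right R' R₁ R]; exact sub_mem hRR' hR₁R
  have hSw : S ∈ fil K P M w 1 := by
    rw [hS, ← sub_sub_sub_cancel_right R' R₁ (expPart π γ 1 (w + 2) R)]
    exact sub_mem hw (fil_antitone (by omega) (hg 1 (w + 2) R))
  -- `2 {R₁, S} + {S, S} = 0` by the two master equations, and `R₁ - R`, `S` lie in `I^{(2)}`.
  have hRS : bracket π 1 1 2 (by norm_num) R S ∈ fil K P M (w + 1) 2 := by
    have hsym : bracket π 1 1 2 (by norm_num) S R₁ = bracket π 1 1 2 (by norm_num) R₁ S := by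
      rw [bracket_X_skew π (by norm_num) (by norm_num), show sgn K (1 * 1) = -1 by simp [sgn]]
      exact (congrArg Neg.neg (neg_one_smul K
        (bracket π 1 1 2 (by norm_num) R₁ S))).trans (neg_neg _)
    have h1 : bracket π 1 1 2 (by norm_num) (R₁ + S) (R₁ + S) = 0 := by
      rw [hS, add_sub_cancel]; exact hR'
    have h0 : bracket π 1 1 2 (by norm_num) R₁ R₁ = 0 := hmaster
    simp only [map_add, LinearMap.add_apply, h0, hsym, zero_add] at h1
    have h2 : bracket π 1 1 2 (by norm_num) R S = (2 : K)⁻¹ • -bracket π 1 1 2 (by norm_num) S S -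
        bracket π 1 1 2 (by norm_num) (R₁ - R) S := by
      have h3 : (2 : K) • bracket π 1 1 2 (by norm_num) R₁ S =
          -bracket π 1 1 2 (by norm_num) S S := by
        rw [two_smul, eq_neg_iff_add_eq_zero, add_assoc]; exact h1
      rw [LinearMap.map_sub₂ _ R₁ R S, ← h3, inv_smul_smul₀ two_ne_zero, sub_sub_cancel]
    rw [h2]
    exact sub_mem (Submodule.smul_mem _ _ (neg_mem (bracket_mem_fil_succ hS2 hSw _)))
      (bracket_mem_fil_succ hR₁R hSw _)
  obtain ⟨η, hη2, hηw, hη⟩ := hR.exists_primitive π hS2 hSw hRS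
  refine ⟨γ + -η, add_mem hγ (neg_mem hη2), by simpa using hηw, ?_⟩
  have h3 := expPart_add_sub_mem_fil (π := π) hγ (neg_mem hη2) (neg_mem hηw) R (w + 1)
  have h4 : ad π (-η) 1 R = bracket π 1 0 1 (by norm_num) R η := by
    rw [bracket_X_skew π (by norm_num : (1 : ℤ) + 0 = 1) (by norm_num)]
    simp [ad, sgn_zero]
  have h5 : R' - expPart π (γ + -η) 1 (w + 3) R =
      (S - bracket π 1 0 1 (by norm_num) R η) + (R₁ - expPart π γ 1 (w + 3) R) -
        (expPart π (γ + -η) 1 (w + 3) R - expPart π γ 1 (w + 3) R - ad π (-η) 1 R) := by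
    rw [h4, hS]; abel
  rw [h5]
  exact sub_mem (add_mem hη (fil_antitone (by omega) (hg 1 (w + 3) R))) h3

end Exponential

end BFV

end

theorem mainTheorem3 {K : Type*} [Field K] [CharZero K]
    {P : Type*} [CommRing P] [Algebra K P] [IsNoetherianRing P]
    (π : BFV.PoissonStructure K P) (J : Ideal P) (hJ : BFV.IsCoisotropic π J)
    {M : ℕ+ → Type*} [∀ n, AddCommGroup (M n)] [∀ n, Module K (M n)]
    [∀ n, FiniteDimensional K (M n)]
    (R R' : BFV.X K P M 1) (hR : BFV.IsBFVModel π J R) (hR' : BFV.MasterEquation π R')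
    (h : BFV.SameInducedDifferential π R R') :
    ∃ γ ∈ BFV.IPow K P M 2 0, ∃ g : ∀ n : ℤ, BFV.X K P M n →ₗ[K] BFV.X K P M n,
      BFV.IsExpAd π γ g ∧ R' = g 1 R := by
  open BFV in
  have hRR' : R' - R ∈ Sub K P M (fun _ _ c => 2 ≤ c) 1 := by
    refine mem_of_bracket_mem_I π fun i j hij x => ?_
    have h1 := LinearMap.congr_fun (h i j hij) ((I K P M i).mkQ x)
    rw [dRQuot_mkQ, dRQuot_mkQ, eq_comm, ← sub_eq_zero, ← map_sub, Submodule.mkQ_apply,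
      Submodule.Quotient.mk_eq_zero] at h1
    simpa [dR] using h1
  have step := fun (w : ℕ) (γ : BFV.X K P M 0)
    (H : γ ∈ BFV.Sub K P M (fun _ _ c => 2 ≤ c) 0 ∧
      R' - BFV.expPart π γ 1 (w + 2) R ∈ BFV.fil K P M w 1) =>
    hR.exists_correction hR' hRR' w H.1 H.2
  choose! f hf using step
  let γ : ℕ → BFV.X K P M 0 := fun n => Nat.rec 0 f n
  have hγ : ∀ w, γ w ∈ BFV.Sub K P M (fun _ _ c => 2 ≤ c) 0 ∧
      R' - BFV.expPart π (γ w) 1 (w + 2) R ∈ BFV.fil K P M w 1 := by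
    intro w
    induction w with
    | zero => exact ⟨zero_mem _, BFV.Sub_mono (by intros; omega) (BFV.mem_Sub_true _)⟩
    | succ w ih => exact ⟨(hf w _ ih).1, (hf w _ ih).2.2⟩
  obtain ⟨L, hL, -⟩ := BFV.exists_limit (fun N => LinearMap.toSpanSingleton K _ (γ N))
    (fun N y => by
      simp only [LinearMap.toSpanSingleton_apply, ← smul_sub]
      exact Submodule.smul_mem _ _ (hf N _ (hγ N)).2.1)
  have hγL : ∀ N, L 1 - γ N ∈ BFV.fil K P M N 0 := fun N => by simpa using hL N 1
  have hL2 : L 1 ∈ BFV.Sub K P M (fun _ _ c => 2 ≤ c) 0 :=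
    BFV.mem_Sub_of_approx fun N => ⟨γ N, (hγ N).1, hγL N⟩
  obtain ⟨g, hg, hg'⟩ := BFV.exists_isExpAd (π := π) hL2
  refine ⟨L 1, BFV.mem_IPow_two_iff.2 hL2, g, hg, ?_⟩
  refine sub_eq_zero.1 (BFV.eq_zero_of_mem_fil fun w => ?_)
  have h1 := BFV.expPart_add_sub_mem_fil (π := π) (hγ w).1 (sub_mem hL2 (hγ w).1) (hγL w) R w
  rw [add_sub_cancel] at h1
  have h2 := BFV.ad_mem_fil_of_mem_fil (π := π) (hγL w) R
  have h3 : R' - g 1 R = (R' - BFV.expPart π (γ w) 1 (w + 2) R) -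
      (BFV.expPart π (L 1) 1 (w + 2) R - BFV.expPart π (γ w) 1 (w + 2) R -
        BFV.ad π (L 1 - γ w) 1 R) - BFV.ad π (L 1 - γ w) 1 R -
      (g 1 R - BFV.expPart π (L 1) 1 (w + 2) R) := by abel
  rw [h3]
  exact sub_mem (sub_mem (sub_mem (hγ w).2 (BFV.fil_antitone (Nat.le_succ w) h1)) h2)
    (BFV.fil_antitone (by omega) (hg' 1 (w + 2) R))
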